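/- Let $n\ge 1$, let $V=\mathbb R^{2n}$ carry the canonical coordinates $x_1,\dots,x_n,y_1,\dots,y_n$ and the symplectic form $\omega=\sum_i dx_i\wedge dy_i$, and let $G=\mathrm{Sp}(2n,\mathbb R)$ act linearly on $V$ and, by prolongation, on the space $J^\infty(V,2n-1)$ of jets of hypersurfaces $\Sigma\subset V$. For a jet at $p\in\Sigma$ let $v_0$ be the position vector of $p$, and let $Q=d^2_pq|_{T_p\Sigma}$, where $q$ is a local defining function of $\Sigma$ normalized by $d_pq(v_0)=1$. (If $\Sigma$ is the graph $y_n=u(x_1,\dots,x_n,y_1,\dots,y_{n-1})$, then $Q=d^2u/(\sum_i z_iu_{z_i}-u)$, where $z$ denotes the independent variables.) A *canonical frame* is a family $v_1,\dots,v_{2n-1}$ with * $T_p\Sigma=\langle v_1,\dots,v_{2n-1}\rangle$; * for $1\le r\le n$: $v_{2r-1}\perp_\omega v_j$ for $j\ge 2r-1$, $v_{2r-2}\perp_\omega v_j$ for $2r\le j\le 2n-1$, and $\omega(v_{2r-2},v_{2r-1})=1$; * for $1\le r\le n-1$: $v_{2r-1}\perp_Q v_j$ and $v_{2r}\perp_Qv_j$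 for $2r+1\le j\le 2n-1$, and $Q(v_{2r-1},v_{2r})=1$. **Theorem.** 1. There is a nonempty Zariski open set of 2-jets on which there is exactly one canonical frame; its components are rational functions on $J^2(V,2n-1)$ (and it is also the unique canonical frame over the field of rational functions on $J^\infty(V,2n-1)$). In it, $\omega^{-1}=v_0\wedge v_1+v_2\wedge v_3+\dots+v_{2n-2}\wedge v_{2n-1}$ (where $\omega^{-1}=\sum_i\partial_{x_i}\wedge\partial_{y_i}$), and, with $I_{2,i}:=Q(v_i,v_i)$, the Gram matrix of $Q$ is block diagonal with the $n-1$ blocks $\begin{pmatrix}I_{2,2r-1}&1\\1&I_{2,2r}\end{pmatrix}$, $1\le r\le n-1$, followed by the $1\times1$ block $(I_{2,2n-1})$. 2. The $I_{2,i}$ $(1\le i\le 2n-1)$ are rational differential invariants of order at most $2$. The horizontal derivations $\nabla_j$ corresponding to the $v_j$ $(1\le j\le 2n-1)$ are invariant derivations, linearly independent over the field of rational functions on $J^\infty(V,2n-1)$. 3. The $I_{2,i}$ and the $\nabla_j$ generate the rational differential invariants: the set of all $G$-invariant rational functions on $J^\infty(V,2n-1)$ is the smallest field of rational functions that contains $\mathbb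 R$ and all $I_{2,i}$ and is closed under all $\nabla_j$. 4. There are rational functions $I_{ij}^k$ with $[\nabla_i,\nabla_j]=\sum_k I_{ij}^k\nabla_k$, and the algebra $\mathcal A$ of all $G$-invariant rational functions on $J^\infty(V,2n-1)$ that are polynomial in the jet variables of order $>2$ (with coefficients rational in the 2-jet) is the smallest algebra that contains the field $\mathbb R(I_{2,1},\dots,I_{2,2n-1})$ and all structure coefficients $I_{ij}^k$ and is closed under all $\nabla_j$. -/

import Mathlib

open scoped ContDiff

noncomputable section

namespace SympHyp

/-! Throughout `n = m + 1`, so that `n ≥ 1`.  The symplectic space is `V = ℝ²ⁿ` with canonical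
coordinates `x₁, …, xₙ` (indices `inl i`) and `y₁, …, yₙ` (indices `inr i`), and a hypersurface is
locally the graph `yₙ = u(x₁, …, xₙ, y₁, …, yₙ₋₁)`. -/

/-- Index set of the `2n` canonical coordinates of `V`. -/
abbrev Idx (m : ℕ) : Type := Fin (m + 1) ⊕ Fin (m + 1)

/-- Index set of the `2n - 1` independent variables `x₁, …, xₙ, y₁, …, yₙ₋₁`. -/
abbrev Base (m : ℕ) : Type := Fin (m + 1) ⊕ Fin m

/-- The inclusion of the independent variables into all canonical coordinates. -/
def emb {m : ℕ} : Base m → Idx m := Sum.map id Fin.castSucc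

/-- The index of the dependent variable `yₙ`. -/
def dep {m : ℕ} : Idx m := Sum.inr (Fin.last m)

/-- The point `(x, u)` of `V` with independent variables `x` and dependent variable `u`. -/
def pt {m : ℕ} {F : Type*} (x : Base m → F) (u : F) : Idx m → F :=
  Sum.elim (fun i => x (Sum.inl i)) (Fin.snoc (fun i => x (Sum.inr i)) u)

/-- Coordinates on (a chart of) `J^∞(V, 2n-1)`: the independent variables `x i` and the
derivatives `u σ` of the dependent variable, `σ` being a multi-index. -/
inductive JetVar (m : ℕ) : Type
  | x (i : Base m) : JetVar m
  | u (σ : Base m →₀ ℕ) : JetVar m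

/-- The jet order of a coordinate. -/
def JetVar.ord {m : ℕ} : JetVar m → ℕ
  | .x _ => 0
  | .u σ => σ.degree

/-- Polynomial functions in jet coordinates. -/
abbrev JetPoly (m : ℕ) : Type := MvPolynomial (JetVar m) ℝ

/-- The field of rational functions on `J^∞(V, 2n-1)`. -/
abbrev JetRat (m : ℕ) : Type := FractionRing (JetPoly m)

/-- The coordinate functions, as rational functions (equivalently: the generic point of the jet
space). -/
def gen {m : ℕ} (t : JetVar m) : JetRat m := algebraMap (JetPoly m) (JetRat m) (MvPolynomial.X t)

/-- The field of rational functions on `J^k(V, 2n-1)`. -/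
def ratOrd (m k : ℕ) : IntermediateField ℝ (JetRat m) :=
  IntermediateField.adjoin ℝ (gen '' {t | t.ord ≤ k})

/-- The rational functions on `J^∞(V, 2n-1)` that are polynomial in the jet coordinates of
order `> 2` (and rational in those of order `≤ 2`). -/
def IsRatPoly {m : ℕ} (f : JetRat m) : Prop :=
  f ∈ Algebra.adjoin (ratOrd m 2) (gen '' {t | 2 < t.ord})

/-- The rational function `f` is defined at the jet `j` and has the value `c` there. -/
def HasValue {m : ℕ} (f : JetRat m) (j : JetVar m → ℝ) (c : ℝ) : Prop :=
  ∃ p q : JetPoly m, MvPolynomial.eval j q ≠ 0 ∧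
    f * algebraMap (JetPoly m) (JetRat m) q = algebraMap (JetPoly m) (JetRat m) p ∧
    c = MvPolynomial.eval j p / MvPolynomial.eval j q

/-! ### Total derivatives -/

/-- The unique extension of a derivation from a domain to its field of fractions. -/
def extendDer {A L : Type*} [CommRing A] [Field L] [Algebra ℝ A] [Algebra ℝ L] [Algebra A L]
    [IsScalarTower ℝ A L] [IsFractionRing A L] (d : Derivation ℝ A L) : Derivation ℝ L L :=
  haveI : Algebra.FormallyEtale A L := Algebra.FormallyEtale.of_isLocalization (nonZeroDivisors A)
  ((LinearMap.liftBaseChange L d.liftKaehlerDifferential) ∘ₗ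
    (KaehlerDifferential.tensorKaehlerEquivOfFormallyEtale ℝ A L).symm.toLinearMap).compDer
      (KaehlerDifferential.D ℝ L)

theorem extendDer_algebraMap {A L : Type*} [CommRing A] [Field L] [Algebra ℝ A] [Algebra ℝ L]
    [Algebra A L] [IsScalarTower ℝ A L] [IsFractionRing A L] (d : Derivation ℝ A L) (a : A) :
    extendDer d (algebraMap A L a) = d a := by
  have : Algebra.FormallyEtale A L := Algebra.FormallyEtale.of_isLocalization (nonZeroDivisors A)
  simp [extendDer, KaehlerDifferential.tensorKaehlerEquivOfFormallyEtale_symm_D_algebraMap]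

/-- The total derivative `D_i` with respect to the `i`-th independent variable,
`D_i = ∂/∂x_i + ∑_σ u_{σ+1_i} ∂/∂u_σ`. -/
def totalDer {m : ℕ} (i : Base m) : Derivation ℝ (JetRat m) (JetRat m) :=
  extendDer (MvPolynomial.mkDerivation ℝ (fun t : JetVar m => match t with
    | .x k => if i = k then (1 : JetRat m) else 0
    | .u σ => gen (.u (σ + Finsupp.single i 1))))

theorem totalDer_x {m : ℕ} (i k : Base m) :
    totalDer i (gen (.x k)) = if i = k then 1 else 0 := by
  simp [totalDer, gen, extendDer_algebraMap]

theorem totalDer_u {m : ℕ} (i : Base m) (σ : Base m →₀ ℕ) :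
    totalDer i (gen (.u σ)) = gen (.u (σ + Finsupp.single i 1)) := by
  simp [totalDer, gen, extendDer_algebraMap]

/-- The horizontal derivation `∑_i w^i D_i` that corresponds to a tangent vector field `w` of the
hypersurface (note that `w = ∑_i w^i (∂/∂x_i + u_i ∂/∂yₙ)` for tangent `w`). -/
def horizontal {m : ℕ} (w : Idx m → JetRat m) : Derivation ℝ (JetRat m) (JetRat m) :=
  ∑ i : Base m, w (emb i) • totalDer i

/-! ### The prolonged action of the symplectic group -/

/-- `j` is the `∞`-jet at `(a, u a)` of the hypersurface that is the graph of `u`. -/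
def IsJet {m : ℕ} (u : (Base m → ℝ) → ℝ) (a : Base m → ℝ) (j : JetVar m → ℝ) : Prop :=
  (∀ i, j (.x i) = a i) ∧
    ∀ (r : ℕ) (s : Fin r → Base m),
      j (.u (∑ l, Finsupp.single (s l) 1)) =
        iteratedFDeriv ℝ r u a (fun l => Pi.single (s l) 1)

/-- The prolongation of the linear map `g` maps the jet `j` to the jet `j'`: there are graphs of
smooth functions with these jets such that `g` maps the germ of the first hypersurface to the
germ of the second. -/
def MapsJet {m : ℕ} (g : Matrix (Idx m) (Idx m) ℝ) (j j' : JetVar m → ℝ) : Prop :=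
  ∃ (u u' : (Base m → ℝ) → ℝ) (a a' : Base m → ℝ),
    ContDiffAt ℝ ∞ u a ∧ ContDiffAt ℝ ∞ u' a' ∧ IsJet u a j ∧ IsJet u' a' j' ∧
    g.mulVec (pt a (u a)) = pt a' (u' a') ∧
    ∀ᶠ x in nhds a, ∃ x', g.mulVec (pt x (u x)) = pt x' (u' x')

/-- `f'` is the pull-back of `f` by the prolongation of `g`. -/
def IsPullback {m : ℕ} (g : Matrix (Idx m) (Idx m) ℝ) (f f' : JetRat m) : Prop :=
  ∀ j j' : JetVar m → ℝ, MapsJet g j j' →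
    ∀ c c' : ℝ, HasValue f' j c → HasValue f j' c' → c = c'

/-- Rational differential invariants of `Sp(2n, ℝ)`: rational functions on the jet space that are
constant along the orbits of the prolonged action. -/
def IsInvariant {m : ℕ} (f : JetRat m) : Prop :=
  ∀ g ∈ Matrix.symplecticGroup (Fin (m + 1)) ℝ, IsPullback g f f

/-- Invariant derivations: those commuting with the prolonged action of `Sp(2n, ℝ)`. -/
def IsInvariantDer {m : ℕ} (D : Derivation ℝ (JetRat m) (JetRat m)) : Prop :=
  ∀ g ∈ Matrix.symplecticGroup (Fin (m + 1)) ℝ, ∀ f f' : JetRat m,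
    IsPullback g f f' → IsPullback g (D f) (D f')

/-! ### Geometric data of a 2-jet

The following makes sense for jets with coordinates in any field `F`; it is used for actual jets
(`F = ℝ`) and for the generic jet (`F = JetRat m`, `j = gen`). -/

section data

variable {m : ℕ} {F : Type*} [Field F]

/-- The symplectic form `ω = ∑ dxᵢ ∧ dyᵢ`. -/
def omega (v w : Idx m → F) : F :=
  ∑ i, (v (Sum.inl i) * w (Sum.inr i) - v (Sum.inr i) * w (Sum.inl i))

/-- The position vector `v₀` of a jet. -/
def position (j : JetVar m → F) : Idx m → F := pt (fun i => j (.x i)) (j (.u 0))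

/-- The differential `dq` at the base point of the defining function `q = u(x) - yₙ`; its kernel
is the tangent space `T_pΣ`. -/
def dq (j : JetVar m → F) (w : Idx m → F) : F :=
  ∑ i : Base m, j (.u (Finsupp.single i 1)) * w (emb i) - w dep

/-- The second differential `d²q` of `q = u(x) - yₙ`. -/
def d2q (j : JetVar m → F) (v w : Idx m → F) : F :=
  ∑ i : Base m, ∑ k : Base m,
    j (.u (Finsupp.single i 1 + Finsupp.single k 1)) * v (emb i) * w (emb k)

/-- The second fundamental form `Q` (on tangent vectors): the second differential of the defining
function that is normalized by `dq(v₀) = 1`. -/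
def secondForm (j : JetVar m → F) (v w : Idx m → F) : F :=
  d2q j v w / dq j (position j)

/-- `v₁, …, v_{2n-1}`, together with the position vector `v₀`, is obtained by the alternating
`ω`- and `Q`-normalizations (indices run over `0, …, 2n - 1 = 2m + 1`). -/
structure IsCanonicalFrame (j : JetVar m → F) (v : Fin (2 * m + 1 + 1) → Idx m → F) : Prop where
  zero : v 0 = position j
  /-- Step 0: `T_pΣ = ⟨v₁, …, v_{2n-1}⟩`. -/
  span : ∀ w : Idx m → F,
    w ∈ Submodule.span F (Set.range fun i : Fin (2 * m + 1) => v i.succ) ↔ dq j w = 0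
  /-- Step `2r-1`: `v_{2r-1} ⊥_ω v_{2r-1}, …, v_{2n-1}`. -/
  omega_odd : ∀ i k, Odd i.val → i ≤ k → omega (v i) (v k) = 0
  /-- Step `2r-1`: `v_{2r-2} ⊥_ω v_{2r}, …, v_{2n-1}`. -/
  omega_even : ∀ i k, Even i.val → i.val + 2 ≤ k.val → omega (v i) (v k) = 0
  /-- Step `2r-1`: `ω(v_{2r-2}, v_{2r-1}) = 1`. -/
  omega_one : ∀ i k, Even i.val → k.val = i.val + 1 → omega (v i) (v k) = 1
  /-- Step `2r`: `v_{2r-1} ⊥_Q v_{2r+1}, …, v_{2n-1}`. -/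
  Q_odd : ∀ i k, Odd i.val → i.val + 2 ≤ k.val → secondForm j (v i) (v k) = 0
  /-- Step `2r`: `v_{2r} ⊥_Q v_{2r+1}, …, v_{2n-1}`. -/
  Q_even : ∀ i k, i ≠ 0 → Even i.val → i < k → secondForm j (v i) (v k) = 0
  /-- Step `2r`: `Q(v_{2r-1}, v_{2r}) = 1`. -/
  Q_one : ∀ i k, Odd i.val → k.val = i.val + 1 → secondForm j (v i) (v k) = 1

/-- `I_{2,i} = Q(v_i, v_i)`, `1 ≤ i ≤ 2n-1`. -/
def gramDiag (j : JetVar m → F) (v : Fin (2 * m + 1 + 1) → Idx m → F) (i : Fin (2 * m + 1)) : F :=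
  secondForm j (v i.succ) (v i.succ)

/-- The block diagonal matrix with rows and columns numbered `1, …, 2n-1` (`0, …, 2m` in the code)
that has `m = n-1` blocks `(I_{2r-1}, 1; 1, I_{2r})` and a last block `(I_{2n-1})`. -/
def blockGram (I : Fin (2 * m + 1) → F) : Matrix (Fin (2 * m + 1)) (Fin (2 * m + 1)) F :=
  fun i k =>
    if i = k then I i
    else if (Even i.val ∧ k.val = i.val + 1) ∨ (Even k.val ∧ i.val = k.val + 1) then 1
    else 0

/-- The normal form of the data in a frame: `ω⁻¹ = v₀∧v₁ + v₂∧v₃ + ⋯ + v_{2n-2}∧v_{2n-1}`,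
where `ω⁻¹ = ∑ ∂/∂xᵢ ∧ ∂/∂yᵢ`, and the Gram matrix of `Q` is block diagonal. -/
def HasNormalForm (j : JetVar m → F) (v : Fin (2 * m + 1 + 1) → Idx m → F) : Prop :=
  (∀ a b : Idx m,
    ∑ i, ∑ k, (if Even i.val ∧ k.val = i.val + 1 then v i a * v k b - v k a * v i b else 0) =
      (-Matrix.J (Fin (m + 1)) F) a b) ∧
  Matrix.of (fun i k : Fin (2 * m + 1) => secondForm j (v i.succ) (v k.succ)) =
    blockGram (gramDiag j v)

end data

/-! ### Generation by invariants and derivations -/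

/-- The smallest field of rational functions that contains the constants and the functions `I i`
and is closed under the derivations `D k`. -/
def diffField {m : ℕ} {ι κ : Type*} (I : ι → JetRat m)
    (D : κ → Derivation ℝ (JetRat m) (JetRat m)) : IntermediateField ℝ (JetRat m) :=
  sInf {E | (∀ i, I i ∈ E) ∧ ∀ k, ∀ f ∈ E, D k f ∈ E}

/-- The smallest algebra of rational functions that contains all rational expressions in the
`I i` and the functions `c l`, and is closed under the derivations `D k`. -/
def diffAlgebra {m : ℕ} {ι κ ν : Type*} (I : ι → JetRat m) (c : ν → JetRat m)
    (D : κ → Derivation ℝ (JetRat m) (JetRat m)) : Subalgebra ℝ (JetRat m) :=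
  sInf {S | (∀ f ∈ IntermediateField.adjoin ℝ (Set.range I), f ∈ S) ∧ (∀ l, c l ∈ S) ∧
    ∀ k, ∀ f ∈ S, D k f ∈ S}

end SympHyp

end

/-! The normalizations are an alternating Gram–Schmidt process for `ω` and `Q` in which every choice
is forced. Uniqueness is linear algebra: the difference of two canonical frames, like the derivative
of a single one, satisfies the linearized relations, and `IsCanonicalFrame.rigid` kills such a
variation vector by vector, using that `ω` is nondegenerate on `V` and `Q` on the tangent space. For
existence, at one explicit 2-jet the standard symplectic basis is canonical and all pivots of the
process are nonzero; the process therefore runs over the local ring of that jet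
(`exists_adapted_basis`, `exists_generic_frame`), and the components come out as rational functions
of the 2-jet.

The prolonged action of `g` becomes a field homomorphism `pullback`, which agrees with the geometric
definition (`isPullback_iff`) because generic jets are jets of polynomial graphs and images of
transversal graphs are graphs. The pulled back frame and the frame moved by `g` are both canonical
for the pulled back jet, so they coincide (`IsCanonicalFrame.pullback_eq`). Hence the `I_{2,i}`, the
derivations `∇_k` and the structure coefficients are invariant.

For generation, `Sp` acts transitively on symplectic bases. If an invariant is a quotient of
polynomials in the frame components with invariant coefficients, these components can be replaced by
constants (`IsCanonicalFrame.exists_specialization`), and only the coefficients remain. It thus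
suffices to write all jet coordinates in terms of the frame and of the proposed generators. For
2-jets this is `ratOrd_le`. Higher coordinates come from total derivatives, which are combinations
of the `∇_k`; this needs the coefficients of `∇_i v_b` in the frame. Modulo the algebra generated by
the `I_{2,i}`, the structure coefficients and the `∇_k`, the two trilinear objects `ω(∇_i v_b, v_a)`
and `Q(v_a, ∇_i v_b)` (tangential part) are totally symmetric: `ω` is constant, the bracket gives
the torsion, and `Q` satisfies a Codazzi equation. The sparse normal forms of `ω` and `Q` then
determine the coefficients one upper index after the other (`IsCanonicalFrame.christoffel_mem`).

For the field, the structure coefficients are redundant: they solve the linear system `[∇_i, ∇_k]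
I_a = ∑ c_l ∇_l I_a`. Its matrix is invertible, because a vertical derivation of third order maps it
to the identity matrix (`thirdDer_nabla_gramDiag`), which is impossible for a singular matrix
(`det_ne_zero_of_derivation`). -/

noncomputable section

namespace SympHyp

variable {m : ℕ}

/-! ### Rational functions on the jet space -/

/-- Polynomial functions, as rational functions. -/
abbrev toRat (p : JetPoly m) : JetRat m := algebraMap (JetPoly m) (JetRat m) p

theorem toRat_injective : Function.Injective (toRat : JetPoly m → JetRat m) :=
  IsFractionRing.injective (JetPoly m) (JetRat m)

theorem toRat_ne_zero {p : JetPoly m} : toRat p ≠ 0 ↔ p ≠ 0 := by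
  rw [Ne, Ne, ← map_zero (algebraMap (JetPoly m) (JetRat m)), toRat_injective.eq_iff]

theorem ne_zero_of_eval_ne_zero {j : JetVar m → ℝ} {p : JetPoly m}
    (h : MvPolynomial.eval j p ≠ 0) : p ≠ 0 := by
  rintro rfl; simp at h

theorem toRat_ne_zero_of_eval {j : JetVar m → ℝ} {p : JetPoly m}
    (h : MvPolynomial.eval j p ≠ 0) : toRat p ≠ 0 :=
  toRat_ne_zero.2 (ne_zero_of_eval_ne_zero h)

theorem aeval_gen (p : JetPoly m) : MvPolynomial.aeval gen p = toRat p := by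
  have : (MvPolynomial.aeval gen : JetPoly m →ₐ[ℝ] JetRat m) =
      Algebra.algHom ℝ (JetPoly m) (JetRat m) := by
    refine MvPolynomial.algHom_ext fun t => ?_
    rw [MvPolynomial.aeval_X]; rfl
  rw [this]; rfl

theorem toRat_X (t : JetVar m) : toRat (MvPolynomial.X t) = gen t := rfl

theorem toRat_C (c : ℝ) : toRat (MvPolynomial.C c : JetPoly m) = algebraMap ℝ (JetRat m) c :=
  (IsScalarTower.algebraMap_apply ℝ (JetPoly m) (JetRat m) c).symm

theorem exists_num_denom (f : JetRat m) :
    ∃ p q : JetPoly m, q ≠ 0 ∧ f * toRat q = toRat p := by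
  obtain ⟨p, q, hq, rfl⟩ := IsFractionRing.div_surjective (A := JetPoly m) f
  have hq' := nonZeroDivisors.ne_zero hq
  exact ⟨p, q, hq', div_mul_cancel₀ _ (toRat_ne_zero.2 hq')⟩

theorem exists_eval_ne_zero {p : JetPoly m} (hp : p ≠ 0) : ∃ j, MvPolynomial.eval j p ≠ 0 := by
  by_contra! h
  exact hp (MvPolynomial.funext fun j => by simpa using h j)

/-- Induction on rational functions. -/
theorem jetRat_induction {P : JetRat m → Prop} (const : ∀ c : ℝ, P (algebraMap ℝ _ c))
    (hgen : ∀ t, P (gen t)) (add : ∀ f g, P f → P g → P (f + g))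
    (mul : ∀ f g, P f → P g → P (f * g)) (inv : ∀ f, P f → P f⁻¹) (f : JetRat m) : P f := by
  have hpoly : ∀ p : JetPoly m, P (toRat p) := by
    intro p
    induction p using MvPolynomial.induction_on with
    | C a => rw [toRat_C]; exact const a
    | add p q hp hq => simpa using add _ _ hp hq
    | mul_X p t hp => rw [toRat, map_mul]; exact mul _ _ hp (hgen t)
  obtain ⟨p, q, hq, h⟩ := exists_num_denom f
  rw [(eq_div_iff (toRat_ne_zero.2 hq)).2 h, div_eq_mul_inv]
  exact mul _ _ (hpoly p) (inv _ (hpoly q))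

/-- Numerator and denominator can be kept free of higher jet variables; this is what makes the
Zariski open domain of the frame an open set of 2-jets. -/
theorem exists_num_denom_of_mem_ratOrd {k : ℕ} {f : JetRat m} (hf : f ∈ ratOrd m k) :
    ∃ p q : JetPoly m, q ≠ 0 ∧ f * toRat q = toRat p ∧
      (∀ t ∈ p.vars, t.ord ≤ k) ∧ ∀ t ∈ q.vars, t.ord ≤ k := by
  classical
  rw [ratOrd, Set.image_eq_range, IntermediateField.mem_adjoin_range_iff] at hf
  obtain ⟨r, s, rfl⟩ := hf
  have key : ∀ r : MvPolynomial {t : JetVar m | t.ord ≤ k} ℝ,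
      MvPolynomial.aeval (fun x : {t : JetVar m | t.ord ≤ k} => gen x.1) r =
        toRat (MvPolynomial.rename Subtype.val r) := fun r => by
    rw [← aeval_gen, MvPolynomial.aeval_rename]; rfl
  have hv : ∀ r : MvPolynomial {t : JetVar m | t.ord ≤ k} ℝ,
      ∀ t ∈ (MvPolynomial.rename Subtype.val r).vars, t.ord ≤ k := fun r t ht => by
    obtain ⟨x, -, rfl⟩ := Finset.mem_image.1 (MvPolynomial.vars_rename _ r ht)
    exact x.2
  rw [key, key]
  -- The presentation as a quotient allows the denominator zero; the quotient is then `0` by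
  -- convention and is rewritten as `0 / 1`.
  by_cases h0 : MvPolynomial.rename Subtype.val s = 0
  · exact ⟨0, 1, one_ne_zero, by rw [h0]; simp, by simp, by simp⟩
  · exact ⟨_, _, h0, div_mul_cancel₀ _ (toRat_ne_zero.2 h0), hv r, hv s⟩

theorem gen_mem_ratOrd {t : JetVar m} {k : ℕ} (h : t.ord ≤ k) : gen t ∈ ratOrd m k :=
  IntermediateField.subset_adjoin _ _ ⟨t, h, rfl⟩

/-! ### Values -/

/-- Two fractions for the same rational function have equal cross products as polynomials, so their
quotients agree wherever both denominators are nonzero. -/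
theorem HasValue.unique {f : JetRat m} {j : JetVar m → ℝ} {c c' : ℝ}
    (h : HasValue f j c) (h' : HasValue f j c') : c = c' := by
  obtain ⟨p, q, hq, hf, rfl⟩ := h
  obtain ⟨p', q', hq', hf', rfl⟩ := h'
  have : p * q' = p' * q := toRat_injective (m := m) (by
    simp only [toRat, map_mul] at *
    rw [← hf, ← hf']; ring)
  rw [div_eq_div_iff hq hq', ← map_mul, ← map_mul, this]

theorem HasValue.toRat (j : JetVar m → ℝ) (p : JetPoly m) :
    HasValue (toRat p) j (MvPolynomial.eval j p) :=
  ⟨p, 1, by simp, by simp, by simp⟩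

theorem HasValue.gen (j : JetVar m → ℝ) (t : JetVar m) : HasValue (gen t) j (j t) := by
  simpa [toRat_X] using HasValue.toRat j (MvPolynomial.X t)

theorem HasValue.const (j : JetVar m → ℝ) (c : ℝ) : HasValue (algebraMap ℝ _ c) j c := by
  simpa [toRat_C] using HasValue.toRat j (MvPolynomial.C c)

theorem HasValue.zero (j : JetVar m → ℝ) : HasValue 0 j 0 := by simpa using HasValue.const j 0

theorem HasValue.one (j : JetVar m → ℝ) : HasValue 1 j 1 := by simpa using HasValue.const j 1

theorem HasValue.add {f g : JetRat m} {j : JetVar m → ℝ} {c d : ℝ}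
    (hf : HasValue f j c) (hg : HasValue g j d) : HasValue (f + g) j (c + d) := by
  obtain ⟨p, q, hq, hf, rfl⟩ := hf
  obtain ⟨p', q', hq', hf', rfl⟩ := hg
  refine ⟨p * q' + p' * q, q * q', by simp [hq, hq'], ?_, by
    simp only [map_add, map_mul]; field_simp⟩
  simp only [map_add, map_mul, ← hf, ← hf']; ring

theorem HasValue.mul {f g : JetRat m} {j : JetVar m → ℝ} {c d : ℝ}
    (hf : HasValue f j c) (hg : HasValue g j d) : HasValue (f * g) j (c * d) := by
  obtain ⟨p, q, hq, hf, rfl⟩ := hf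
  obtain ⟨p', q', hq', hf', rfl⟩ := hg
  refine ⟨p * p', q * q', by simp [hq, hq'], ?_, by
    simp only [map_mul]; field_simp⟩
  simp only [map_mul, ← hf, ← hf']; ring

theorem HasValue.inv {f : JetRat m} {j : JetVar m → ℝ} {c : ℝ}
    (hf : HasValue f j c) (hc : c ≠ 0) : HasValue f⁻¹ j c⁻¹ := by
  obtain ⟨p, q, hq, hf, rfl⟩ := hf
  have hp : MvPolynomial.eval j p ≠ 0 := fun h => hc (by simp [h])
  refine ⟨q, p, hp, ?_, by rw [inv_div]⟩
  have hf0 : f ≠ 0 := by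
    rintro rfl
    exact toRat_ne_zero_of_eval hp (by simpa [SympHyp.toRat] using hf.symm)
  rw [← hf, inv_mul_cancel_left₀ hf0]

theorem HasValue.neg {f : JetRat m} {j : JetVar m → ℝ} {c : ℝ} (hf : HasValue f j c) :
    HasValue (-f) j (-c) := by
  simpa using (HasValue.const j (-1)).mul hf

theorem HasValue.sub {f g : JetRat m} {j : JetVar m → ℝ} {c d : ℝ}
    (hf : HasValue f j c) (hg : HasValue g j d) : HasValue (f - g) j (c - d) := by
  simpa [sub_eq_add_neg] using hf.add hg.neg

theorem HasValue.div {f g : JetRat m} {j : JetVar m → ℝ} {c d : ℝ}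
    (hf : HasValue f j c) (hg : HasValue g j d) (hd : d ≠ 0) : HasValue (f / g) j (c / d) := by
  simpa [div_eq_mul_inv] using hf.mul (hg.inv hd)

theorem HasValue.sum {ι : Type*} (s : Finset ι) {f : ι → JetRat m} {j : JetVar m → ℝ} {c : ι → ℝ}
    (h : ∀ i ∈ s, HasValue (f i) j (c i)) : HasValue (∑ i ∈ s, f i) j (∑ i ∈ s, c i) := by
  classical
  induction s using Finset.induction_on with
  | empty => simpa using HasValue.zero j
  | insert a s ha ih =>
    rw [Finset.sum_insert ha, Finset.sum_insert ha]
    exact (h a (by simp)).add (ih fun i hi => h i (by simp [hi]))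

theorem HasValue.aeval {ι : Type*} {f : ι → JetRat m} {j : JetVar m → ℝ} {c : ι → ℝ}
    (p : MvPolynomial ι ℝ) (h : ∀ i ∈ p.vars, HasValue (f i) j (c i)) :
    HasValue (MvPolynomial.aeval f p) j (MvPolynomial.aeval c p) := by
  classical
  rw [MvPolynomial.aeval_def, MvPolynomial.eval₂_eq, MvPolynomial.aeval_def,
    MvPolynomial.eval₂_eq]
  refine HasValue.sum _ fun d hd => (HasValue.const j _).mul ?_
  have : ∀ (s : Finset ι) (_ : s ⊆ p.vars),
      HasValue (∏ i ∈ s, f i ^ d i) j (∏ i ∈ s, c i ^ d i) := by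
    intro s
    induction s using Finset.induction_on with
    | empty => intro _; simpa using HasValue.one j
    | insert a s ha ih =>
      intro hs
      rw [Finset.prod_insert ha, Finset.prod_insert ha]
      refine HasValue.mul ?_ (ih fun i hi => hs (by simp [hi]))
      have h1 := h a (hs (by simp))
      induction d a with
      | zero => simpa using HasValue.one j
      | succ n ihn => rw [pow_succ, pow_succ]; exact ihn.mul h1
  refine this _ fun i hi => (MvPolynomial.mem_vars_iff_mem_support i).2 ⟨d, hd, hi⟩

/-! ### Derivations of the field of rational functions -/

theorem derivation_ext {d d' : Derivation ℝ (JetRat m) (JetRat m)}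
    (h : ∀ t, d (gen t) = d' (gen t)) : d = d' := by
  ext f
  induction f using jetRat_induction with
  | const c => simp
  | hgen t => exact h t
  | add f g hf hg => simp [hf, hg]
  | mul f g hf hg => simp [hf, hg]
  | inv f hf => simp [Derivation.leibniz_inv, hf]

/-- The derivation with prescribed values on the coordinate functions. -/
def genDer (w : JetVar m → JetRat m) : Derivation ℝ (JetRat m) (JetRat m) :=
  extendDer (MvPolynomial.mkDerivation ℝ w)

theorem genDer_gen (w : JetVar m → JetRat m) (t : JetVar m) : genDer w (gen t) = w t := by
  simp [genDer, gen, extendDer_algebraMap]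

theorem totalDer_comm (i k : Base m) (f : JetRat m) :
    totalDer i (totalDer k f) = totalDer k (totalDer i f) := by
  have : ⁅totalDer i, totalDer k⁆ = (0 : Derivation ℝ (JetRat m) (JetRat m)) := by
    refine derivation_ext fun t => ?_
    rw [Derivation.commutator_apply]
    cases t with
    | x l => simp only [totalDer_x]; split_ifs <;> simp
    | u σ => simp [totalDer_u, add_right_comm]
  have h := congrArg (fun d => d f) this
  simp only [Derivation.commutator_apply, Derivation.zero_apply, sub_eq_zero] at h
  exact h

theorem horizontal_apply (w : Idx m → JetRat m) (f : JetRat m) :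
    horizontal w f = ∑ i, w (emb i) * totalDer i f := by
  have : ∀ s : Finset (Base m), (∑ i ∈ s, w (emb i) • totalDer i) f =
      ∑ i ∈ s, w (emb i) * totalDer i f := by
    intro s
    induction s using Finset.cons_induction with
    | empty => simp
    | cons a s ha ih => rw [Finset.sum_cons, Finset.sum_cons, Derivation.add_apply, ih]; rfl
  exact this _

/-! ### Points and coordinates -/

section coordinates

variable {m : ℕ} {F : Type*}

@[simp] theorem pt_emb (x : Base m → F) (u : F) (i : Base m) : pt x u (emb i) = x i := by
  cases i <;> simp [pt, emb]

@[simp] theorem pt_dep (x : Base m → F) (u : F) : pt x u dep = u := by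
  simp [pt, dep]

theorem idx_cases {P : Idx m → Prop} (h : ∀ i, P (emb i)) (h' : P dep) (a : Idx m) : P a := by
  rcases a with i | i
  · exact h (Sum.inl i)
  · induction i using Fin.lastCases with
    | last => exact h'
    | cast i => exact h (Sum.inr i)

theorem idx_ext {v w : Idx m → F} (h : ∀ i, v (emb i) = w (emb i)) (h' : v dep = w dep) : v = w :=
  funext (idx_cases h h')

theorem emb_ne_dep (i : Base m) : emb i ≠ dep := by
  rcases i with i | i
  · simp [emb, dep]
  · simp [emb, dep]

theorem emb_injective : Function.Injective (emb : Base m → Idx m) := by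
  intro i k h
  rcases i with i | i <;> rcases k with k | k <;> simp_all [emb]

theorem sum_idx {A : Type*} [AddCommMonoid A] (f : Idx m → A) :
    ∑ a, f a = ∑ i : Base m, f (emb i) + f dep := by
  rw [Fintype.sum_sum_type, Fintype.sum_sum_type, Fin.sum_univ_castSucc (fun i => f (Sum.inr i)),
    ← add_assoc]
  rfl

end coordinates

section frames

variable {m : ℕ} {F : Type*} [Field F]

/-! ### The forms as (bi)linear maps -/

/-- `ω` as a bilinear map. -/
def omegaB : LinearMap.BilinForm F (Idx m → F) :=
  LinearMap.mk₂ F omega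
    (fun v v' w => by simp only [omega, ← Finset.sum_add_distrib, Pi.add_apply]; congr 1; ext; ring)
    (fun c v w => by
      simp only [omega, Finset.mul_sum, Pi.smul_apply, smul_eq_mul]; congr 1; ext; ring)
    (fun v w w' => by simp only [omega, ← Finset.sum_add_distrib, Pi.add_apply]; congr 1; ext; ring)
    (fun c v w => by
      simp only [omega, Finset.mul_sum, Pi.smul_apply, smul_eq_mul]; congr 1; ext; ring)

theorem omegaB_apply (v w : Idx m → F) : omegaB v w = omega v w := rfl

theorem omega_self (v : Idx m → F) : omega v v = 0 := by
  simp [omega, mul_comm]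

theorem omega_skew (v w : Idx m → F) : omega v w = -omega w v := by
  simp only [omega, ← Finset.sum_neg_distrib]; congr 1; ext; ring

/-- `dq` as a linear map. -/
def dqL (j : JetVar m → F) : (Idx m → F) →ₗ[F] F where
  toFun := dq j
  map_add' v w := by
    simp only [dq, Pi.add_apply, mul_add, Finset.sum_add_distrib]; ring
  map_smul' c v := by
    simp only [dq, Pi.smul_apply, smul_eq_mul, mul_sub, Finset.mul_sum, RingHom.id_apply]
    congr 1; refine Finset.sum_congr rfl fun i _ => by ring

theorem dqL_apply (j : JetVar m → F) (v : Idx m → F) : dqL j v = dq j v := rfl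

/-- The second fundamental form as a bilinear map. -/
def secB (j : JetVar m → F) : LinearMap.BilinForm F (Idx m → F) :=
  LinearMap.mk₂ F (secondForm j)
    (fun v v' w => by
      simp only [secondForm, d2q, ← add_div, ← Finset.sum_add_distrib, Pi.add_apply]
      congr 1; refine Finset.sum_congr rfl fun i _ => Finset.sum_congr rfl fun k _ => by ring)
    (fun c v w => by
      simp only [secondForm, d2q, smul_eq_mul, ← mul_div_assoc, Finset.mul_sum, Pi.smul_apply]
      congr 1; refine Finset.sum_congr rfl fun i _ => Finset.sum_congr rfl fun k _ => by ring)
    (fun v w w' => by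
      simp only [secondForm, d2q, ← add_div, ← Finset.sum_add_distrib, Pi.add_apply]
      congr 1; refine Finset.sum_congr rfl fun i _ => Finset.sum_congr rfl fun k _ => by ring)
    (fun c v w => by
      simp only [secondForm, d2q, smul_eq_mul, ← mul_div_assoc, Finset.mul_sum, Pi.smul_apply]
      congr 1; refine Finset.sum_congr rfl fun i _ => Finset.sum_congr rfl fun k _ => by ring)

theorem secB_apply (j : JetVar m → F) (v w : Idx m → F) : secB j v w = secondForm j v w := rfl

theorem d2q_symm (j : JetVar m → F) (v w : Idx m → F) : d2q j v w = d2q j w v := by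
  rw [d2q, Finset.sum_comm]
  refine Finset.sum_congr rfl fun i _ => Finset.sum_congr rfl fun k _ => ?_
  rw [add_comm]; ring

theorem secondForm_symm (j : JetVar m → F) (v w : Idx m → F) :
    secondForm j v w = secondForm j w v := by
  rw [secondForm, d2q_symm, secondForm]

/-- The Hessian matrix `u_{ik}`. -/
def hess (j : JetVar m → F) : Matrix (Base m) (Base m) F :=
  Matrix.of fun i k => j (.u (Finsupp.single i 1 + Finsupp.single k 1))

/-- The tangent vector with given components along the independent variables. -/
def tangentVec (j : JetVar m → F) (ξ : Base m → F) : Idx m → F :=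
  pt ξ (∑ i, j (.u (Finsupp.single i 1)) * ξ i)

theorem dq_tangentVec (j : JetVar m → F) (ξ : Base m → F) : dq j (tangentVec j ξ) = 0 := by
  simp [dq, tangentVec]

theorem eq_tangentVec {j : JetVar m → F} {w : Idx m → F} (h : dq j w = 0) :
    w = tangentVec j (fun i => w (emb i)) :=
  idx_ext (by simp [tangentVec]) (by rw [tangentVec, pt_dep]; exact (sub_eq_zero.1 h).symm)

/-- A tangent vector is determined by its components along the independent variables, and these are
arbitrary. On tangent vectors `Q` is therefore the Hessian divided by `dq(v₀)`, and an invertible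
Hessian makes it nondegenerate. -/
theorem eq_zero_of_secondForm {j : JetVar m → F} (hlam : dq j (position j) ≠ 0)
    (hH : (hess j).det ≠ 0) {y : Idx m → F} (hy : dq j y = 0)
    (h : ∀ z, dq j z = 0 → secondForm j y z = 0) : y = 0 := by
  have h0 : (fun i => y (emb i)) = 0 := by
    refine Matrix.eq_zero_of_vecMul_eq_zero hH (funext fun k => ?_)
    have h1 := h _ (dq_tangentVec j (Pi.single k 1))
    rw [secondForm, div_eq_zero_iff, or_iff_left hlam] at h1
    rw [Pi.zero_apply, ← h1]
    simp [d2q, tangentVec, Matrix.vecMul, dotProduct, hess, Pi.single_apply, mul_comm,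
      -Fintype.sum_sum_type]
  rw [eq_tangentVec hy, h0]
  exact idx_ext (by simp [tangentVec]) (by simp [tangentVec])

/-! ### Symplectic bases -/

/-- The index of the partner of a member of a symplectic basis. -/
def partner (k : Fin (2 * m + 1 + 1)) : Fin (2 * m + 1 + 1) :=
  if h : Even k.val then ⟨k.val + 1, by obtain ⟨r, hr⟩ := h; omega⟩ else ⟨k.val - 1, by omega⟩

theorem partner_of_even {k : Fin (2 * m + 1 + 1)} (h : Even k.val) :
    (partner k).val = k.val + 1 := by
  simp [partner, h]

theorem partner_of_odd {k : Fin (2 * m + 1 + 1)} (h : Odd k.val) :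
    (partner k).val + 1 = k.val := by
  have := h.pos
  simp [partner, Nat.not_even_iff_odd.2 h]; omega

theorem even_partner {k : Fin (2 * m + 1 + 1)} : Even (partner k).val ↔ Odd k.val := by
  rcases Nat.even_or_odd k.val with h | h
  · have := partner_of_even h; grind
  · have := partner_of_odd h; grind

@[simp] theorem partner_partner (k : Fin (2 * m + 1 + 1)) : partner (partner k) = k := by
  apply Fin.ext
  rcases Nat.even_or_odd k.val with h | h
  · have h1 := partner_of_even h
    have h2 : Odd (partner k).val := by grind
    have := partner_of_odd h2; omega
  · have h1 := partner_of_odd h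
    have h2 : Even (partner k).val := by grind
    have := partner_of_even h2; omega

theorem partner_lt_iff {k : Fin (2 * m + 1 + 1)} {r : ℕ} :
    (partner k).val < 2 * r ↔ k.val < 2 * r := by
  rcases Nat.even_or_odd k.val with h | h
  · have h1 := partner_of_even h
    obtain ⟨t, ht⟩ := h; omega
  · have h1 := partner_of_odd h
    obtain ⟨t, ht⟩ := h; omega

/-- The sign attached to a member of a symplectic basis. -/
def sgn (F : Type*) [Field F] (k : Fin (2 * m + 1 + 1)) : F := if Even k.val then 1 else -1

theorem sgn_mul_self (k : Fin (2 * m + 1 + 1)) : sgn F k * sgn F k = 1 := by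
  unfold sgn; split_ifs <;> simp

/-- `v` is a symplectic basis, ordered as `e₀, f₀, e₁, f₁, …`. -/
def IsDarboux (v : Fin (2 * m + 1 + 1) → Idx m → F) : Prop :=
  ∀ i k, omega (v i) (v k) = if k = partner i then sgn F i else 0

/-- The coordinates with respect to a symplectic basis. -/
def coord (v : Fin (2 * m + 1 + 1) → Idx m → F) (k : Fin (2 * m + 1 + 1)) (y : Idx m → F) : F :=
  sgn F k * omega y (v (partner k))

/-- The three hypotheses list the pairings of `v i` with `v k` for `i ≤ k`; skew symmetry supplies
the others. -/
theorem isDarboux_of_omega {v : Fin (2 * m + 1 + 1) → Idx m → F}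
    (h1 : ∀ i k, Odd i.val → i ≤ k → omega (v i) (v k) = 0)
    (h2 : ∀ i k, Even i.val → i.val + 2 ≤ k.val → omega (v i) (v k) = 0)
    (h3 : ∀ i k, Even i.val → k.val = i.val + 1 → omega (v i) (v k) = 1) : IsDarboux v := by
  have key : ∀ i k : Fin (2 * m + 1 + 1), i ≤ k →
      omega (v i) (v k) = if k = partner i then sgn F i else 0 := by
    intro i k hik
    rcases Nat.even_or_odd i.val with hi | hi
    · have hp := partner_of_even hi
      rcases lt_trichotomy k.val (i.val + 1) with hk | hk | hk
      · have : k = i := Fin.ext (by have : i.val ≤ k.val := hik; omega)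
        subst this
        rw [omega_self, if_neg]
        intro h; have := congrArg Fin.val h; omega
      · rw [h3 i k hi hk, if_pos (Fin.ext (by omega)), sgn, if_pos hi]
      · rw [h2 i k hi hk, if_neg]
        intro h; have := congrArg Fin.val h; omega
    · have hp := partner_of_odd hi
      rw [h1 i k hi hik, if_neg]
      intro h; have := congrArg Fin.val h; have : i.val ≤ k.val := hik; omega
  intro i k
  rcases le_total i k with hik | hik
  · exact key i k hik
  · rw [omega_skew, key k i hik]
    by_cases h : i = partner k
    · have h' : k = partner i := by rw [h, partner_partner]
      rw [if_pos h, if_pos h']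
      rcases Nat.even_or_odd k.val with hk | hk
      · have : Odd i.val := by rw [h, partner_of_even hk]; exact hk.add_one
        simp [sgn, hk, Nat.not_even_iff_odd.2 this]
      · have : Even i.val := by rw [h, even_partner]; exact hk
        simp [sgn, this, Nat.not_even_iff_odd.2 hk]
    · rw [if_neg h, if_neg (fun h' => h (by rw [h', partner_partner])), neg_zero]

variable {v : Fin (2 * m + 1 + 1) → Idx m → F}

theorem IsDarboux.coord_self (h : IsDarboux v) (k i : Fin (2 * m + 1 + 1)) :
    coord v k (v i) = if k = i then 1 else 0 := by
  rw [coord, h]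
  by_cases hk : k = i
  · subst hk; simp [sgn_mul_self]
  · rw [if_neg, if_neg hk, mul_zero]
    intro h'; exact hk (by rw [← partner_partner k, h', partner_partner])

theorem coord_add (k : Fin (2 * m + 1 + 1)) (y z : Idx m → F) :
    coord v k (y + z) = coord v k y + coord v k z := by
  simp only [coord, ← omegaB_apply, map_add, LinearMap.add_apply, mul_add]

theorem coord_smul (k : Fin (2 * m + 1 + 1)) (c : F) (y : Idx m → F) :
    coord v k (c • y) = c * coord v k y := by
  simp only [coord, ← omegaB_apply, map_smul, LinearMap.smul_apply, smul_eq_mul]; ring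

theorem coord_sub (k : Fin (2 * m + 1 + 1)) (y z : Idx m → F) :
    coord v k (y - z) = coord v k y - coord v k z := by
  simp only [coord, ← omegaB_apply, map_sub, LinearMap.sub_apply, mul_sub]

theorem coord_sum {ι : Type*} (s : Finset ι) (k : Fin (2 * m + 1 + 1)) (y : ι → Idx m → F) :
    coord v k (∑ i ∈ s, y i) = ∑ i ∈ s, coord v k (y i) := by
  simp only [coord, ← omegaB_apply, map_sum, LinearMap.sum_apply, Finset.mul_sum]

theorem IsDarboux.linearIndependent (h : IsDarboux v) : LinearIndependent F v := by
  rw [Fintype.linearIndependent_iff]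
  intro g hg k
  have := congrArg (coord v k) hg
  rw [coord_sum] at this
  simp only [coord_smul, h.coord_self, mul_ite, mul_one, mul_zero, Finset.sum_ite_eq,
    Finset.mem_univ, if_true] at this
  simpa [coord, omega] using this

theorem IsDarboux.expand (h : IsDarboux v) (y : Idx m → F) : ∑ k, coord v k y • v k = y := by
  let b := basisOfLinearIndependentOfCardEqFinrank h.linearIndependent (by simp; omega)
  have hb : ⇑b = v := coe_basisOfLinearIndependentOfCardEqFinrank _ _
  have h1 := b.sum_repr y
  rw [hb] at h1
  have : ∀ k, coord v k y = b.repr y k := by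
    intro k
    conv_lhs => rw [← h1]
    rw [coord_sum]
    simp only [coord_smul, h.coord_self, mul_ite, mul_one, mul_zero, Finset.sum_ite_eq,
      Finset.mem_univ, if_true]
  simp only [this, h1]

theorem IsDarboux.eq_zero (h : IsDarboux v) {y : Idx m → F}
    (hy : ∀ k, omega y (v k) = 0) : y = 0 := by
  rw [← h.expand y]; simp [coord, hy]

/-- If `y` is the vector with `ω(y, z) = z b` for all `z`, the coefficients of `y` in the symplectic
basis are, up to sign, the `b`-components of the partners. The `a`-component of this expansion is
the bivector, while `y` itself is, up to sign, a coordinate vector. -/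
theorem IsDarboux.bivector (h : IsDarboux v) (a b : Idx m) :
    ∑ i : Fin (2 * m + 1 + 1), ∑ k : Fin (2 * m + 1 + 1),
      (if Even i.val ∧ k.val = i.val + 1 then v i a * v k b - v k a * v i b else 0) =
      (-Matrix.J (Fin (m + 1)) F) a b := by
  classical
  have h1 : ∀ i k : Fin (2 * m + 1 + 1),
      (if Even i.val ∧ k.val = i.val + 1 then v i a * v k b - v k a * v i b else 0) =
      (if k = partner i then (if Even i.val then v i a * v (partner i) b else 0) else 0) -
      (if i = partner k then (if Even k.val then 0 else v k a * v (partner k) b) else 0) := by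
    intro i k
    by_cases hik : k = partner i
    · have hki : i = partner k := by rw [hik, partner_partner]
      rw [if_pos hik, if_pos hki]
      rcases Nat.even_or_odd i.val with hi | hi
      · have : Odd k.val := by rw [hik, partner_of_even hi]; exact hi.add_one
        have hv : k.val = i.val + 1 := by rw [hik, partner_of_even hi]
        rw [if_pos ⟨hi, hv⟩, if_pos hi, if_neg (Nat.not_even_iff_odd.2 this), ← hik, ← hki]
      · have : Even k.val := by rw [hik, even_partner]; exact hi
        have hi' := Nat.not_even_iff_odd.2 hi
        rw [if_neg (fun h => hi' h.1), if_neg hi', if_pos this, sub_zero]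
    · have hki : i ≠ partner k := fun h => hik (by rw [h, partner_partner])
      rw [if_neg hik, if_neg hki, sub_zero, if_neg]
      rintro ⟨hi, hv⟩
      exact hik (Fin.ext (by rw [partner_of_even hi, hv]))
  simp only [h1, Finset.sum_sub_distrib]
  rw [Finset.sum_comm (f := fun i k : Fin (2 * m + 1 + 1) =>
    if i = partner k then (if Even k.val then 0 else v k a * v (partner k) b) else 0)]
  simp only [Finset.sum_ite_eq', Finset.mem_univ, if_true]
  rw [← Finset.sum_sub_distrib]
  have h2 : ∀ y : Idx m → F, (∀ z, omega y z = z b) →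
      ∑ x : Fin (2 * m + 1 + 1), ((if Even x.val then v x a * v (partner x) b else 0) -
        if Even x.val then 0 else v x a * v (partner x) b) = y a := by
    intro y hy
    rw [← h.expand y, Finset.sum_apply]
    refine Finset.sum_congr rfl fun k _ => ?_
    rw [coord, hy, Pi.smul_apply, smul_eq_mul, sgn]
    split_ifs <;> ring
  rcases b with i | i
  · rw [h2 (-Pi.single (Sum.inr i) 1) (fun z => by simp [omega, Pi.single_apply])]
    rcases a with l | l <;> simp [Matrix.J, Pi.single_apply, Matrix.one_apply]
  · rw [h2 (Pi.single (Sum.inl i) 1) (fun z => by simp [omega, Pi.single_apply])]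
    rcases a with l | l <;> simp [Matrix.J, Pi.single_apply, Matrix.one_apply]

end frames

section frames

variable {m : ℕ} {F : Type*} [Field F] {j : JetVar m → F} {v w : Fin (2 * m + 1 + 1) → Idx m → F}

/-! ### Canonical frames -/

theorem IsCanonicalFrame.isDarboux (h : IsCanonicalFrame j v) : IsDarboux v :=
  isDarboux_of_omega h.omega_odd h.omega_even h.omega_one

theorem IsCanonicalFrame.dq_eq_zero (h : IsCanonicalFrame j v) {i : Fin (2 * m + 1 + 1)}
    (hi : i ≠ 0) : dq j (v i) = 0 := by
  obtain ⟨k, rfl⟩ := Fin.exists_succ_eq.2 hi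
  exact (h.span _).1 (Submodule.subset_span ⟨k, rfl⟩)

theorem dq_eq_coord (hD : IsDarboux v) (h0 : v 0 = position j)
    (hT : ∀ i, i ≠ 0 → dq j (v i) = 0) (y : Idx m → F) :
    dq j y = coord v 0 y * dq j (position j) := by
  conv_lhs => rw [← hD.expand y, ← dqL_apply, map_sum]
  simp only [map_smul, dqL_apply, smul_eq_mul]
  rw [Finset.sum_eq_single 0 (fun i _ hi => by rw [hT i hi, mul_zero]) (by simp), h0]

/-- By the preceding lemma `dq` is a multiple of one coordinate, with factor `dq(v₀)`. Since `dq`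
takes the value `-1` on `∂/∂yₙ`, the factor cannot vanish: transversality of `v₀` is a consequence
of the frame relations. -/
theorem dq_position_ne_zero (hD : IsDarboux v) (h0 : v 0 = position j)
    (hT : ∀ i, i ≠ 0 → dq j (v i) = 0) : dq j (position j) ≠ 0 := by
  intro h
  have h1 := dq_eq_coord hD h0 hT (Pi.single dep 1)
  rw [h, mul_zero] at h1
  simp [dq, emb_ne_dep, -Fintype.sum_sum_type] at h1

/-- The span condition needs only tangency of `v₁, …, v_{2n-1}`: the `ω`-relations make `v` a basis
of `V`, and `dq` is a nonzero multiple of the coordinate along `v₀`. -/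
theorem IsCanonicalFrame.of_relations (h0 : v 0 = position j)
    (hT : ∀ i, i ≠ 0 → dq j (v i) = 0)
    (h1 : ∀ i k, Odd i.val → i ≤ k → omega (v i) (v k) = 0)
    (h2 : ∀ i k, Even i.val → i.val + 2 ≤ k.val → omega (v i) (v k) = 0)
    (h3 : ∀ i k, Even i.val → k.val = i.val + 1 → omega (v i) (v k) = 1)
    (h4 : ∀ i k, Odd i.val → i.val + 2 ≤ k.val → secondForm j (v i) (v k) = 0)
    (h5 : ∀ i k, i ≠ 0 → Even i.val → i < k → secondForm j (v i) (v k) = 0)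
    (h6 : ∀ i k, Odd i.val → k.val = i.val + 1 → secondForm j (v i) (v k) = 1) :
    IsCanonicalFrame j v where
  zero := h0
  omega_odd := h1
  omega_even := h2
  omega_one := h3
  Q_odd := h4
  Q_even := h5
  Q_one := h6
  span y := by
    have hD := isDarboux_of_omega h1 h2 h3
    constructor
    · intro hy
      have : Submodule.span F (Set.range fun i : Fin (2 * m + 1) => v i.succ) ≤
          LinearMap.ker (dqL j) := by
        rw [Submodule.span_le]
        rintro _ ⟨i, rfl⟩
        exact hT _ (Fin.succ_ne_zero i)
      exact this hy
    · intro hy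
      rw [dq_eq_coord hD h0 hT, mul_eq_zero, or_iff_left (dq_position_ne_zero hD h0 hT)] at hy
      rw [← hD.expand y, Fin.sum_univ_succ, hy, zero_smul, zero_add]
      exact Submodule.sum_mem _ fun i _ =>
        Submodule.smul_mem _ _ (Submodule.subset_span ⟨i, rfl⟩)

theorem IsCanonicalFrame.lam_ne_zero (h : IsCanonicalFrame j v) : dq j (position j) ≠ 0 :=
  dq_position_ne_zero h.isDarboux h.zero fun _ => h.dq_eq_zero

/-- The tangent space is the `ω`-complement of `v₁`, and the normalized covector `dq / dq(v₀)` is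
`ω(·, v₁)`. This links the two forms in the structure equations below. -/
theorem IsCanonicalFrame.dq_eq (h : IsCanonicalFrame j v) (y : Idx m → F) :
    dq j y = omega y (v 1) * dq j (position j) := by
  rw [dq_eq_coord h.isDarboux h.zero fun _ => h.dq_eq_zero, coord]
  have : (partner 0 : Fin (2 * m + 1 + 1)) = 1 := Fin.ext (by simp [partner])
  simp [this, sgn]

theorem IsCanonicalFrame.secondForm_eq (h : IsCanonicalFrame j v) {i k : Fin (2 * m + 1 + 1)}
    (hi : i ≠ 0) (hk : k ≠ 0) : secondForm j (v i) (v k) =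
      if i = k then secondForm j (v i) (v i)
      else if (Odd i.val ∧ k.val = i.val + 1) ∨ (Odd k.val ∧ i.val = k.val + 1) then 1 else 0 := by
  have key : ∀ i k : Fin (2 * m + 1 + 1), i ≠ 0 → i < k → secondForm j (v i) (v k) =
      if (Odd i.val ∧ k.val = i.val + 1) ∨ (Odd k.val ∧ i.val = k.val + 1) then 1 else 0 := by
    intro i k hi hik
    have hik' : i.val < k.val := hik
    rcases Nat.even_or_odd i.val with he | ho
    · rw [h.Q_even i k hi he hik, if_neg]
      rintro (⟨h1, -⟩ | ⟨-, h1⟩)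
      · exact Nat.not_even_iff_odd.2 h1 he
      · omega
    · by_cases h1 : k.val = i.val + 1
      · rw [h.Q_one i k ho h1, if_pos (Or.inl ⟨ho, h1⟩)]
      · rw [h.Q_odd i k ho (by omega), if_neg]
        rintro (⟨-, h2⟩ | ⟨-, h2⟩) <;> omega
  rcases lt_trichotomy i k with hik | hik | hik
  · rw [if_neg hik.ne, key i k hi hik]
  · rw [if_pos hik, hik]
  · rw [if_neg hik.ne', secondForm_symm, key k i hk hik]
    simp only [or_comm]

theorem IsCanonicalFrame.hasNormalForm (h : IsCanonicalFrame j v) : HasNormalForm j v := by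
  refine ⟨h.isDarboux.bivector, ?_⟩
  ext i k
  rw [Matrix.of_apply, h.secondForm_eq (Fin.succ_ne_zero i) (Fin.succ_ne_zero k)]
  simp only [blockGram, gramDiag, Fin.succ_inj, Fin.val_succ, Nat.odd_add_one, Nat.not_odd_iff_even,
    add_left_inj]

/-- The pairing of the second fundamental form with a member of the frame, in coordinates. -/
theorem IsCanonicalFrame.secondForm_right (h : IsCanonicalFrame j v) (i : Fin (2 * m + 1 + 1))
    (y : Idx m → F) :
    secondForm j (v i) y = ∑ k, coord v k y * secondForm j (v i) (v k) := by
  conv_lhs => rw [← h.isDarboux.expand y, ← secB_apply, map_sum]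
  simp only [map_smul, secB_apply, smul_eq_mul]

/-- By the sparse normal form, pairing with `v_{a-1}` reads off the coordinate along `v_a` once the
earlier coordinates vanish. -/
theorem IsCanonicalFrame.secondForm_pred (h : IsCanonicalFrame j v) {a b : Fin (2 * m + 1 + 1)}
    (hb : Odd b.val) (hab : a.val = b.val + 1) {y : Idx m → F} (hy : ∀ k < a, coord v k y = 0) :
    secondForm j (v b) y = coord v a y := by
  rw [h.secondForm_right, Finset.sum_eq_single a, h.Q_one b a hb hab, mul_one]
  · intro k _ hk
    rcases lt_or_gt_of_ne hk with h1 | h1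
    · rw [hy k h1, zero_mul]
    · have : a.val < k.val := h1
      rw [h.Q_odd b k hb (by omega), mul_zero]
  · simp

theorem IsCanonicalFrame.secondForm_tail (h : IsCanonicalFrame j v) {a b : Fin (2 * m + 1 + 1)}
    (ha : Even a.val) (hb : b ≠ 0) (hba : b ≤ a) {y : Idx m → F}
    (hy : ∀ k ≤ a, coord v k y = 0) : secondForm j (v b) y = 0 := by
  rw [h.secondForm_right]
  refine Finset.sum_eq_zero fun k _ => ?_
  rcases le_or_gt k a with h1 | h1
  · rw [hy k h1, zero_mul]
  · have h1' : a.val < k.val := h1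
    have hba' : b.val ≤ a.val := hba
    rcases Nat.even_or_odd b.val with he | ho
    · rw [h.Q_even b k hb he (lt_of_le_of_lt hba h1), mul_zero]
    · have : b.val ≠ a.val := fun h => Nat.not_even_iff_odd.2 ho (h ▸ ha)
      rw [h.Q_odd b k ho (by omega), mul_zero]

theorem IsCanonicalFrame.eq_zero_of_secondForm (h : IsCanonicalFrame j v)
    (hH : (hess j).det ≠ 0) {y : Idx m → F} (hy : dq j y = 0)
    (hQ : ∀ b, b ≠ 0 → secondForm j (v b) y = 0) : y = 0 := by
  refine SympHyp.eq_zero_of_secondForm h.lam_ne_zero hH hy fun z hz => ?_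
  rw [dq_eq_coord h.isDarboux h.zero (fun _ => h.dq_eq_zero), mul_eq_zero,
    or_iff_left h.lam_ne_zero] at hz
  rw [← h.isDarboux.expand z, ← secB_apply, map_sum]
  refine Finset.sum_eq_zero fun k _ => ?_
  rw [map_smul, secB_apply, smul_eq_mul]
  by_cases hk : k = 0
  · rw [hk, hz, zero_mul]
  · rw [secondForm_symm, hQ k hk, mul_zero]

/-- The canonical frame is rigid, for finite as well as for infinitesimal changes. -/
theorem IsCanonicalFrame.rigid (hv : IsCanonicalFrame j v) (hw : IsCanonicalFrame j w)
    (hH : (hess j).det ≠ 0) (s : Fin (2 * m + 1 + 1) → Idx m → F) (h0 : s 0 = 0)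
    (hT : ∀ a, dq j (s a) = 0)
    (hω : ∀ a b, omega (s a) (v b) + omega (w a) (s b) = 0)
    (hQ : ∀ a b, a ≠ 0 → b ≠ 0 → a ≠ b →
      secondForm j (s a) (v b) + secondForm j (w a) (s b) = 0) : s = 0 := by
  have hω' : ∀ a b, omega (s a) (w b) + omega (v a) (s b) = 0 := fun a b => by
    rw [omega_skew (s a), omega_skew (v a), ← neg_add, add_comm, hω b a, neg_zero]
  -- coordinates of `s b` before `2 r`, if `s` vanishes before `2 r`
  have A : ∀ v w : Fin (2 * m + 1 + 1) → Idx m → F,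
      (∀ a b, omega (s a) (v b) + omega (w a) (s b) = 0) → ∀ r : ℕ,
      (∀ k, k.val < 2 * r → s k = 0) → ∀ b k, k.val < 2 * r → coord v k (s b) = 0 := by
    intro v w h r ih b k hk
    have h1 := h b (partner k)
    rw [ih _ (partner_lt_iff.2 hk)] at h1
    have h2 : omega (w b) 0 = 0 := by simp [← omegaB_apply]
    rw [coord, eq_neg_of_add_eq_zero_left h1, h2, neg_zero, mul_zero]
  -- coordinate `2 r`
  have B : ∀ v w : Fin (2 * m + 1 + 1) → Idx m → F, IsCanonicalFrame j v →
      (∀ a b, omega (s a) (v b) + omega (w a) (s b) = 0) →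
      (∀ a b, a ≠ 0 → b ≠ 0 → a ≠ b →
        secondForm j (s a) (v b) + secondForm j (w a) (s b) = 0) → ∀ r : ℕ, 1 ≤ r →
      (∀ k, k.val < 2 * r → s k = 0) → ∀ b k, 2 * r ≤ b.val → k.val ≤ 2 * r →
        coord v k (s b) = 0 := by
    intro v w hv h hq r hr ih b k hb hk
    rcases hk.lt_or_eq with hk | hk
    · exact A v w h r ih b k hk
    · have hlt := k.isLt
      have hk0 : (⟨k.val - 1, by omega⟩ : Fin (2 * m + 1 + 1)) ≠ 0 :=
        fun h => by have := congrArg Fin.val h; simp at this; omega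
      -- The coordinate `2 r` is not accessible through `ω` yet, but `Q(v_{2r-1}, ·)` computes it by
      -- the previous lemmas, and `s_{2r-1}` is already zero.
      have h1 := hq b ⟨k.val - 1, by omega⟩
        (fun h => by subst h; simp at hb; omega) hk0
        (fun h => by have := congrArg Fin.val h; simp at this; omega)
      rw [ih ⟨k.val - 1, by omega⟩ (by simp; omega)] at h1
      have h2 : secondForm j (w b) 0 = 0 := by simp [← secB_apply]
      rw [h2, add_zero, secondForm_symm, hv.secondForm_pred (a := k) ⟨r - 1, by simp; omega⟩
        (by simp; omega) (fun l hl => A v w h r ih b l (by have : l.val < k.val := hl; omega))]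
        at h1
      exact h1
  have hQ' : ∀ a b, a ≠ 0 → b ≠ 0 → a ≠ b →
      secondForm j (s a) (w b) + secondForm j (v a) (s b) = 0 := fun a b ha hb hab => by
    rw [secondForm_symm j (s a), secondForm_symm j (v a), add_comm, hQ b a hb ha hab.symm]
  have main : ∀ n (hn : n < 2 * m + 1 + 1), s ⟨n, hn⟩ = 0 := by
    intro n
    induction n using Nat.strong_induction_on with
    | _ n ih =>
    intro hn
    have ih' : ∀ k : Fin (2 * m + 1 + 1), k.val < n → s k = 0 := fun k hk => ih k.val hk k.isLt
    rcases Nat.even_or_odd' n with ⟨r, rfl | rfl⟩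
    · rcases Nat.eq_zero_or_pos r with rfl | hr
      · exact h0
      -- For `n = 2 r` it suffices to kill all `Q`-pairings of `s_{2r}`. For `b ≤ 2 r`, including
      -- the diagonal pairing that no normalization prescribes, they vanish since `s_{2r}` has only
      -- later coordinates; for `b > 2 r` the relation moves the variation to `s_b`, which also has
      -- only later coordinates.
      · refine hv.eq_zero_of_secondForm hH (hT _) fun b hb => ?_
        rcases le_or_gt b.val (2 * r) with hbr | hbr
        · exact hv.secondForm_tail (a := ⟨2 * r, hn⟩) (even_two_mul r) hb hbr
            fun k hk => B v w hv hω hQ r hr ih' _ _ le_rfl hk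
        · have h1 := hQ ⟨2 * r, hn⟩ b (fun h => by have := congrArg Fin.val h; simp at this; omega)
            hb (fun h => by have := congrArg Fin.val h; simp at this; omega)
          rw [hw.secondForm_tail (a := ⟨2 * r, hn⟩) (b := ⟨2 * r, hn⟩) (even_two_mul r)
            (fun h => by have := congrArg Fin.val h; simp at this; omega) le_rfl
            (fun k hk => B w v hw hω' hQ' r hr ih' _ _ hbr.le hk), add_zero] at h1
          rw [secondForm_symm, h1]
    -- For odd `n = 2 r + 1` the pairing of `s_n` with `v_b` equals the coordinate `2 r` of `s_b`
    -- with respect to `w`. It vanishes by tangency if `r = 0` and by the claim `B` otherwise.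
    · refine hv.isDarboux.eq_zero fun b => ?_
      rw [eq_neg_of_add_eq_zero_left (hω _ b), omega_skew, neg_neg]
      rcases Nat.eq_zero_or_pos r with rfl | hr
      · have h1 := hw.dq_eq (s b)
        rw [hT, eq_comm, mul_eq_zero, or_iff_left hw.lam_ne_zero] at h1
        exact h1
      · rcases lt_or_ge b.val (2 * r) with hb | hb
        · rw [ih' b (by omega)]; simp [← omegaB_apply]
        · have h1 := B w v hw hω' hQ' r hr (fun k hk => ih' k (by omega)) b ⟨2 * r, by omega⟩ hb
            le_rfl
          have h2 : partner (⟨2 * r, by omega⟩ : Fin (2 * m + 1 + 1)) = ⟨2 * r + 1, hn⟩ :=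
            Fin.ext (partner_of_even (even_two_mul r))
          simpa [coord, sgn, h2] using h1
  funext k
  exact main k.val k.isLt

/-- For `s = w - v` the expression `β(s_a, v_b) + β(w_a, s_b)` telescopes to `β(w_a, w_b) - β(v_a,
v_b)`, and the prescribed pairings of the two frames agree. Rigidity thus gives uniqueness. -/
theorem IsCanonicalFrame.unique (hv : IsCanonicalFrame j v) (hw : IsCanonicalFrame j w)
    (hH : (hess j).det ≠ 0) : w = v := by
  refine sub_eq_zero.1 (hv.rigid hw hH (w - v) ?_ ?_ ?_ ?_)
  · simp [hv.zero, hw.zero]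
  · intro a
    rw [Pi.sub_apply, ← dqL_apply, map_sub, dqL_apply, dqL_apply]
    by_cases ha : a = 0
    · rw [ha, hv.zero, hw.zero, sub_self]
    · rw [hv.dq_eq_zero ha, hw.dq_eq_zero ha, sub_self]
  · intro a b
    simp only [Pi.sub_apply, ← omegaB_apply, map_sub, LinearMap.sub_apply]
    simp only [omegaB_apply, hv.isDarboux a b, hw.isDarboux a b]
    ring
  · intro a b ha hb hab
    simp only [Pi.sub_apply, ← secB_apply, map_sub, LinearMap.sub_apply]
    simp only [secB_apply, hv.secondForm_eq ha hb, hw.secondForm_eq ha hb, if_neg hab]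
    ring

end frames

/-! ### Adapted bases over a local ring -/

section localRing

/-- The coefficients `c` that orthogonalize member `k` against the later ones solve a square system
on the indices after `k`. It is invertible over the local ring because it is so at the residue
field, and the solution reduces to zero since the right-hand side does. -/
theorem exists_tail_solution {R : Type*} [CommRing R] (π : R →+* ℝ)
    (hπ : ∀ r, π r ≠ 0 → IsUnit r) {n : ℕ} (k : Fin n) (G : Fin n → Fin n → R)
    (hnd : ∀ β : Fin n → ℝ, (∀ l ≤ k, β l = 0) → (∀ l > k, ∑ p, β p * π (G p l) = 0) → β = 0)
    (h0 : ∀ l > k, π (G k l) = 0) :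
    ∃ c : Fin n → R, (∀ l ≤ k, c l = 0) ∧ (∀ l > k, ∑ p, c p * G p l = G k l) ∧
      ∀ l, π (c l) = 0 := by
  classical
  -- The tail block is completed by an identity block, which avoids matrices indexed by a subtype.
  let M : Matrix (Fin n) (Fin n) R :=
    Matrix.of fun p l => if k < p ∧ k < l then G p l else if p = l then 1 else 0
  have hM1 : ∀ p l, l ≤ k → M p l = if p = l then 1 else 0 := fun p l hl => by
    simp [M, not_lt.2 hl]
  have hM2 : ∀ p l, k < p → k < l → M p l = G p l := fun p l hp hl => by
    simp [M, hp, hl]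
  have hker : ∀ β : Fin n → ℝ, Matrix.vecMul β (π.mapMatrix M) = 0 → β = 0 := by
    intro β hβ
    have h1 : ∀ l ≤ k, β l = 0 := fun l hl => by
      have := congrFun hβ l
      simpa [Matrix.vecMul, dotProduct, hM1 _ l hl, apply_ite π] using this
    refine hnd β h1 fun l hl => ?_
    have := congrFun hβ l
    rw [Matrix.vecMul, dotProduct, Pi.zero_apply] at this
    rw [← this]
    refine Finset.sum_congr rfl fun p _ => ?_
    rcases le_or_gt p k with hp | hp
    · rw [h1 p hp, zero_mul, zero_mul]
    · rw [RingHom.mapMatrix_apply, Matrix.map_apply, hM2 p l hp hl]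
  have hdet : IsUnit M.det := by
    refine hπ _ fun h => ?_
    rw [RingHom.map_det] at h
    obtain ⟨β, hβ, h1⟩ := Matrix.exists_vecMul_eq_zero_iff.2 h
    exact hβ (hker β h1)
  let r : Fin n → R := fun l => if k < l then G k l else 0
  let c := Matrix.vecMul r M⁻¹
  have hc : Matrix.vecMul c M = r := by
    rw [Matrix.vecMul_vecMul, Matrix.nonsing_inv_mul _ hdet, Matrix.vecMul_one]
  have hc1 : ∀ l ≤ k, c l = 0 := fun l hl => by
    have := congrFun hc l
    simpa [Matrix.vecMul, dotProduct, hM1 _ l hl, r, not_lt.2 hl] using this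
  refine ⟨c, hc1, fun l hl => ?_, fun l => ?_⟩
  · have := congrFun hc l
    rw [Matrix.vecMul, dotProduct] at this
    simp only [r, if_pos hl] at this
    rw [← this]
    refine Finset.sum_congr rfl fun p _ => ?_
    rcases le_or_gt p k with hp | hp
    · rw [hc1 p hp, zero_mul, zero_mul]
    · rw [hM2 p l hp hl]
  · have : (fun l => π (c l)) = 0 := by
      refine hker _ (funext fun l => ?_)
      have h1 := congrArg π (congrFun hc l)
      rw [Matrix.vecMul, dotProduct, map_sum] at h1
      simp only [map_mul] at h1
      rw [Matrix.vecMul, dotProduct, Pi.zero_apply]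
      refine h1.trans ?_
      by_cases hl : k < l
      · simp [r, hl, h0 l hl]
      · simp [r, hl]
    exact congrFun this l

/-- Gram–Schmidt with two forms at each step: member `k` is made `A k`-orthogonal to all later
members, then member `k + 1` is scaled to `B k`-pairing one with it, and the remaining members are
made `B k`-orthogonal to it. At the residue field the basis `t` already satisfies the relations, so
every correction reduces to zero, every factor to one, and all pivots are units. -/
theorem exists_adapted_basis {R : Type*} [CommRing R] (π : R →+* ℝ)
    (hπ : ∀ r, π r ≠ 0 → IsUnit r) {ι : Type*} {n : ℕ}
    (A B : ℕ → LinearMap.BilinForm R (ι → R)) (A' B' : ℕ → LinearMap.BilinForm ℝ (ι → ℝ))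
    (hA : ∀ i x y, π (A i x y) = A' i (fun a => π (x a)) (fun a => π (y a)))
    (hB : ∀ i x y, π (B i x y) = B' i (fun a => π (x a)) (fun a => π (y a)))
    (b₀ : Fin n → ι → R) (t : Fin n → ι → ℝ) (ht : ∀ i a, π (b₀ i a) = t i a)
    (hA0 : ∀ i l : Fin n, i < l → A' i (t i) (t l) = 0)
    (hB0 : ∀ i l : Fin n, i < l → B' i (t i) (t l) = if l.val = i.val + 1 then 1 else 0)
    (hnd : ∀ k : Fin n, A k = 0 ∨ ∀ β : Fin n → ℝ, (∀ l ≤ k, β l = 0) →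
      (∀ l > k, ∑ p, β p * A' k (t p) (t l) = 0) → β = 0) (k : ℕ) :
    ∃ b : Fin n → ι → R,
      (∀ i l : Fin n, i.val < k → i < l →
        A i (b i) (b l) = 0 ∧ B i (b i) (b l) = if l.val = i.val + 1 then 1 else 0) ∧
      (∀ i a, π (b i a) = t i a) ∧
      (∀ i : Fin n, i.val ≠ 0 → b i ∈ Submodule.span R (b₀ '' {l | l.val ≠ 0})) ∧
      (A 0 = 0 → ∀ i : Fin n, i.val = 0 → b i = b₀ i) := by
  classical
  induction k with
  | zero =>
    exact ⟨b₀, by simp, ht, fun i hi => Submodule.subset_span ⟨i, hi, rfl⟩, fun _ _ _ => rfl⟩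
  | succ k ih =>
    obtain ⟨b, hb, hbt, hbs, hb0⟩ := ih
    by_cases hk : k < n
    swap
    · refine ⟨b, fun i l hi hl => hb i l ?_ hl, hbt, hbs, hb0⟩
      have := i.isLt; omega
    let K : Fin n := ⟨k, hk⟩
    have hbt' : ∀ i, (fun a => π (b i a)) = t i := fun i => funext (hbt i)
    -- If `A k` is the zero form no correction is made. This keeps member `0`, the position vector,
    -- unchanged.
    obtain ⟨c, hc1, hc2, hc3, hc4⟩ : ∃ c : Fin n → R, (∀ l ≤ K, c l = 0) ∧
        (∀ l > K, ∑ p, c p * A k (b p) (b l) = A k (b K) (b l)) ∧ (∀ l, π (c l) = 0) ∧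
        (A k = 0 → c = 0) := by
      by_cases hz : A k = 0
      · exact ⟨0, by simp, by simp [hz], by simp, fun _ => rfl⟩
      · obtain ⟨c, h1, h2, h3⟩ := exists_tail_solution π hπ K (fun p l => A k (b p) (b l))
          (fun β h1 h2 => ((hnd K).resolve_left hz) β h1 fun l hl => by
            simpa [hA, hbt'] using h2 l hl) (fun l hl => by
            rw [hA, hbt', hbt']; exact hA0 K l hl)
        exact ⟨c, h1, h2, h3, fun h => absurd h hz⟩
    let w : ι → R := b K - ∑ p, c p • b p
    have hwt : ∀ a, π (w a) = t K a := fun a => by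
      simp [w, hbt, hc3]
    have hwA : ∀ l > K, A k w (b l) = 0 := fun l hl => by
      simp only [w, map_sub, map_sum, map_smul, LinearMap.sub_apply, LinearMap.sum_apply,
        LinearMap.smul_apply, smul_eq_mul]
      rw [hc2 l hl, sub_self]
    have hwB : ∀ l > K, π (B k w (b l)) = if l.val = k + 1 then 1 else 0 := fun l hl => by
      rw [hB, hbt', show (fun a => π (w a)) = t K from funext hwt]; exact hB0 K l hl
    -- the new member number `k + 1`
    obtain ⟨z, hz1, hz2, hz3⟩ : ∃ z : ι → R,
        (∀ l : Fin n, l.val = k + 1 → B k w z = 1 ∧ (∀ a, π (z a) = t l a) ∧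
          z ∈ Submodule.span R (b '' {p | K < p})) ∧
        ((∀ l : Fin n, l.val ≠ k + 1) → z = 0) ∧
        z ∈ Submodule.span R (b '' {p | K < p}) := by
      by_cases hk1 : k + 1 < n
      · let K1 : Fin n := ⟨k + 1, hk1⟩
        have hKK : K < K1 := Nat.lt_succ_self k
        obtain ⟨μ, hμ⟩ := hπ (B k w (b K1)) (by rw [hwB K1 hKK]; simp [K1])
        have hmem : (↑μ⁻¹ : R) • b K1 ∈ Submodule.span R (b '' {p | K < p}) :=
          Submodule.smul_mem _ _ (Submodule.subset_span ⟨K1, hKK, rfl⟩)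
        refine ⟨(↑μ⁻¹ : R) • b K1, ?_, fun h => absurd rfl (h K1), hmem⟩
        intro l hl
        obtain rfl : l = K1 := Fin.ext hl
        refine ⟨by rw [map_smul, ← hμ, smul_eq_mul, Units.inv_mul], fun a => ?_, hmem⟩
        have h1 : π (↑μ⁻¹ : R) = 1 := by
          have h2 : π (↑μ : R) = 1 := by rw [hμ, hwB _ hKK]; simp [K1]
          have h3 := congrArg π (Units.inv_mul μ)
          rwa [map_mul, h2, mul_one, map_one] at h3
        simp [h1, hbt]
      · exact ⟨0, fun l hl => absurd l.isLt (by omega), fun _ => rfl, Submodule.zero_mem _⟩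
    let b' : Fin n → ι → R := fun l =>
      if l.val < k then b l else if l.val = k then w else if l.val = k + 1 then z
      else b l - B k w (b l) • z
    have e1 : ∀ l : Fin n, l.val < k → b' l = b l := fun l hl => by simp [b', hl]
    have e2 : b' K = w := by simp [b', K]
    have e3 : ∀ l : Fin n, l.val = k + 1 → b' l = z := fun l hl => by simp [b', hl]
    have e4 : ∀ l : Fin n, k + 1 < l.val → b' l = b l - B k w (b l) • z := fun l hl => by
      have h1 : ¬ l.val < k := by omega
      have h2 : l.val ≠ k := by omega
      have h3 : l.val ≠ k + 1 := by omega
      simp [b', h1, h2, h3]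
    have tail : ∀ l > K, b' l ∈ Submodule.span R (b '' {p | K < p}) := by
      intro l hl
      have hl' : k < l.val := hl
      rcases (Nat.succ_le_of_lt hl').eq_or_lt with h | h
      · rw [e3 l h.symm]; exact hz3
      · rw [e4 l h]
        exact Submodule.sub_mem _ (Submodule.subset_span ⟨l, hl, rfl⟩)
          (Submodule.smul_mem _ _ hz3)
    have wtail : w - b K ∈ Submodule.span R (b '' {p | K < p}) := by
      have : w - b K = -∑ p, c p • b p := by simp [w]
      rw [this]
      refine Submodule.neg_mem _ (Submodule.sum_mem _ fun p _ => ?_)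
      rcases le_or_gt p K with hp | hp
      · rw [hc1 p hp, zero_smul]; exact Submodule.zero_mem _
      · exact Submodule.smul_mem _ _ (Submodule.subset_span ⟨p, hp, rfl⟩)
    have span_le : Submodule.span R (b '' {p | K < p}) ≤
        Submodule.span R (b₀ '' {l | l.val ≠ 0}) := by
      rw [Submodule.span_le]
      rintro _ ⟨p, hp, rfl⟩
      have : k < p.val := hp
      exact hbs p (by omega)
    -- The changes at step `k` stay inside the span of the members after `k`. Relations with earlier
    -- members vanish on that span and therefore survive.
    have functional : ∀ (f : (ι → R) →ₗ[R] R), (∀ p > K, f (b p) = 0) →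
        ∀ y ∈ Submodule.span R (b '' {p | K < p}), f y = 0 := by
      intro f hf y hy
      have : Submodule.span R (b '' {p | K < p}) ≤ LinearMap.ker f := by
        rw [Submodule.span_le]
        rintro _ ⟨p, hp, rfl⟩
        exact hf p hp
      exact this hy
    refine ⟨b', ?_, ?_, ?_, ?_⟩
    · intro i l hi hil
      have hil' : i.val < l.val := hil
      rcases (Nat.lt_succ_iff.1 hi).lt_or_eq with hik | hik
      · rw [e1 i hik]
        rcases lt_trichotomy l.val k with hl | hl | hl
        · rw [e1 l hl]; exact hb i l hik hil
        · obtain rfl : l = K := Fin.ext hl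
          rw [e2]
          have hp : ∀ p > K, A i (b i) (b p) = 0 ∧ B i (b i) (b p) = 0 := fun p hp => by
            have hp' : k < p.val := hp
            have h1 := hb i p hik (hil.trans hp)
            rw [if_neg (by omega)] at h1
            exact h1
          have h1 := functional (A i (b i)) (fun p h => (hp p h).1) _ wtail
          have h2 := functional (B i (b i)) (fun p h => (hp p h).2) _ wtail
          rw [map_sub, sub_eq_zero] at h1 h2
          rw [h1, h2]
          exact hb i K hik hil
        · have hp : ∀ p > K, A i (b i) (b p) = 0 ∧ B i (b i) (b p) = 0 := fun p hp => by
            have hp' : k < p.val := hp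
            have h1 := hb i p hik (show i.val < p.val by omega)
            rw [if_neg (by omega)] at h1
            exact h1
          rw [if_neg (by omega)]
          exact ⟨functional (A i (b i)) (fun p h => (hp p h).1) _ (tail l hl),
            functional (B i (b i)) (fun p h => (hp p h).2) _ (tail l hl)⟩
      · obtain rfl : i = K := Fin.ext hik
        rw [e2]
        refine ⟨functional (A k w) hwA _ (tail l hil), ?_⟩
        show B k w (b' l) = if l.val = k + 1 then 1 else 0
        have hl' : k < l.val := hil
        rcases (Nat.succ_le_of_lt hl').eq_or_lt with h | h
        · rw [e3 l h.symm, if_pos h.symm]; exact (hz1 l h.symm).1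
        · have hlt := l.isLt
          rw [e4 l h, if_neg (by omega), map_sub, map_smul,
            (hz1 ⟨k + 1, by omega⟩ rfl).1, smul_eq_mul, mul_one, sub_self]
    · intro i a
      rcases lt_trichotomy i.val k with hi | hi | hi
      · rw [e1 i hi, hbt]
      · obtain rfl : i = K := Fin.ext hi
        rw [e2, hwt]
      · rcases (Nat.succ_le_of_lt hi).eq_or_lt with h | h
        · rw [e3 i h.symm]; exact (hz1 i h.symm).2.1 a
        · have h1 := hwB i hi
          rw [if_neg (by omega)] at h1
          rw [e4 i h, Pi.sub_apply, map_sub, Pi.smul_apply, smul_eq_mul, map_mul, h1, zero_mul,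
            sub_zero, hbt]
    · intro i hi0
      rcases lt_trichotomy i.val k with hi | hi | hi
      · rw [e1 i hi]; exact hbs i hi0
      · obtain rfl : i = K := Fin.ext hi
        rw [e2, ← sub_add_cancel w (b K)]
        exact Submodule.add_mem _ (span_le wtail) (hbs _ hi0)
      · exact span_le (tail i hi)
    · intro hA0' i hi0
      rcases Nat.eq_zero_or_pos k with h | h
      · have : i = K := Fin.ext (by rw [hi0]; exact h.symm)
        have hc0 : c = 0 := hc4 (by rw [h]; exact hA0')
        rw [this, e2, ← hb0 hA0' K h]
        simp [w, hc0]
      · rw [e1 i (by omega)]; exact hb0 hA0' i hi0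

end localRing

/-! ### A special 2-jet with a canonical frame -/

section special

variable {m : ℕ}

/-- Values of jet coordinates given by sums of powers of linear forms. -/
theorem prod_pow_single_add {F κ : Type*} [CommRing F] [Fintype κ] (f : κ → F) (i k : κ) :
    ∏ l, f l ^ (Finsupp.single i 1 + Finsupp.single k 1 : κ →₀ ℕ) l = f i * f k := by
  classical
  have h : ∀ i : κ, ∏ l, f l ^ (Finsupp.single i 1 : κ →₀ ℕ) l = f i := fun i => by
    rw [Finset.prod_eq_single i (fun l _ hl => by simp [Finsupp.single_eq_of_ne hl])
      (by simp)]
    simp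
  simp only [Finsupp.add_apply, pow_add, Finset.prod_mul_distrib, h]

/-- The symplectic basis `∂/∂yₙ, -∂/∂xₙ, …, ∂/∂y₁, -∂/∂x₁`. -/
def stdFrame (k : Fin (2 * m + 1 + 1)) : Idx m → ℝ :=
  if Even k.val then Pi.single (Sum.inr (Fin.rev ⟨k.val / 2, by omega⟩)) 1
  else -Pi.single (Sum.inl (Fin.rev ⟨k.val / 2, by omega⟩)) 1

theorem isDarboux_stdFrame : IsDarboux (stdFrame (m := m)) := by
  refine isDarboux_of_omega ?_ ?_ ?_
  · intro i k hi hik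
    rcases Nat.even_or_odd k.val with hk | hk
    · have h1 : (k.val / 2) ≠ (i.val / 2) := by
        have : i.val ≤ k.val := hik
        obtain ⟨r, hr⟩ := hk; obtain ⟨s, hs⟩ := hi; omega
      simpa [stdFrame, Nat.not_even_iff_odd.2 hi, hk, omega, Pi.single_apply] using h1
    · simp [stdFrame, Nat.not_even_iff_odd.2 hi, Nat.not_even_iff_odd.2 hk, omega]
  · intro i k hi hik
    rcases Nat.even_or_odd k.val with hk | hk
    · simp [stdFrame, hi, hk, omega]
    · have h1 : (k.val / 2) ≠ (i.val / 2) := by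
        obtain ⟨r, hr⟩ := hk; obtain ⟨s, hs⟩ := hi; omega
      simp [stdFrame, Nat.not_even_iff_odd.2 hk, hi, omega, Pi.single_apply, h1]
  · intro i k hi hk
    have hk' : ¬ Even k.val := by rw [hk]; exact Nat.not_even_iff_odd.2 hi.add_one
    have h1 : (k.val / 2) = (i.val / 2) := by obtain ⟨s, hs⟩ := hi; omega
    simp [stdFrame, hi, hk', omega, Pi.single_apply, h1]

theorem stdFrame_zero : stdFrame (m := m) 0 = Pi.single dep 1 := by
  have h : Fin.rev (0 : Fin (m + 1)) = Fin.last m := Fin.rev_zero m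
  simp [stdFrame, dep, h]

theorem stdFrame_dep {k : Fin (2 * m + 1 + 1)} (hk : k ≠ 0) : stdFrame k dep = 0 := by
  unfold stdFrame
  split_ifs with h
  · have h1 : k.val / 2 ≠ 0 := by
      have : k.val ≠ 0 := fun h => hk (Fin.ext h)
      obtain ⟨r, hr⟩ := h; omega
    rw [Pi.single_eq_of_ne]
    intro h2
    have h3 := congrArg Fin.val (Sum.inr_injective h2)
    simp [Fin.val_rev] at h3
    omega
  · simp [dep]

/-- The linear forms whose squares add up to the second fundamental form of the special jet. -/
def stdForm (c : Fin (2 * m + 1 + 1) ⊕ Fin (2 * m + 1 + 1)) (y : Idx m → ℝ) : ℝ :=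
  match c with
  | .inl k => if k = 0 then 0 else coord stdFrame k y
  | .inr k => if Odd k.val then coord stdFrame k y +
      (if h : k.val + 1 < 2 * m + 1 + 1 then coord stdFrame ⟨k.val + 1, h⟩ y else 0) else 0

theorem stdForm_add (c : Fin (2 * m + 1 + 1) ⊕ Fin (2 * m + 1 + 1)) (y z : Idx m → ℝ) :
    stdForm c (y + z) = stdForm c y + stdForm c z := by
  rcases c with k | k
  · simp only [stdForm]; split_ifs <;> simp [coord_add]
  · simp only [stdForm]; split_ifs <;> simp only [coord_add, add_zero]; ring

theorem stdForm_smul (c : Fin (2 * m + 1 + 1) ⊕ Fin (2 * m + 1 + 1)) (a : ℝ) (y : Idx m → ℝ) :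
    stdForm c (a • y) = a * stdForm c y := by
  rcases c with k | k
  · simp only [stdForm]; split_ifs <;> simp [coord_smul]
  · simp only [stdForm]; split_ifs <;> simp only [coord_smul, mul_zero] <;> ring

theorem stdForm_frame_inl (k i : Fin (2 * m + 1 + 1)) :
    stdForm (.inl k) (stdFrame i) = if k = i ∧ i ≠ 0 then 1 else 0 := by
  simp only [stdForm, isDarboux_stdFrame.coord_self]
  grind

theorem stdForm_frame_inr (k i : Fin (2 * m + 1 + 1)) :
    stdForm (.inr k) (stdFrame i) =
      if Odd k.val then (if k = i then 1 else 0) + (if k.val + 1 = i.val then 1 else 0) else 0 := by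
  simp only [stdForm, isDarboux_stdFrame.coord_self]
  have := i.isLt
  grind

/-- These linear forms annihilate `∂/∂yₙ`, which is the position vector of the special jet, so they
involve only the independent variables. -/
theorem stdForm_eq_sum (c : Fin (2 * m + 1 + 1) ⊕ Fin (2 * m + 1 + 1)) (y : Idx m → ℝ) :
    stdForm c y = ∑ i, stdForm c (Pi.single (emb i) 1) * y (emb i) := by
  have h0 : stdForm c (Pi.single dep 1) = 0 := by
    rw [← stdFrame_zero]
    rcases c with k | k
    · rw [stdForm_frame_inl]; simp
    · rw [stdForm_frame_inr]; split_ifs with h h' <;> simp_all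
  let L : (Idx m → ℝ) →ₗ[ℝ] ℝ :=
    { toFun := stdForm c, map_add' := stdForm_add c, map_smul' := stdForm_smul c }
  have h1 : y = ∑ a, y a • (Pi.single a 1 : Idx m → ℝ) := by
    funext a; simp [Finset.sum_apply, Pi.single_apply, -Fintype.sum_sum_type]
  have h2 : L y = ∑ a, y a * L (Pi.single a 1) := by
    conv_lhs => rw [h1]
    simp only [map_sum, map_smul, smul_eq_mul]
  have h3 : L (Pi.single dep 1) = 0 := h0
  rw [sum_idx, h3, mul_zero, add_zero] at h2
  exact h2.trans (Finset.sum_congr rfl fun i _ => mul_comm _ _)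

/-- The special 2-jet. -/
def stdJet : JetVar m → ℝ
  | .x _ => 0
  -- The value `1` and the vanishing slopes put the position vector along `∂/∂yₙ` and give `dq(v₀) =
  -- -1`; the minus sign in front of the sum compensates for this, so that `Q` is the sum of the
  -- squares of the forms. The formula is only used for second derivatives.
  | .u σ => if σ = 0 then 1 else if σ.degree = 1 then 0
      else -∑ c, ∏ i, stdForm c (Pi.single (emb i) 1) ^ σ i

theorem stdJet_single (i : Base m) : stdJet (.u (Finsupp.single i 1)) = 0 := by
  simp [stdJet]

theorem position_stdJet : position (stdJet (m := m)) = stdFrame 0 := by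
  rw [stdFrame_zero]
  refine idx_ext ?_ ?_
  · intro i; simp [position, stdJet, emb_ne_dep]
  · simp [position, stdJet]

theorem dq_stdJet (y : Idx m → ℝ) : dq stdJet y = -y dep := by
  simp [dq, stdJet_single]

theorem secondForm_stdJet (y z : Idx m → ℝ) :
    secondForm stdJet y z = ∑ c, stdForm c y * stdForm c z := by
  have h1 : dq stdJet (position (stdJet (m := m))) = -1 := by
    rw [dq_stdJet, position_stdJet, stdFrame_zero]; simp
  rw [secondForm, h1, d2q, div_neg, div_one]
  have h2 : ∀ i k : Base m, stdJet (.u (Finsupp.single i 1 + Finsupp.single k 1)) =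
      -∑ c, stdForm c (Pi.single (emb i) 1) * stdForm c (Pi.single (emb k) 1) := by
    intro i k
    have h3 : (Finsupp.single i 1 + Finsupp.single k 1 : Base m →₀ ℕ) ≠ 0 := fun h => by
      have := congrArg Finsupp.degree h; simp at this
    have h4 : (Finsupp.single i 1 + Finsupp.single k 1 : Base m →₀ ℕ).degree ≠ 1 := by simp
    rw [stdJet, if_neg h3, if_neg h4]
    simp only [prod_pow_single_add]
  simp only [h2, neg_mul, Finset.sum_neg_distrib, neg_neg, Finset.sum_mul]
  simp only [stdForm_eq_sum _ y, stdForm_eq_sum _ z, Finset.sum_mul_sum]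
  rw [Finset.sum_comm]
  conv_rhs => rw [Finset.sum_comm]
  rw [Finset.sum_comm]
  refine Finset.sum_congr rfl fun i _ => ?_
  rw [Finset.sum_comm]
  refine Finset.sum_congr rfl fun k _ => Finset.sum_congr rfl fun c _ => by ring

/-- The squares of the coordinates contribute only to the diagonal; the squares of sums of
coordinates `k` and `k + 1` with `k` odd produce the prescribed ones beside it. -/
theorem secondForm_stdFrame {i l : Fin (2 * m + 1 + 1)} (hil : i < l) :
    secondForm stdJet (stdFrame i) (stdFrame l) =
      if Odd i.val ∧ l.val = i.val + 1 then 1 else 0 := by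
  have hil' : i.val < l.val := hil
  rw [secondForm_stdJet, Fintype.sum_sum_type]
  simp only [stdForm_frame_inl, stdForm_frame_inr]
  rw [Finset.sum_eq_zero, zero_add]
  · rw [Finset.sum_eq_single i]
    · grind
    · intro k _ hk; grind
    · simp
  · intro k _; grind

/-- Definiteness makes `Q` nondegenerate on every tail of the basis at once, as the pivots of the
even steps require. -/
theorem stdForm_definite {β : Fin (2 * m + 1 + 1) → ℝ} (h0 : β 0 = 0)
    (h : secondForm stdJet (∑ p, β p • stdFrame p) (∑ p, β p • stdFrame p) = 0) : β = 0 := by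
  rw [secondForm_stdJet, Finset.sum_eq_zero_iff_of_nonneg fun c _ => mul_self_nonneg _] at h
  funext k
  by_cases hk : k = 0
  · rw [hk, h0]; rfl
  · have h1 := mul_self_eq_zero.1 (h (.inl k) (Finset.mem_univ _))
    simp only [stdForm, if_neg hk, coord_sum, coord_smul, isDarboux_stdFrame.coord_self] at h1
    simpa using h1

end special

/-! ### Forms over a commutative ring -/

section rings

variable {m : ℕ}

/-- The matrix of `ν • u_{ik}`, extended by zero. -/
def secMatrix {R : Type*} [CommRing R] (j : JetVar m → R) (ν : R) : Matrix (Idx m) (Idx m) R :=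
  Matrix.of fun a b =>
    pt (fun i => pt (fun k => ν * j (.u (Finsupp.single i 1 + Finsupp.single k 1))) 0 b) 0 a

theorem toBilin_secMatrix {F : Type*} [Field F] (j : JetVar m → F) (y z : Idx m → F) :
    Matrix.toBilin' (secMatrix j (dq j (position j))⁻¹) y z = secondForm j y z := by
  rw [Matrix.toBilin'_apply]
  simp only [sum_idx, secMatrix, Matrix.of_apply, pt_emb, pt_dep, mul_zero, zero_mul,
    Finset.sum_const_zero, add_zero]
  rw [secondForm, d2q, Finset.sum_div]
  refine Finset.sum_congr rfl fun i _ => ?_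
  rw [Finset.sum_div]
  refine Finset.sum_congr rfl fun k _ => ?_
  rw [div_eq_mul_inv]; ring

theorem toBilin_J {F : Type*} [Field F] (y z : Idx m → F) :
    Matrix.toBilin' (-Matrix.J (Fin (m + 1)) F) y z = omega y z := by
  rw [Matrix.toBilin'_apply]
  simp [Fintype.sum_sum_type, Matrix.J, Matrix.one_apply, omega, sub_eq_add_neg,
    Finset.sum_add_distrib]

theorem map_toBilin {R S ι : Type*} [CommRing R] [CommRing S] [Fintype ι] [DecidableEq ι]
    (f : R →+* S) (M : Matrix ι ι R) (x y : ι → R) :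
    f (Matrix.toBilin' M x y) = Matrix.toBilin' (M.map f) (fun a => f (x a)) (fun a => f (y a)) := by
  simp [Matrix.toBilin'_apply]

theorem map_secMatrix {R S : Type*} [CommRing R] [CommRing S] (f : R →+* S) {j : JetVar m → R}
    {j' : JetVar m → S} (h : ∀ i k, f (j (.u (Finsupp.single i 1 + Finsupp.single k 1))) =
      j' (.u (Finsupp.single i 1 + Finsupp.single k 1))) (ν : R) :
    (secMatrix j ν).map f = secMatrix j' (f ν) := by
  ext a b
  rw [Matrix.map_apply]
  induction a using idx_cases with
  | h' => simp [secMatrix]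
  | h i =>
    induction b using idx_cases with
    | h' => simp [secMatrix]
    | h k => simp [secMatrix, h]

theorem map_J {R S ι : Type*} [CommRing R] [CommRing S] [DecidableEq ι] (f : R →+* S) :
    (-Matrix.J ι R).map f = -Matrix.J ι S := by
  ext (a | a) (b | b) <;> simp [Matrix.J, Matrix.one_apply, apply_ite f]

end rings

/-! ### The canonical frame of the generic jet -/

section generic

variable {m : ℕ}

/-- Polynomial functions on the space of 2-jets. -/
abbrev TwoPoly (m : ℕ) : Type := MvPolynomial {t : JetVar m // t.ord ≤ 2} ℝ

/-- Evaluation of functions at the special 2-jet. -/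
def stdEval : TwoPoly m →+* ℝ := MvPolynomial.eval fun t => stdJet t.1

/-- Functions on the space of 2-jets vanishing at the special jet. -/
def stdIdeal (m : ℕ) : Ideal (TwoPoly m) := RingHom.ker (stdEval (m := m))

instance : (stdIdeal m).IsPrime := RingHom.ker_isPrime _

/-- The local ring of the special 2-jet. -/
abbrev StdLocal (m : ℕ) : Type := Localization.AtPrime (stdIdeal m)

theorem stdEval_isUnit (s : (stdIdeal m).primeCompl) : IsUnit (stdEval s.1) :=
  isUnit_iff_ne_zero.2 s.2

/-- Values at the special jet. -/
def stdResidue : StdLocal m →+* ℝ := IsLocalization.lift (stdEval_isUnit (m := m))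

/-- Functions on the space of 2-jets, as rational functions. -/
def twoToRat : TwoPoly m →ₐ[ℝ] JetRat m := MvPolynomial.aeval fun t => gen t.1

theorem twoToRat_eq (p : TwoPoly m) : twoToRat p = toRat (MvPolynomial.rename Subtype.val p) := by
  rw [← aeval_gen, MvPolynomial.aeval_rename]; rfl

theorem twoToRat_isUnit (s : (stdIdeal m).primeCompl) :
    IsUnit ((twoToRat : TwoPoly m →ₐ[ℝ] JetRat m).toRingHom s.1) := by
  refine isUnit_iff_ne_zero.2 ?_
  show twoToRat s.1 ≠ 0
  rw [twoToRat_eq, toRat_ne_zero]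
  intro h
  have h1 : s.1 = 0 := MvPolynomial.rename_injective _ Subtype.val_injective (by simpa using h)
  exact s.2 (by rw [h1]; exact Ideal.zero_mem _)

/-- The local ring is contained in the field of rational functions. -/
def stdIncl : StdLocal m →+* JetRat m := IsLocalization.lift (twoToRat_isUnit (m := m))

theorem stdIncl_algebraMap (p : TwoPoly m) :
    stdIncl (algebraMap (TwoPoly m) (StdLocal m) p) = twoToRat p :=
  IsLocalization.lift_eq _ p

theorem stdResidue_algebraMap (p : TwoPoly m) :
    stdResidue (algebraMap (TwoPoly m) (StdLocal m) p) = stdEval p :=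
  IsLocalization.lift_eq _ p

theorem isUnit_of_stdResidue (r : StdLocal m) (h : stdResidue r ≠ 0) : IsUnit r := by
  obtain ⟨⟨p, s⟩, rfl⟩ := IsLocalization.mk'_surjective (stdIdeal m).primeCompl r
  rw [IsLocalization.AtPrime.isUnit_mk'_iff _ (stdIdeal m)]
  intro hp
  apply h
  have h1 := congrArg stdResidue (IsLocalization.mk'_spec (StdLocal m) p s)
  rw [map_mul, stdResidue_algebraMap, stdResidue_algebraMap, show stdEval p = 0 from hp] at h1
  exact (mul_eq_zero.1 h1).resolve_right s.2

theorem twoToRat_mem (p : TwoPoly m) : twoToRat p ∈ ratOrd m 2 := by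
  induction p using MvPolynomial.induction_on with
  | C a => simp [twoToRat]
  | add p q hp hq => rw [map_add]; exact add_mem hp hq
  | mul_X p t hp =>
    rw [map_mul]
    refine mul_mem hp ?_
    simp [twoToRat, gen_mem_ratOrd t.2]

theorem stdIncl_mem (r : StdLocal m) : stdIncl r ∈ ratOrd m 2 := by
  obtain ⟨⟨p, s⟩, rfl⟩ := IsLocalization.mk'_surjective (stdIdeal m).primeCompl r
  have h1 := congrArg stdIncl (IsLocalization.mk'_spec (StdLocal m) p s)
  rw [map_mul, stdIncl_algebraMap, stdIncl_algebraMap] at h1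
  have h2 : twoToRat s.1 ≠ 0 := (twoToRat_isUnit s).ne_zero
  rw [(eq_div_iff h2).2 h1]
  exact div_mem (twoToRat_mem p) (twoToRat_mem s.1)

/-- The generic 2-jet over the local ring. -/
def stdGen (t : JetVar m) : StdLocal m :=
  if h : t.ord ≤ 2 then algebraMap (TwoPoly m) (StdLocal m) (MvPolynomial.X ⟨t, h⟩) else 0

theorem stdIncl_stdGen {t : JetVar m} (h : t.ord ≤ 2) : stdIncl (stdGen t) = gen t := by
  rw [stdGen, dif_pos h, stdIncl_algebraMap, twoToRat, MvPolynomial.aeval_X]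

theorem stdResidue_stdGen {t : JetVar m} (h : t.ord ≤ 2) : stdResidue (stdGen t) = stdJet t := by
  rw [stdGen, dif_pos h, stdResidue_algebraMap, stdEval, MvPolynomial.eval_X]

theorem ord_single (i : Base m) : (JetVar.u (Finsupp.single i 1) : JetVar m).ord = 1 := by
  simp [JetVar.ord]

theorem ord_single_add (i k : Base m) :
    (JetVar.u (Finsupp.single i 1 + Finsupp.single k 1) : JetVar m).ord = 2 := by
  simp [JetVar.ord]

theorem ord_zero : (JetVar.u 0 : JetVar m).ord = 0 := by simp [JetVar.ord]

/-- The tangent vector with given constant components along the independent variables. -/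
def stdTangent (ξ : Base m → ℝ) : Idx m → StdLocal m :=
  pt (fun i => algebraMap (TwoPoly m) (StdLocal m) (MvPolynomial.C (ξ i)))
    (∑ i, stdGen (.u (Finsupp.single i 1)) *
      algebraMap (TwoPoly m) (StdLocal m) (MvPolynomial.C (ξ i)))

theorem map_pt {R S : Type*} (f : R → S) (x : Base m → R) (u : R) (a : Idx m) :
    f (pt x u a) = pt (fun i => f (x i)) (f u) a := by
  induction a using idx_cases with
  | h i => simp
  | h' => simp

/-- The adapted basis is constructed over the local ring of the special jet, starting from a lift of
the standard basis by the position vector and tangent vectors, and then regarded over the fraction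
field. Working over the local ring ensures that every division is by a unit. -/
theorem exists_generic_frame :
    ∃ v : Fin (2 * m + 1 + 1) → Idx m → JetRat m, IsCanonicalFrame gen v ∧
      ∀ i a, v i a ∈ ratOrd m 2 := by
  let dqR : (Idx m → StdLocal m) → StdLocal m := fun w =>
    ∑ i : Base m, stdGen (.u (Finsupp.single i 1)) * w (emb i) - w dep
  let posR : Idx m → StdLocal m := pt (fun i => stdGen (.x i)) (stdGen (.u 0))
  have incl_pos : ∀ a, stdIncl (posR a) = position gen a := fun a => by
    rw [map_pt stdIncl, position]
    congr 1
    · funext i; exact stdIncl_stdGen (by simp [JetVar.ord])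
    · exact stdIncl_stdGen (by simp [JetVar.ord])
  have res_pos : ∀ a, stdResidue (posR a) = stdFrame 0 a := fun a => by
    rw [← position_stdJet]
    rw [map_pt stdResidue, position]
    congr 1
    · funext i; exact stdResidue_stdGen (by simp [JetVar.ord])
    · exact stdResidue_stdGen (by simp [JetVar.ord])
  have incl_dq : ∀ w, stdIncl (dqR w) = dq gen (fun a => stdIncl (w a)) := fun w => by
    simp only [dqR, dq, map_sub, map_sum, map_mul]
    congr 1
    refine Finset.sum_congr rfl fun i _ => ?_
    rw [stdIncl_stdGen (by rw [ord_single]; norm_num)]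
  have res_dq : ∀ w, stdResidue (dqR w) = dq stdJet (fun a => stdResidue (w a)) := fun w => by
    simp only [dqR, dq, map_sub, map_sum, map_mul]
    congr 1
    refine Finset.sum_congr rfl fun i _ => ?_
    rw [stdResidue_stdGen (by rw [ord_single]; norm_num)]
  have res_lam : stdResidue (dqR posR) = dq stdJet (position (stdJet (m := m))) := by
    rw [res_dq]; congr 1; funext a; rw [res_pos, position_stdJet]
  obtain ⟨μ, hμ⟩ : IsUnit (dqR posR) := by
    refine isUnit_of_stdResidue _ ?_
    rw [res_lam, dq_stdJet, position_stdJet, stdFrame_zero]; simp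
  let ν : StdLocal m := ↑μ⁻¹
  have hν : ν * dqR posR = 1 := by rw [← hμ]; exact Units.inv_mul μ
  have incl_ν : stdIncl ν = (dq gen (position gen))⁻¹ := by
    refine eq_inv_of_mul_eq_one_left ?_
    have h1 := congrArg stdIncl hν
    rw [map_mul, map_one, incl_dq] at h1
    simpa [incl_pos] using h1
  have res_ν : stdResidue ν = (dq stdJet (position (stdJet (m := m))))⁻¹ := by
    refine eq_inv_of_mul_eq_one_left ?_
    have h1 := congrArg stdResidue hν
    rwa [map_mul, map_one, res_lam] at h1
  let Ω : LinearMap.BilinForm (StdLocal m) (Idx m → StdLocal m) :=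
    Matrix.toBilin' (-Matrix.J (Fin (m + 1)) (StdLocal m))
  let Q : LinearMap.BilinForm (StdLocal m) (Idx m → StdLocal m) :=
    Matrix.toBilin' (secMatrix stdGen ν)
  have incl_Ω : ∀ y z, stdIncl (Ω y z) = omega (fun a => stdIncl (y a)) fun a => stdIncl (z a) := by
    intro y z; rw [map_toBilin, map_J, toBilin_J]
  have res_Ω : ∀ y z, stdResidue (Ω y z) =
      omega (fun a => stdResidue (y a)) fun a => stdResidue (z a) := by
    intro y z; rw [map_toBilin, map_J, toBilin_J]
  have incl_Q : ∀ y z, stdIncl (Q y z) =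
      secondForm gen (fun a => stdIncl (y a)) fun a => stdIncl (z a) := by
    intro y z
    rw [map_toBilin, map_secMatrix stdIncl (j' := gen) fun i k => stdIncl_stdGen
      (by rw [ord_single_add]), incl_ν, toBilin_secMatrix]
  have res_Q : ∀ y z, stdResidue (Q y z) =
      secondForm stdJet (fun a => stdResidue (y a)) fun a => stdResidue (z a) := by
    intro y z
    rw [map_toBilin, map_secMatrix stdResidue (j' := stdJet) fun i k => stdResidue_stdGen
      (by rw [ord_single_add]), res_ν, toBilin_secMatrix]
  -- Odd members are `ω`-orthogonal and even members `Q`-orthogonal to all later ones, whereas the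
  -- pairing with the next member is normalized by `ω` for even and by `Q` for odd ones. Member `0`
  -- is fixed, hence the zero form there.
  let A : ℕ → LinearMap.BilinForm (StdLocal m) (Idx m → StdLocal m) := fun i =>
    if i = 0 then 0 else if Even i then Q else Ω
  let B : ℕ → LinearMap.BilinForm (StdLocal m) (Idx m → StdLocal m) := fun i =>
    if Even i then Ω else Q
  let A' : ℕ → LinearMap.BilinForm ℝ (Idx m → ℝ) := fun i =>
    if i = 0 then 0 else if Even i then secB stdJet else omegaB
  let B' : ℕ → LinearMap.BilinForm ℝ (Idx m → ℝ) := fun i =>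
    if Even i then omegaB else secB stdJet
  let b₀ : Fin (2 * m + 1 + 1) → Idx m → StdLocal m := fun i =>
    if i = 0 then posR else stdTangent fun k => stdFrame i (emb k)
  have hb₀ : ∀ i a, stdResidue (b₀ i a) = stdFrame i a := by
    intro i a
    by_cases hi : i = 0
    · subst hi; exact res_pos a
    · simp only [b₀, if_neg hi, stdTangent]
      rw [map_pt stdResidue]
      induction a using idx_cases with
      | h k => rw [pt_emb, stdResidue_algebraMap]; simp [stdEval]
      | h' =>
        rw [pt_dep, stdFrame_dep hi, map_sum]
        refine Finset.sum_eq_zero fun k _ => ?_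
        rw [map_mul, stdResidue_stdGen (by rw [ord_single]; norm_num), stdJet_single, zero_mul]
  obtain ⟨b, hb1, -, hb3, hb4⟩ := exists_adapted_basis stdResidue isUnit_of_stdResidue A B A' B'
    (fun i x y => by
      simp only [A, A']
      split_ifs
      · simp
      · exact res_Q x y
      · exact res_Ω x y)
    (fun i x y => by
      simp only [B, B']
      split_ifs
      · exact res_Ω x y
      · exact res_Q x y)
    b₀ stdFrame hb₀
    (fun i l hil => by
      simp only [A']
      split_ifs with h1 h2
      · simp
      · rw [secB_apply, secondForm_stdFrame hil, if_neg]
        exact fun h => Nat.not_even_iff_odd.2 h.1 h2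
      · rw [omegaB_apply, isDarboux_stdFrame, if_neg]
        have h3 := partner_of_odd (Nat.not_even_iff_odd.1 h2)
        rintro rfl
        have : i.val < (partner i).val := hil
        omega)
    (fun i l hil => by
      simp only [B']
      split_ifs with h1 h2 h2
      · rw [omegaB_apply, isDarboux_stdFrame, if_pos (Fin.ext (by rw [partner_of_even h1, h2])),
          sgn, if_pos h1]
      · rw [omegaB_apply, isDarboux_stdFrame, if_neg]
        rintro rfl
        exact h2 (partner_of_even h1)
      · rw [secB_apply, secondForm_stdFrame hil, if_pos ⟨Nat.not_even_iff_odd.1 h1, h2⟩]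
      · rw [secB_apply, secondForm_stdFrame hil, if_neg fun h => h2 h.2])
    (fun k => by
      by_cases hk : k.val = 0
      · exact Or.inl (by simp [A, hk])
      · right
        intro β hβ h
        have h0 : β 0 = 0 := hβ 0 (Fin.zero_le _)
        -- For even `k` the tail is nondegenerate because `Q` is definite. For odd `k` it consists
        -- of complete pairs of the symplectic basis, so each coefficient is detected by pairing
        -- with the partner.
        by_cases he : Even k.val
        · refine stdForm_definite h0 ?_
          simp only [A', if_neg hk, if_pos he, secB_apply] at h
          simp only [← secB_apply, map_sum, map_smul, LinearMap.sum_apply, LinearMap.smul_apply]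
          simp only [secB_apply, smul_eq_mul]
          refine Finset.sum_eq_zero fun l _ => ?_
          rcases le_or_gt l k with hl | hl
          · rw [hβ l hl, zero_mul]
          · rw [h l hl, mul_zero]
        · simp only [A', if_neg hk, if_neg he, omegaB_apply] at h
          funext l
          rcases le_or_gt l k with hl | hl
          · exact hβ l hl
          · have h1 : k < partner l := by
              have h2 : k.val < l.val := hl
              show k.val < (partner l).val
              obtain ⟨r, hr⟩ := Nat.not_even_iff_odd.1 he
              have h3 := (partner_lt_iff (k := l) (r := r + 1)).not
              omega
            have h3 := h _ h1
            rw [Finset.sum_eq_single l] at h3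
            · rw [isDarboux_stdFrame, if_pos rfl, mul_eq_zero] at h3
              refine (h3.resolve_right fun h4 => ?_ : β l = 0)
              have := sgn_mul_self (F := ℝ) l
              rw [h4, mul_zero] at this
              exact zero_ne_one this
            · intro p _ hp
              rw [isDarboux_stdFrame, if_neg, mul_zero]
              intro h4
              exact hp (by rw [← partner_partner p, ← h4, partner_partner])
            · simp)
    (2 * m + 1 + 1)
  have hrel : ∀ i l : Fin (2 * m + 1 + 1), i < l → A i (b i) (b l) = 0 ∧
      B i (b i) (b l) = if l.val = i.val + 1 then 1 else 0 := fun i l h => hb1 i l i.isLt h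
  have ha : ∀ i l : Fin (2 * m + 1 + 1), Odd i.val → i ≤ l →
      omega (fun a => stdIncl (b i a)) (fun a => stdIncl (b l a)) = 0 := by
    intro i l hi hil
    rcases hil.lt_or_eq with h | rfl
    · have h1 := (hrel i l h).1
      simp only [A, if_neg hi.pos.ne', if_neg (Nat.not_even_iff_odd.2 hi)] at h1
      rw [← incl_Ω, h1, map_zero]
    · exact omega_self _
  have hq : ∀ i l : Fin (2 * m + 1 + 1), Odd i.val → i < l →
      secondForm gen (fun a => stdIncl (b i a)) (fun a => stdIncl (b l a)) =
        if l.val = i.val + 1 then 1 else 0 := by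
    intro i l hi hil
    have h1 := (hrel i l hil).2
    simp only [B, if_neg (Nat.not_even_iff_odd.2 hi)] at h1
    rw [← incl_Q, h1, apply_ite stdIncl, map_one, map_zero]
  have ho : ∀ i l : Fin (2 * m + 1 + 1), Even i.val → i < l →
      omega (fun a => stdIncl (b i a)) (fun a => stdIncl (b l a)) =
        if l.val = i.val + 1 then 1 else 0 := by
    intro i l hi hil
    have h1 := (hrel i l hil).2
    simp only [B, if_pos hi] at h1
    rw [← incl_Ω, h1, apply_ite stdIncl, map_one, map_zero]
  refine ⟨fun i a => stdIncl (b i a), IsCanonicalFrame.of_relations ?_ ?_ ha ?_ ?_ ?_ ?_ ?_,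
    fun i a => stdIncl_mem _⟩
  · funext a
    rw [hb4 (by simp [A]) 0 rfl]
    simp only [b₀, if_pos]
    exact incl_pos a
  · intro i hi
    rw [← incl_dq]
    -- Members other than `0` remain combinations of the tangent lifts, so they stay tangent.
    have h1 : ∀ y ∈ Submodule.span (StdLocal m) (b₀ '' {l | l.val ≠ 0}), dqR y = 0 := by
      let L : (Idx m → StdLocal m) →ₗ[StdLocal m] StdLocal m :=
        ∑ k : Base m, stdGen (.u (Finsupp.single k 1)) • LinearMap.proj (emb k) -
          LinearMap.proj dep
      have hL : ∀ y, L y = dqR y := fun y => by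
        simp [L, dqR, LinearMap.sum_apply, -Fintype.sum_sum_type]
      intro y hy
      have : Submodule.span (StdLocal m) (b₀ '' {l | l.val ≠ 0}) ≤ LinearMap.ker L := by
        rw [Submodule.span_le]
        rintro _ ⟨l, hl, rfl⟩
        have hl' : l ≠ 0 := fun h => hl (by rw [h]; rfl)
        show L _ = 0
        rw [hL]
        simp [dqR, b₀, if_neg hl', stdTangent, -Fintype.sum_sum_type]
      rw [← hL]; exact this hy
    rw [h1 _ (hb3 i fun h => hi (Fin.ext h)), map_zero]
  · intro i l hi hil
    rw [ho i l hi (show i.val < l.val by omega), if_neg (by omega)]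
  · intro i l hi hil
    rw [ho i l hi (show i.val < l.val by omega), if_pos hil]
  · intro i l hi hil
    rw [hq i l hi (show i.val < l.val by omega), if_neg (by omega)]
  · intro i l hi0 hi hil
    have h1 := (hrel i l hil).1
    simp only [A, if_neg (fun h : i.val = 0 => hi0 (Fin.ext h)), if_pos hi] at h1
    rw [← incl_Q, h1, map_zero]
  · intro i l hi hil
    rw [hq i l hi (show i.val < l.val by omega), if_pos hil]

/-- The Hessian determinant, as a polynomial. -/
def hessPoly (m : ℕ) : JetPoly m :=
  Matrix.det (Matrix.of fun i k : Base m =>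
    MvPolynomial.X (.u (Finsupp.single i 1 + Finsupp.single k 1)))

theorem eval_hessPoly (j : JetVar m → ℝ) : MvPolynomial.eval j (hessPoly m) = (hess j).det := by
  rw [hessPoly, RingHom.map_det]; congr 1; ext i k; simp [hess]

theorem toRat_hessPoly : toRat (hessPoly m) = (hess (gen (m := m))).det := by
  rw [hessPoly, toRat, RingHom.map_det]; congr 1

theorem hessPoly_ne_zero : hessPoly m ≠ 0 := by
  -- A jet whose Hessian is the identity matrix.
  let j : JetVar m → ℝ := fun t => match t with
    | .x _ => 0
    | .u σ => ∑ c : Base m, ∏ l, (if c = l then 1 else 0 : ℝ) ^ σ l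
  refine ne_zero_of_eval_ne_zero (j := j) ?_
  have : hess j = 1 := by
    ext i k
    simp only [hess, Matrix.of_apply, j, prod_pow_single_add, Matrix.one_apply]
    simp [-Fintype.sum_sum_type, eq_comm]
  rw [eval_hessPoly, this, Matrix.det_one]
  exact one_ne_zero

theorem det_hess_gen_ne_zero : (hess (gen (m := m))).det ≠ 0 := by
  rw [← toRat_hessPoly, toRat_ne_zero]; exact hessPoly_ne_zero

theorem vars_hessPoly : ∀ t ∈ (hessPoly m).vars, t.ord ≤ 2 := by
  classical
  intro t ht
  rw [hessPoly, Matrix.det_apply] at ht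
  obtain ⟨s, -, hs⟩ := Finset.mem_biUnion.1 (MvPolynomial.vars_sum_subset _ _ ht)
  have h1 : t ∈ (∏ i, (Matrix.of fun i k : Base m => (MvPolynomial.X
      (.u (Finsupp.single i 1 + Finsupp.single k 1)) : JetPoly m)) (s i) i).vars := by
    rcases Int.units_eq_one_or (Equiv.Perm.sign s) with h | h
    · simpa only [h, one_smul] using hs
    · rw [h, Units.neg_smul, one_smul, MvPolynomial.vars_neg] at hs
      exact hs
  obtain ⟨i, -, hi⟩ := Finset.mem_biUnion.1 (MvPolynomial.vars_prod _ h1)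
  rw [Matrix.of_apply, MvPolynomial.vars_X, Finset.mem_singleton] at hi
  rw [hi, ord_single_add]

end generic

/-! ### Values of the generic frame at actual jets -/

section specialisation

variable {m : ℕ}

theorem HasValue.omega {y z : Idx m → JetRat m} {j : JetVar m → ℝ} {y' z' : Idx m → ℝ}
    (hy : ∀ a, HasValue (y a) j (y' a)) (hz : ∀ a, HasValue (z a) j (z' a)) :
    HasValue (omega y z) j (omega y' z') :=
  HasValue.sum _ fun _ _ => ((hy _).mul (hz _)).sub ((hy _).mul (hz _))

theorem HasValue.dq {y : Idx m → JetRat m} {j : JetVar m → ℝ} {y' : Idx m → ℝ}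
    (hy : ∀ a, HasValue (y a) j (y' a)) : HasValue (dq SympHyp.gen y) j (dq j y') :=
  (HasValue.sum _ fun _ _ => (HasValue.gen j _).mul (hy _)).sub (hy _)

theorem HasValue.pt {x : Base m → JetRat m} {u : JetRat m} {j : JetVar m → ℝ} {x' : Base m → ℝ}
    {u' : ℝ} (hx : ∀ i, HasValue (x i) j (x' i)) (hu : HasValue u j u') (a : Idx m) :
    HasValue (pt x u a) j (pt x' u' a) := by
  induction a using idx_cases with
  | h i => simpa using hx i
  | h' => simpa using hu

theorem HasValue.position (j : JetVar m → ℝ) (a : Idx m) :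
    HasValue (position SympHyp.gen a) j (position j a) :=
  HasValue.pt (fun _ => HasValue.gen j _) (HasValue.gen j _) a

theorem HasValue.secondForm {y z : Idx m → JetRat m} {j : JetVar m → ℝ} {y' z' : Idx m → ℝ}
    (hy : ∀ a, HasValue (y a) j (y' a)) (hz : ∀ a, HasValue (z a) j (z' a))
    (hj : SympHyp.dq j (SympHyp.position j) ≠ 0) :
    HasValue (secondForm SympHyp.gen y z) j (secondForm j y' z') :=
  (HasValue.sum _ fun _ _ => HasValue.sum _ fun _ _ =>
    ((HasValue.gen j _).mul (hy _)).mul (hz _)).div (HasValue.dq (HasValue.position j)) hj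

/-- The values of a canonical frame of the generic jet form a canonical frame. -/
theorem IsCanonicalFrame.of_hasValue {v : Fin (2 * m + 1 + 1) → Idx m → JetRat m}
    (hv : IsCanonicalFrame gen v) {j : JetVar m → ℝ} {w : Fin (2 * m + 1 + 1) → Idx m → ℝ}
    (hw : ∀ i a, HasValue (v i a) j (w i a)) : IsCanonicalFrame j w := by
  have h0 : w 0 = position j := funext fun a =>
    (hw 0 a).unique (by rw [hv.zero]; exact HasValue.position j a)
  have hT : ∀ i, i ≠ 0 → dq j (w i) = 0 := fun i hi =>
    (HasValue.dq (hw i)).unique (by rw [hv.dq_eq_zero hi]; exact HasValue.zero j)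
  have hω : ∀ i k c, omega (v i) (v k) = algebraMap ℝ _ c → omega (w i) (w k) = c :=
    fun i k c h => (HasValue.omega (hw i) (hw k)).unique (by rw [h]; exact HasValue.const j c)
  have h1 : ∀ i k : Fin (2 * m + 1 + 1), Odd i.val → i ≤ k → omega (w i) (w k) = 0 :=
    fun i k hi hk => hω i k 0 (by rw [hv.omega_odd i k hi hk, map_zero])
  have h2 : ∀ i k : Fin (2 * m + 1 + 1), Even i.val → i.val + 2 ≤ k.val →
    omega (w i) (w k) = 0 := fun i k hi hk => hω i k 0 (by rw [hv.omega_even i k hi hk, map_zero])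
  have h3 : ∀ i k : Fin (2 * m + 1 + 1), Even i.val → k.val = i.val + 1 →
    omega (w i) (w k) = 1 := fun i k hi hk => hω i k 1 (by rw [hv.omega_one i k hi hk, map_one])
  -- The `ω`-relations already force `dq(v₀) ≠ 0` at `j`, so the values of `Q` are defined without a
  -- further genericity assumption.
  have hlam := dq_position_ne_zero (isDarboux_of_omega h1 h2 h3) h0 hT
  have hQ : ∀ i k c, secondForm gen (v i) (v k) = algebraMap ℝ _ c → secondForm j (w i) (w k) = c :=
    fun i k c h => (HasValue.secondForm (hw i) (hw k) hlam).unique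
      (by rw [h]; exact HasValue.const j c)
  exact IsCanonicalFrame.of_relations h0 hT h1 h2 h3
    (fun i k hi hk => hQ i k 0 (by rw [hv.Q_odd i k hi hk, map_zero]))
    (fun i k h0 hi hk => hQ i k 0 (by rw [hv.Q_even i k h0 hi hk, map_zero]))
    (fun i k hi hk => hQ i k 1 (by rw [hv.Q_one i k hi hk, map_one]))

/-- `P` is the Hessian determinant, which ensures uniqueness, times the denominators of all frame
components. -/
theorem exists_frame_domain {v : Fin (2 * m + 1 + 1) → Idx m → JetRat m}
    (hv : IsCanonicalFrame gen v) (h2 : ∀ i a, v i a ∈ ratOrd m 2) :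
    ∃ P : JetPoly m, P ≠ 0 ∧ (∀ t ∈ P.vars, t.ord ≤ 2) ∧
      ∀ j : JetVar m → ℝ, MvPolynomial.eval j P ≠ 0 →
        ∃ w : Fin (2 * m + 1 + 1) → Idx m → ℝ,
          IsCanonicalFrame j w ∧ (∀ w', IsCanonicalFrame j w' → w' = w) ∧
          HasNormalForm j w ∧ ∀ i a, HasValue (v i a) j (w i a) := by
  classical
  choose p q hq hpq hp2 hq2 using fun i a => exists_num_denom_of_mem_ratOrd (h2 i a)
  refine ⟨hessPoly m * ∏ x : Fin (2 * m + 1 + 1) × Idx m, q x.1 x.2,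
    mul_ne_zero hessPoly_ne_zero (Finset.prod_ne_zero_iff.2 fun x _ => hq x.1 x.2), ?_, ?_⟩
  · intro t ht
    rcases Finset.mem_union.1 (MvPolynomial.vars_mul _ _ ht) with h | h
    · exact vars_hessPoly t h
    · obtain ⟨x, -, hx⟩ := Finset.mem_biUnion.1 (MvPolynomial.vars_prod _ h)
      exact hq2 _ _ t hx
  · intro j hj
    rw [map_mul, map_prod, eval_hessPoly] at hj
    have hw : ∀ i a, HasValue (v i a) j
        (MvPolynomial.eval j (p i a) / MvPolynomial.eval j (q i a)) := fun i a =>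
      ⟨p i a, q i a, Finset.prod_ne_zero_iff.1 (right_ne_zero_of_mul hj) (i, a)
        (Finset.mem_univ _), hpq i a, rfl⟩
    have hc := hv.of_hasValue hw
    exact ⟨_, hc, fun w' h' => hc.unique h' (left_ne_zero_of_mul hj), hc.hasNormalForm, hw⟩

end specialisation

/-! ### Linear maps acting on vectors -/

section action

variable {m : ℕ} {F : Type*} [Field F] [Algebra ℝ F]

/-- The action of a real matrix on vectors with coefficients in a field. -/
def act (g : Matrix (Idx m) (Idx m) ℝ) (v : Idx m → F) : Idx m → F :=
  fun a => ∑ b, algebraMap ℝ F (g a b) * v b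

theorem act_real (g : Matrix (Idx m) (Idx m) ℝ) (v : Idx m → ℝ) : act g v = g.mulVec v := rfl

theorem act_eq (g : Matrix (Idx m) (Idx m) ℝ) (v : Idx m → F) :
    act g v = (g.map (algebraMap ℝ F)).mulVec v := rfl

theorem act_act {g h : Matrix (Idx m) (Idx m) ℝ} (hgh : h * g = 1) (v : Idx m → F) :
    act h (act g v) = v := by
  rw [act_eq, act_eq, Matrix.mulVec_mulVec, ← Matrix.map_mul, hgh,
    Matrix.map_one _ (map_zero _) (map_one _), Matrix.one_mulVec]

theorem act_add (g : Matrix (Idx m) (Idx m) ℝ) (v w : Idx m → F) :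
    act g (v + w) = act g v + act g w := Matrix.mulVec_add _ _ _

theorem act_smul (g : Matrix (Idx m) (Idx m) ℝ) (c : F) (w : Idx m → F) :
    act g (c • w) = c • act g w := Matrix.mulVec_smul _ _ _

theorem act_zero (g : Matrix (Idx m) (Idx m) ℝ) : act g (0 : Idx m → F) = 0 :=
  Matrix.mulVec_zero _

theorem act_sum {ι : Type*} (s : Finset ι) (g : Matrix (Idx m) (Idx m) ℝ) (w : ι → Idx m → F) :
    act g (∑ i ∈ s, w i) = ∑ i ∈ s, act g (w i) := by
  exact map_sum (Matrix.mulVecLin (g.map (algebraMap ℝ F))) w s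

theorem act_single (g : Matrix (Idx m) (Idx m) ℝ) (b : Idx m) :
    act g (Pi.single b (1 : F)) = fun a => algebraMap ℝ F (g a b) := by
  funext a; simp [act, Pi.single_apply, -Fintype.sum_sum_type]

end action

/-! ### Horizontal derivations along tangent vector fields -/

section horizontal

variable {m : ℕ}

theorem derivation_act (d : Derivation ℝ (JetRat m) (JetRat m)) (g : Matrix (Idx m) (Idx m) ℝ)
    (v : Idx m → JetRat m) (a : Idx m) : d (act g v a) = act g (fun b => d (v b)) a := by
  simp [act, -Fintype.sum_sum_type]

theorem HasValue.act {y : Idx m → JetRat m} {j : JetVar m → ℝ} {y' : Idx m → ℝ}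
    (g : Matrix (Idx m) (Idx m) ℝ) (hy : ∀ a, HasValue (y a) j (y' a)) (a : Idx m) :
    HasValue (act g y a) j (act g y' a) :=
  HasValue.sum _ fun _ _ => (HasValue.const j _).mul (hy _)

/-- The derivative of the position vector along a tangent vector is that vector. So a tangent field
is recovered from its derivation. -/
theorem horizontal_position {y : Idx m → JetRat m} (hy : dq gen y = 0) (a : Idx m) :
    horizontal y (position gen a) = y a := by
  induction a using idx_cases with
  | h i => simp [position, horizontal_apply, totalDer_x, -Fintype.sum_sum_type]
  | h' =>
    rw [position, pt_dep, horizontal_apply]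
    rw [dq, sub_eq_zero] at hy
    rw [← hy]
    refine Finset.sum_congr rfl fun i _ => ?_
    rw [totalDer_u, zero_add, mul_comm]

theorem horizontal_congr {y z : Idx m → JetRat m} (h : ∀ i, y (emb i) = z (emb i)) :
    horizontal y = horizontal z := by
  simp only [horizontal, h]

theorem horizontal_sum {ι : Type*} (s : Finset ι) (c : ι → JetRat m) (y : ι → Idx m → JetRat m) :
    horizontal (∑ i ∈ s, c i • y i) = ∑ i ∈ s, c i • horizontal (y i) := by
  simp only [horizontal, Finset.sum_apply, Pi.smul_apply, smul_eq_mul, Finset.sum_smul,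
    Finset.smul_sum, mul_smul]
  exact Finset.sum_comm

theorem derivation_sum_apply {ι : Type*} (s : Finset ι)
    (d : ι → Derivation ℝ (JetRat m) (JetRat m)) (f : JetRat m) :
    (∑ i ∈ s, d i) f = ∑ i ∈ s, d i f := by
  induction s using Finset.cons_induction with
  | empty => simp
  | cons a s ha ih => rw [Finset.sum_cons, Finset.sum_cons, Derivation.add_apply, ih]

/-- The second-order terms cancel because total derivatives commute. -/
theorem bracket_horizontal (y z : Idx m → JetRat m) :
    ⁅horizontal y, horizontal z⁆ =
      horizontal (fun a => horizontal y (z a) - horizontal z (y a)) := by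
  ext f
  rw [Derivation.commutator_apply]
  have h1 : ∀ y z : Idx m → JetRat m, horizontal y (horizontal z f) =
      ∑ i, horizontal y (z (emb i)) * totalDer i f +
        ∑ k, ∑ i, y (emb i) * z (emb k) * totalDer i (totalDer k f) := by
    intro y z
    rw [horizontal_apply z, map_sum, ← Finset.sum_add_distrib]
    refine Finset.sum_congr rfl fun k _ => ?_
    rw [Derivation.leibniz, smul_eq_mul, smul_eq_mul, add_comm, horizontal_apply y (totalDer k f),
      Finset.mul_sum, mul_comm]
    congr 1
    exact Finset.sum_congr rfl fun i _ => by ring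
  rw [h1, h1, horizontal_apply, Finset.sum_comm (f := fun k i => z (emb i) * y (emb k) *
    totalDer i (totalDer k f))]
  simp only [sub_mul, Finset.sum_sub_distrib]
  have : ∑ k : Base m, ∑ i : Base m, y (emb i) * z (emb k) * totalDer i (totalDer k f) =
      ∑ k : Base m, ∑ i : Base m, z (emb k) * y (emb i) * totalDer k (totalDer i f) :=
    Finset.sum_congr rfl fun k _ => Finset.sum_congr rfl fun i _ => by
      rw [totalDer_comm, mul_comm (y _)]
  rw [this]; ring

end horizontal

/-! ### The prolonged action on functions -/

section prolongation

variable {m : ℕ} (g h : Matrix (Idx m) (Idx m) ℝ)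

/-- The values of `dq` on the columns of `h`. -/
def conormal (a : Idx m) : JetRat m := dq gen (act h (Pi.single a 1))

/-- The values of `dq` on the columns of `h`, as polynomials. -/
def conormalPoly (b : Idx m) : JetPoly m :=
  ∑ i, MvPolynomial.X (.u (Finsupp.single i 1)) * MvPolynomial.C (h (emb i) b) -
    MvPolynomial.C (h dep b)

/-- The function that vanishes where the image of the graph is not transversal to the last
coordinate axis. -/
abbrev denPoly : JetPoly m := conormalPoly h dep

theorem toRat_conormalPoly (b : Idx m) : toRat (conormalPoly h b) = conormal h b := by
  rw [conormal, act_single, conormalPoly, toRat, map_sub, map_sum, dq]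
  simp only [map_mul]
  simp only [← toRat_C]
  rfl

theorem eval_denPoly (j : JetVar m → ℝ) :
    MvPolynomial.eval j (denPoly h) = dq j (h.mulVec (Pi.single dep 1)) := by
  simp [conormalPoly, dq, -Fintype.sum_sum_type]

variable {g h}

/-- As an affine function of the slopes, the polynomial has the last column of `h` as its
coefficients. If the constant term vanishes, taking this column as slopes gives a sum of squares,
nonzero since `h` is invertible; otherwise zero slopes suffice. -/
theorem denPoly_ne_zero (hgh : g * h = 1) : denPoly h ≠ 0 := by
  classical
  let J : (Base m → ℝ) → JetVar m → ℝ := fun c t => match t with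
    | .x _ => 0
    | .u σ => ∑ i, if σ = Finsupp.single i 1 then c i else 0
  have hJ : ∀ c i, J c (.u (Finsupp.single i 1)) = c i := fun c i => by
    simp only [J]
    simp [Finsupp.single_left_inj, -Fintype.sum_sum_type]
  have key : ∀ c, MvPolynomial.eval (J c) (denPoly h) =
      ∑ i, c i * h (emb i) dep - h dep dep := fun c => by
    simp [conormalPoly, hJ, -Fintype.sum_sum_type]
  by_cases h0 : h dep dep = 0
  · refine ne_zero_of_eval_ne_zero (j := J fun i => h (emb i) dep) ?_
    rw [key, h0, sub_zero]
    intro h1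
    rw [Finset.sum_eq_zero_iff_of_nonneg fun i _ => mul_self_nonneg _] at h1
    have h2 : ∀ a, h a dep = 0 :=
      idx_cases (fun i => mul_self_eq_zero.1 (h1 i (Finset.mem_univ _))) h0
    have h3 := congrFun (congrFun hgh dep) dep
    simp [Matrix.mul_apply, h2] at h3
  · refine ne_zero_of_eval_ne_zero (j := J 0) ?_
    rw [key]; simpa using h0

theorem conormal_ne_zero (hgh : g * h = 1) : conormal h dep ≠ 0 := by
  rw [← toRat_conormalPoly, toRat_ne_zero]; exact denPoly_ne_zero hgh

theorem dq_act (y : Idx m → JetRat m) : dq gen (act h y) = ∑ a, conormal h a * y a := by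
  have h1 : y = ∑ a, y a • (Pi.single a 1 : Idx m → JetRat m) := by
    funext a; simp [Finset.sum_apply, Pi.single_apply, -Fintype.sum_sum_type]
  conv_lhs => rw [h1, act_sum, ← dqL_apply, map_sum]
  refine Finset.sum_congr rfl fun a _ => ?_
  rw [act_smul, map_smul, smul_eq_mul, mul_comm]; rfl

variable (g h)

/-- The first derivatives of the transformed function. -/
def newSlope (i : Base m) : JetRat m := -conormal h (emb i) / conormal h dep

/-- The tangent vectors that are mapped to the coordinate vectors of the transformed graph. -/
def newTangent (i : Base m) : Idx m → JetRat m := act h (pt (Pi.single i 1) (newSlope h i))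

/-- The total derivatives with respect to the transformed variables. -/
def newDer (i : Base m) : Derivation ℝ (JetRat m) (JetRat m) := horizontal (newTangent h i)

variable {g h}

theorem dq_newTangent (hgh : g * h = 1) (i : Base m) : dq gen (newTangent h i) = 0 := by
  have h0 := conormal_ne_zero hgh
  rw [newTangent, dq_act, sum_idx]
  simp only [pt_emb, pt_dep, Pi.single_apply, mul_ite, mul_one, mul_zero, Finset.sum_ite_eq',
    Finset.mem_univ, if_true, newSlope]
  field_simp; ring

theorem newDer_position (hgh : g * h = 1) (i : Base m) (a : Idx m) :
    newDer h i (act g (position gen) a) = pt (Pi.single i 1) (newSlope h i) a := by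
  rw [newDer, derivation_act]
  simp only [horizontal_position (dq_newTangent hgh i)]
  rw [newTangent]
  show act g (act h _) a = _
  rw [act_act hgh]

theorem act_tangent (hgh : g * h = 1) {y : Idx m → JetRat m} (hy : dq gen y = 0) :
    act g y dep = ∑ i, act g y (emb i) * newSlope h i := by
  have h0 := conormal_ne_zero hgh
  have h1 : dq gen (act h (act g y)) = 0 := by rw [act_act (mul_eq_one_comm.1 hgh), hy]
  rw [dq_act, sum_idx] at h1
  rw [← mul_right_inj' h0, eq_neg_of_add_eq_zero_right h1, Finset.mul_sum, ← Finset.sum_neg_distrib]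
  refine Finset.sum_congr rfl fun i _ => ?_
  rw [newSlope]; field_simp

theorem horizontal_eq_newDer (hgh : g * h = 1) {y : Idx m → JetRat m} (hy : dq gen y = 0) :
    horizontal y = ∑ i, act g y (emb i) • newDer h i := by
  simp only [newDer]
  rw [← horizontal_sum]
  congr 1
  simp only [newTangent, ← act_smul]
  rw [← act_sum]
  have : ∑ i : Base m, act g y (emb i) • pt (Pi.single i 1) (newSlope h i) = act g y := by
    refine idx_ext (fun k => ?_) ?_
    · simp [Finset.sum_apply, Pi.single_apply, -Fintype.sum_sum_type]
    · simp [Finset.sum_apply, act_tangent hgh hy, -Fintype.sum_sum_type]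
  rw [this, act_act (mul_eq_one_comm.1 hgh)]

/-- The bracket is the horizontal derivation of a tangent field `z`. It annihilates the transformed
independent variables, whose derivatives are constants; a tangent vector whose image has no
components along them is zero. -/
theorem newDer_comm (hgh : g * h = 1) (i k : Base m) (f : JetRat m) :
    newDer h i (newDer h k f) = newDer h k (newDer h i f) := by
  obtain ⟨z, hz0, hz⟩ : ∃ z, dq gen z = 0 ∧ ⁅newDer h i, newDer h k⁆ = horizontal z := by
    refine ⟨tangentVec gen fun l => newDer h i (newTangent h k (emb l)) -
      newDer h k (newTangent h i (emb l)), dq_tangentVec _ _, ?_⟩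
    rw [newDer, newDer, bracket_horizontal]
    exact horizontal_congr fun l => by simp [tangentVec]
  have h1 : ∀ l, act g z (emb l) = 0 := by
    intro l
    have h2 : horizontal z (act g (position gen) (emb l)) = act g z (emb l) := by
      rw [derivation_act]; simp only [horizontal_position hz0]
    rw [← h2, ← hz, Derivation.commutator_apply, newDer_position hgh, newDer_position hgh, pt_emb,
      pt_emb, Pi.single_apply, Pi.single_apply]
    split_ifs <;> simp
  have h3 : act g z = 0 := idx_ext h1 (by rw [act_tangent hgh hz0]; simp [h1])
  have h4 : z = 0 := by rw [← act_act (mul_eq_one_comm.1 hgh) z, h3, act_zero]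
  have h5 := congrArg (fun d => d f) hz
  simp only [Derivation.commutator_apply, h4, horizontal_apply, Pi.zero_apply, zero_mul,
    Finset.sum_const_zero, sub_eq_zero] at h5
  exact h5

variable (g h)

/-- The pull-backs of the coordinate functions. -/
def newCoord : JetVar m → JetRat m
  | .x i => act g (position gen) (emb i)
  | .u σ => (Finsupp.toMultiset σ).toList.foldr (fun i f => newDer h i f)
      (act g (position gen) dep)

variable {g h}

theorem newCoord_zero : newCoord g h (.u 0) = act g (position gen) dep := by
  simp [newCoord]

/-- The order of differentiation chosen in `newCoord` is arbitrary, and commutation makes it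
irrelevant. -/
theorem newCoord_add (hgh : g * h = 1) (σ : Base m →₀ ℕ) (i : Base m) :
    newCoord g h (.u (σ + Finsupp.single i 1)) = newDer h i (newCoord g h (.u σ)) := by
  have hc : LeftCommutative (fun (i : Base m) (f : JetRat m) => newDer h i f) :=
    ⟨fun i k f => newDer_comm hgh i k f⟩
  have hp : (Finsupp.toMultiset (σ + Finsupp.single i 1)).toList.Perm
      (i :: (Finsupp.toMultiset σ).toList) := by
    rw [← Multiset.coe_eq_coe, Multiset.coe_toList, ← Multiset.cons_coe, Multiset.coe_toList,
      map_add, Finsupp.toMultiset_single, one_smul, add_comm, Multiset.singleton_add]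
  simp only [newCoord]
  rw [hp.foldr_eq]
  rfl

/-- The total derivative of polynomial functions. -/
def totalDerPoly (i : Base m) : Derivation ℝ (JetPoly m) (JetPoly m) :=
  MvPolynomial.mkDerivation ℝ fun t => match t with
    | .x k => if i = k then 1 else 0
    | .u σ => MvPolynomial.X (.u (σ + Finsupp.single i 1))

theorem toRat_totalDerPoly (i : Base m) (p : JetPoly m) :
    toRat (totalDerPoly i p) = totalDer i (toRat p) := by
  induction p using MvPolynomial.induction_on with
  | C a =>
    rw [toRat_C, Derivation.map_algebraMap, ← MvPolynomial.algebraMap_eq,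
      Derivation.map_algebraMap, toRat, map_zero]
  | add p q hp hq => simp only [toRat, map_add] at *; rw [hp, hq]
  | mul_X p t hp =>
    simp only [toRat, Derivation.leibniz, smul_eq_mul, map_add, map_mul] at *
    rw [hp]
    congr 2
    show toRat (totalDerPoly i (MvPolynomial.X t)) = totalDer i (gen t)
    cases t with
    | x k =>
      rw [totalDer_x, totalDerPoly, MvPolynomial.mkDerivation_X]
      simp only [toRat, apply_ite (algebraMap (JetPoly m) (JetRat m)), map_one, map_zero]
    | u σ => rw [totalDer_u, totalDerPoly, MvPolynomial.mkDerivation_X]; rfl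

variable (g h)

/-- The pull-back of polynomial functions. -/
def newPoly : JetPoly m →ₐ[ℝ] JetRat m := MvPolynomial.aeval (newCoord g h)

variable {g h}

/-- The chain rule: pulling back turns the total derivative with respect to a variable into that
with respect to the transformed variable. -/
theorem newDer_newPoly (hgh : g * h = 1) (i : Base m) (p : JetPoly m) :
    newDer h i (newPoly g h p) = newPoly g h (totalDerPoly i p) := by
  induction p using MvPolynomial.induction_on with
  | C a => simp [newPoly, totalDerPoly]
  | add p q hp hq => simp only [map_add] at *; rw [hp, hq]
  | mul_X p t hp =>
    rw [map_mul, Derivation.leibniz, Derivation.leibniz, map_add, smul_eq_mul, smul_eq_mul,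
      smul_eq_mul, smul_eq_mul, map_mul, map_mul, hp]
    congr 2
    have hX : ∀ t, newPoly g h (MvPolynomial.X t) = newCoord g h t := fun t =>
      MvPolynomial.aeval_X _ _
    rw [hX]
    cases t with
    | x k =>
      rw [totalDerPoly, MvPolynomial.mkDerivation_X]
      simp only [newCoord]
      rw [newDer_position hgh, pt_emb, Pi.single_apply]
      simp only [apply_ite (newPoly g h), map_one, map_zero, eq_comm]
    | u σ => rw [totalDerPoly, MvPolynomial.mkDerivation_X, hX, newCoord_add hgh]

end prolongation

open Filter Topology

/-! ### Jets of functions -/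

section jets

variable {m : ℕ}

theorem natCast_ne_infty (n : ℕ) : (n : ℕ∞ω) ≠ ∞ := by simp

/-- Iterated partial derivatives. -/
def iterPartial (l : List (Base m)) (u : (Base m → ℝ) → ℝ) : (Base m → ℝ) → ℝ :=
  l.foldr (fun i f x => fderiv ℝ f x (Pi.single i 1)) u

theorem iterPartial_cons (i : Base m) (l : List (Base m)) (u : (Base m → ℝ) → ℝ) :
    iterPartial (i :: l) u = fun x => fderiv ℝ (iterPartial l u) x (Pi.single i 1) := rfl

theorem contDiffAt_iterPartial {u : (Base m → ℝ) → ℝ} {x : Base m → ℝ} (l : List (Base m)) :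
    ∀ k : ℕ, ContDiffAt ℝ ((k + l.length : ℕ) : ℕ∞ω) u x →
      ContDiffAt ℝ (k : ℕ∞ω) (iterPartial l u) x := by
  induction l with
  | nil => intro k h; simpa [iterPartial] using h
  | cons i l ih =>
    intro k h
    have h1 : ContDiffAt ℝ ((k + 1 : ℕ) : ℕ∞ω) (iterPartial l u) x := by
      refine ih (k + 1) ?_
      rw [List.length_cons] at h
      rwa [add_assoc, add_comm 1]
    rw [iterPartial_cons]
    exact (h1.fderiv_right (m := (k : ℕ∞ω)) (by push_cast; exact le_rfl)).clm_apply
      contDiffAt_const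

/-- Symmetry of second derivatives handles a transposition. Equality near the point, rather than
only at it, is carried along so that further differentiation is possible. -/
theorem iterPartial_perm {u : (Base m → ℝ) → ℝ} {l l' : List (Base m)} (hl : l.Perm l') :
    ∀ {x : Base m → ℝ}, ContDiffAt ℝ (l.length : ℕ∞ω) u x →
      iterPartial l u =ᶠ[𝓝 x] iterPartial l' u := by
  induction hl with
  | nil => intro x _; exact EventuallyEq.rfl
  | cons i hl ih =>
    intro x h
    have h1 := ih (h.of_le (by rw [List.length_cons]; push_cast; exact le_self_add))
    filter_upwards [h1.fderiv (𝕜 := ℝ)] with y hy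
    simp only [iterPartial_cons, hy]
  | swap i k l =>
    intro x h
    have h1 := h.eventually (natCast_ne_infty _)
    filter_upwards [h1] with y hy
    have h2 : ContDiffAt ℝ ((2 : ℕ) : ℕ∞ω) (iterPartial l u) y := by
      exact contDiffAt_iterPartial l 2 (hy.of_le (Nat.cast_le.2 (by simp; omega)))
    have h3 : IsSymmSndFDerivAt ℝ (iterPartial l u) y :=
      h2.isSymmSndFDerivAt (by simp)
    have h4 : DifferentiableAt ℝ (fderiv ℝ (iterPartial l u)) y :=
      (h2.fderiv_right (m := 1) (by norm_num)).differentiableAt (by simp)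
    have h5 : ∀ v w : Base m → ℝ, fderiv ℝ (fun z => fderiv ℝ (iterPartial l u) z v) y w =
        fderiv ℝ (fderiv ℝ (iterPartial l u)) y w v := by
      intro v w
      rw [fderiv_clm_apply h4 (differentiableAt_const v)]
      simp
    simp only [iterPartial_cons]
    rw [h5, h5, h3]
  | trans h1 h2 ih1 ih2 =>
    intro x h
    exact (ih1 h).trans (ih2 (by rwa [← h1.length_eq]))

/-- The jet of a function. -/
def jetOf (u : (Base m → ℝ) → ℝ) (x : Base m → ℝ) : JetVar m → ℝ
  | .x i => x i
  | .u σ => iterPartial (Finsupp.toMultiset σ).toList u x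

theorem iteratedFDeriv_eq_iterPartial {u : (Base m → ℝ) → ℝ} (r : ℕ) :
    ∀ {x : Base m → ℝ} (s : Fin r → Base m), ContDiffAt ℝ (r : ℕ∞ω) u x →
      iteratedFDeriv ℝ r u x (fun l => Pi.single (s l) 1) = iterPartial (List.ofFn s) u x := by
  induction r with
  | zero => intro x s _; simp [iterPartial]
  | succ r ih =>
    intro x s h
    have h1 : DifferentiableAt ℝ (iteratedFDeriv ℝ r u) x :=
      h.differentiableAt_iteratedFDeriv (by exact_mod_cast Nat.lt_succ_self r)
    rw [iteratedFDeriv_succ_apply_left, ← fderiv_continuousMultilinear_apply_const_apply h1,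
      List.ofFn_succ, iterPartial_cons]
    have h2 : (fun y => iteratedFDeriv ℝ r u y fun l : Fin r => Pi.single (s l.succ) 1) =ᶠ[𝓝 x]
        iterPartial (List.ofFn fun i => s i.succ) u := by
      filter_upwards [h.eventually (natCast_ne_infty _)] with y hy
      exact ih (fun i => s i.succ) (hy.of_le (by exact_mod_cast Nat.le_succ r))
    exact congrArg (fun L : (Base m → ℝ) →L[ℝ] ℝ => L (Pi.single (s 0) 1)) h2.fderiv_eq

theorem toMultiset_sum_single {r : ℕ} (s : Fin r → Base m) :
    Finsupp.toMultiset (∑ l, Finsupp.single (s l) 1) = (List.ofFn s : Multiset (Base m)) := by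
  rw [map_sum]
  simp only [Finsupp.toMultiset_single, one_smul]
  induction r with
  | zero => simp
  | succ r ih => rw [Fin.sum_univ_succ, ih, List.ofFn_succ]; rfl

theorem isJet_jetOf {u : (Base m → ℝ) → ℝ} {a : Base m → ℝ} (hu : ContDiffAt ℝ ∞ u a) :
    IsJet u a (jetOf u a) := by
  refine ⟨fun i => rfl, fun r s => ?_⟩
  have h1 : ∀ n : ℕ, ContDiffAt ℝ (n : ℕ∞ω) u a := fun n => hu.of_le (by exact_mod_cast le_top)
  rw [iteratedFDeriv_eq_iterPartial r s (h1 r), jetOf]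
  refine (iterPartial_perm ?_ (h1 _)).self_of_nhds
  rw [← Multiset.coe_eq_coe, Multiset.coe_toList, toMultiset_sum_single]

/-- Every multi-index is a sum of unit multi-indices, so the jet of a function at a point is
uniquely determined. -/
theorem IsJet.eq_jetOf {u : (Base m → ℝ) → ℝ} {a : Base m → ℝ} {j : JetVar m → ℝ}
    (hu : ContDiffAt ℝ ∞ u a) (hj : IsJet u a j) : j = jetOf u a := by
  have h := isJet_jetOf hu
  funext t
  cases t with
  | x i => exact hj.1 i
  | u σ =>
    have h1 : ∑ l, Finsupp.single ((Finsupp.toMultiset σ).toList.get l) 1 = σ := by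
      refine Multiset.toFinsupp.symm.injective ?_
      show Finsupp.toMultiset _ = Finsupp.toMultiset _
      rw [toMultiset_sum_single, List.ofFn_get, Multiset.coe_toList]
    have h2 := hj.2 _ (Finsupp.toMultiset σ).toList.get
    rw [← h.2, h1] at h2
    exact h2

theorem differentiableAt_jetOf {u : (Base m → ℝ) → ℝ} {a : Base m → ℝ}
    (hu : ContDiffAt ℝ ∞ u a) (σ : Base m →₀ ℕ) :
    ∀ᶠ x in 𝓝 a, DifferentiableAt ℝ (fun y => jetOf u y (.u σ)) x ∧
      ∀ k, fderiv ℝ (fun y => jetOf u y (.u σ)) x (Pi.single k 1) =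
        jetOf u x (.u (σ + Finsupp.single k 1)) := by
  set l := (Finsupp.toMultiset σ).toList
  have h1 : ContDiffAt ℝ ((1 + l.length : ℕ) : ℕ∞ω) u a := hu.of_le (by exact_mod_cast le_top)
  filter_upwards [h1.eventually (natCast_ne_infty _)] with x hx
  refine ⟨(contDiffAt_iterPartial l 1 hx).differentiableAt (by simp), fun k => ?_⟩
  have hp : (k :: l).Perm (Finsupp.toMultiset (σ + Finsupp.single k 1)).toList := by
    rw [← Multiset.coe_eq_coe, Multiset.coe_toList, ← Multiset.cons_coe, Multiset.coe_toList,
      map_add, Finsupp.toMultiset_single, one_smul, add_comm, Multiset.singleton_add]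
  exact (iterPartial_perm hp (hx.of_le (Nat.cast_le.2 (by simp [add_comm])))).self_of_nhds

theorem jetOf_zero (u : (Base m → ℝ) → ℝ) (x : Base m → ℝ) : jetOf u x (.u 0) = u x := by
  simp [jetOf, iterPartial]

theorem fderiv_eq_sum_single {f : (Base m → ℝ) → ℝ} {x : Base m → ℝ} (y : Base m → ℝ) :
    fderiv ℝ f x y = ∑ k, y k * fderiv ℝ f x (Pi.single k 1) := by
  classical
  have h : y = ∑ k, y k • (Pi.single k 1 : Base m → ℝ) := by
    funext a; simp [Finset.sum_apply, Pi.single_apply, -Fintype.sum_sum_type]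
  conv_lhs => rw [h, map_sum]
  simp only [map_smul, smul_eq_mul]

theorem fderiv_eq_jetOf {u : (Base m → ℝ) → ℝ} {a : Base m → ℝ} (hu : ContDiffAt ℝ ∞ u a)
    (y : Base m → ℝ) :
    fderiv ℝ u a y = ∑ k, jetOf u a (.u (Finsupp.single k 1)) * y k := by
  have h := (differentiableAt_jetOf hu 0).self_of_nhds
  simp only [jetOf_zero, zero_add] at h
  rw [fderiv_eq_sum_single]
  exact Finset.sum_congr rfl fun k _ => by rw [← h.2 k, mul_comm]

/-! ### Rational functions along the jets of a function -/

theorem eval_jetOf {u : (Base m → ℝ) → ℝ} {a : Base m → ℝ} (hu : ContDiffAt ℝ ∞ u a)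
    (p : JetPoly m) :
    ∀ᶠ x in 𝓝 a, DifferentiableAt ℝ (fun y => MvPolynomial.eval (jetOf u y) p) x ∧
      ∀ k, fderiv ℝ (fun y => MvPolynomial.eval (jetOf u y) p) x (Pi.single k 1) =
        MvPolynomial.eval (jetOf u x) (totalDerPoly k p) := by
  classical
  induction p using MvPolynomial.induction_on with
  | C c =>
    refine Eventually.of_forall fun x => ?_
    have h : ∀ k, totalDerPoly (m := m) k (MvPolynomial.C c) = 0 := fun k =>
      Derivation.map_algebraMap _ _
    simp [h]
  | add p q hp hq =>
    filter_upwards [hp, hq] with x hp hq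
    simp only [map_add]
    refine ⟨hp.1.add hq.1, fun k => ?_⟩
    rw [fderiv_fun_add hp.1 hq.1, add_apply, hp.2, hq.2]
  | mul_X p t hp =>
    have ht : ∀ᶠ x in 𝓝 a, DifferentiableAt ℝ (fun y => jetOf u y t) x ∧
        ∀ k, fderiv ℝ (fun y => jetOf u y t) x (Pi.single k 1) =
          MvPolynomial.eval (jetOf u x) (totalDerPoly k (MvPolynomial.X t)) := by
      cases t with
      | x i =>
        refine Eventually.of_forall fun x => ⟨differentiableAt_apply i x, fun k => ?_⟩
        simp only [jetOf, totalDerPoly, MvPolynomial.mkDerivation_X]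
        rw [(hasFDerivAt_apply i x).fderiv, ContinuousLinearMap.proj_apply, Pi.single_apply]
        split_ifs with h1 h2 h2
        · simp
        · exact absurd h1.symm h2
        · exact absurd h2.symm h1
        · simp
      | u σ =>
        filter_upwards [differentiableAt_jetOf hu σ] with x hx
        refine ⟨hx.1, fun k => ?_⟩
        rw [hx.2, totalDerPoly, MvPolynomial.mkDerivation_X, MvPolynomial.eval_X]
    filter_upwards [hp, ht] with x hp ht
    simp only [map_mul, MvPolynomial.eval_X]
    refine ⟨hp.1.mul ht.1, fun k => ?_⟩
    rw [fderiv_fun_mul hp.1 ht.1]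
    simp only [add_apply, smul_apply, smul_eq_mul,
      hp.2, ht.2, Derivation.leibniz, map_add, map_mul, MvPolynomial.eval_X]

theorem eval_jetOf_ne_zero {u : (Base m → ℝ) → ℝ} {a : Base m → ℝ} (hu : ContDiffAt ℝ ∞ u a)
    {p : JetPoly m} (hp : MvPolynomial.eval (jetOf u a) p ≠ 0) :
    ∀ᶠ x in 𝓝 a, MvPolynomial.eval (jetOf u x) p ≠ 0 :=
  (eval_jetOf hu p).self_of_nhds.1.continuousAt.eventually_ne hp

/-- Near `a`, the function `H` is the rational function `f` of the jets of `u`. -/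
def RatAlong (u : (Base m → ℝ) → ℝ) (a : Base m → ℝ) (f : JetRat m) (H : (Base m → ℝ) → ℝ) :
    Prop :=
  ∃ p q : JetPoly m, MvPolynomial.eval (jetOf u a) q ≠ 0 ∧ f * toRat q = toRat p ∧
    ∀ᶠ x in 𝓝 a, H x = MvPolynomial.eval (jetOf u x) p / MvPolynomial.eval (jetOf u x) q

variable {u : (Base m → ℝ) → ℝ} {a : Base m → ℝ}

theorem RatAlong.hasValue {f : JetRat m} {H : (Base m → ℝ) → ℝ} (h : RatAlong u a f H) :
    HasValue f (jetOf u a) (H a) := by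
  obtain ⟨p, q, hq, hf, hH⟩ := h
  exact ⟨p, q, hq, hf, hH.self_of_nhds⟩

theorem RatAlong.eventually_hasValue (hu : ContDiffAt ℝ ∞ u a) {f : JetRat m}
    {H : (Base m → ℝ) → ℝ} (h : RatAlong u a f H) : ∀ᶠ x in 𝓝 a, HasValue f (jetOf u x) (H x) := by
  obtain ⟨p, q, hq, hf, hH⟩ := h
  filter_upwards [eval_jetOf_ne_zero hu hq, hH] with x h1 h2
  exact ⟨p, q, h1, hf, h2⟩

theorem RatAlong.unique (hu : ContDiffAt ℝ ∞ u a) {f : JetRat m} {H H' : (Base m → ℝ) → ℝ}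
    (h : RatAlong u a f H) (h' : RatAlong u a f H') : H =ᶠ[𝓝 a] H' := by
  filter_upwards [h.eventually_hasValue hu, h'.eventually_hasValue hu] with x h1 h2
  exact h1.unique h2

theorem RatAlong.congr {f : JetRat m} {H H' : (Base m → ℝ) → ℝ} (h : RatAlong u a f H)
    (hH : H' =ᶠ[𝓝 a] H) : RatAlong u a f H' := by
  obtain ⟨p, q, hq, hf, h1⟩ := h
  exact ⟨p, q, hq, hf, by filter_upwards [h1, hH] with x h1 h2; rw [h2, h1]⟩

theorem RatAlong.toRat (p : JetPoly m) :
    RatAlong u a (toRat p) fun x => MvPolynomial.eval (jetOf u x) p :=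
  ⟨p, 1, by simp, by simp, by simp⟩

theorem RatAlong.gen (t : JetVar m) : RatAlong u a (gen t) fun x => jetOf u x t := by
  simpa [toRat_X] using RatAlong.toRat (u := u) (a := a) (MvPolynomial.X t)

theorem RatAlong.const (c : ℝ) : RatAlong u a (algebraMap ℝ _ c) fun _ => c := by
  simpa [toRat_C] using RatAlong.toRat (u := u) (a := a) (MvPolynomial.C c)

theorem RatAlong.add (hu : ContDiffAt ℝ ∞ u a) {f g : JetRat m} {H G : (Base m → ℝ) → ℝ}
    (hf : RatAlong u a f H) (hg : RatAlong u a g G) :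
    RatAlong u a (f + g) fun x => H x + G x := by
  obtain ⟨p, q, hq, hf, hH⟩ := hf
  obtain ⟨p', q', hq', hf', hG⟩ := hg
  refine ⟨p * q' + p' * q, q * q', by simp [hq, hq'], ?_, ?_⟩
  · simp only [SympHyp.toRat, map_add, map_mul] at *
    rw [← hf, ← hf']; ring
  · filter_upwards [hH, hG, eval_jetOf_ne_zero hu hq, eval_jetOf_ne_zero hu hq'] with x h1 h2 h3 h4
    rw [h1, h2]; simp only [map_add, map_mul]; field_simp

theorem RatAlong.mul {f g : JetRat m} {H G : (Base m → ℝ) → ℝ}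
    (hf : RatAlong u a f H) (hg : RatAlong u a g G) :
    RatAlong u a (f * g) fun x => H x * G x := by
  obtain ⟨p, q, hq, hf, hH⟩ := hf
  obtain ⟨p', q', hq', hf', hG⟩ := hg
  refine ⟨p * p', q * q', by simp [hq, hq'], ?_, ?_⟩
  · simp only [SympHyp.toRat, map_mul] at *
    rw [← hf, ← hf']; ring
  · filter_upwards [hH, hG] with x h1 h2
    rw [h1, h2, map_mul, map_mul, div_mul_div_comm]

theorem RatAlong.inv {f : JetRat m} {H : (Base m → ℝ) → ℝ}
    (hf : RatAlong u a f H) (h0 : H a ≠ 0) : RatAlong u a f⁻¹ fun x => (H x)⁻¹ := by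
  obtain ⟨p, q, hq, hf, hH⟩ := hf
  have h1 := hH.self_of_nhds
  have hp : MvPolynomial.eval (jetOf u a) p ≠ 0 := fun h => h0 (by rw [h1, h, zero_div])
  have hf0 : f ≠ 0 := by
    rintro rfl
    rw [zero_mul] at hf
    exact toRat_ne_zero_of_eval hp hf.symm
  refine ⟨q, p, hp, by rw [← hf, inv_mul_cancel_left₀ hf0], ?_⟩
  filter_upwards [hH] with x hx
  rw [hx, inv_div]

theorem RatAlong.sum (hu : ContDiffAt ℝ ∞ u a) {ι : Type*} (s : Finset ι) {f : ι → JetRat m}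
    {H : ι → (Base m → ℝ) → ℝ} (h : ∀ i ∈ s, RatAlong u a (f i) (H i)) :
    RatAlong u a (∑ i ∈ s, f i) fun x => ∑ i ∈ s, H i x := by
  induction s using Finset.cons_induction with
  | empty => simpa using RatAlong.const (u := u) (a := a) 0
  | cons i s hi ih =>
    simp only [Finset.sum_cons]
    exact (h i (by simp)).add hu (ih fun k hk => h k (by simp [hk]))

/-- Total derivatives are ordinary derivatives along the jets of a function. The quotient rule is
obtained by differentiating `f q = p`, algebraically and analytically. -/
theorem RatAlong.totalDer (hu : ContDiffAt ℝ ∞ u a) {f : JetRat m} {H : (Base m → ℝ) → ℝ}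
    (hf : RatAlong u a f H) (k : Base m) :
    RatAlong u a (totalDer k f) fun x => fderiv ℝ H x (Pi.single k 1) := by
  obtain ⟨p, q, hq, hf, hH⟩ := hf
  have hq0 : SympHyp.toRat q ≠ 0 := toRat_ne_zero_of_eval hq
  refine ⟨q * totalDerPoly k p - p * totalDerPoly k q, q ^ 2, by simp [hq], ?_, ?_⟩
  · have h1 := congrArg (SympHyp.totalDer k) hf
    rw [Derivation.leibniz, smul_eq_mul, smul_eq_mul] at h1
    simp only [SympHyp.toRat, map_sub, map_mul, map_pow]
    simp only [SympHyp.toRat] at h1 hf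
    have h2 := toRat_totalDerPoly k p
    have h3 := toRat_totalDerPoly k q
    simp only [SympHyp.toRat] at h2 h3
    rw [h2, h3, ← h1, ← hf]; ring
  · filter_upwards [EventuallyEq.eventuallyEq_nhds hH, eval_jetOf hu p, eval_jetOf hu q,
      eval_jetOf_ne_zero hu hq] with x h1 h2 h3 h4
    have h5 : DifferentiableAt ℝ H x := by
      refine DifferentiableAt.congr_of_eventuallyEq ?_ h1
      simp only [div_eq_mul_inv]
      exact h2.1.mul (h3.1.inv h4)
    have h6 : (fun y => H y * MvPolynomial.eval (jetOf u y) q) =ᶠ[𝓝 x]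
        fun y => MvPolynomial.eval (jetOf u y) p := by
      filter_upwards [h1, h3.1.continuousAt.eventually_ne h4] with y h6 h7
      rw [h6, div_mul_cancel₀ _ h7]
    have h7 := congrArg (fun L : (Base m → ℝ) →L[ℝ] ℝ => L (Pi.single k 1)) h6.fderiv_eq
    simp only [fderiv_fun_mul h5 h3.1, add_apply, smul_apply, smul_eq_mul, h2.2, h3.2] at h7
    have h8 := h1.self_of_nhds
    rw [map_sub, map_mul, map_mul, map_pow, ← h7]
    simp only [h8]
    field_simp
    ring

end jets

/-! ### Images of graphs under linear maps -/

section images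

variable {m : ℕ}

/-- The linear map `(x, s) ↦ g (x, s)`. -/
def graphL (g : Matrix (Idx m) (Idx m) ℝ) : (Base m → ℝ) × ℝ →L[ℝ] Idx m → ℝ :=
  LinearMap.toContinuousLinearMap
    { toFun := fun z => g.mulVec (pt z.1 z.2)
      map_add' := fun y z => by
        rw [← Matrix.mulVec_add]; congr 1
        exact idx_ext (fun k => by simp) (by simp)
      map_smul' := fun c z => by
        rw [RingHom.id_apply, ← Matrix.mulVec_smul]; congr 1
        exact idx_ext (fun k => by simp) (by simp) }

/-- The first components of the image of the graph. -/
def imageBase (g : Matrix (Idx m) (Idx m) ℝ) (u : (Base m → ℝ) → ℝ) (x : Base m → ℝ) :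
    Base m → ℝ := fun i => g.mulVec (pt x (u x)) (emb i)

variable {g h : Matrix (Idx m) (Idx m) ℝ} {u u' : (Base m → ℝ) → ℝ} {a a' : Base m → ℝ}

theorem pt_imageBase (x : Base m → ℝ) :
    pt (imageBase g u x) (g.mulVec (pt x (u x)) dep) = g.mulVec (pt x (u x)) :=
  idx_ext (fun k => by simp [imageBase]) (by simp)

theorem eq_imageBase {x x' : Base m → ℝ} {s : ℝ} (hx : g.mulVec (pt x (u x)) = pt x' s) :
    x' = imageBase g u x ∧ s = g.mulVec (pt x (u x)) dep := by
  constructor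
  · funext i; simp [imageBase, hx]
  · simp [hx]

theorem hasFDerivAt_image (hu : DifferentiableAt ℝ u a) :
    HasFDerivAt (fun x => g.mulVec (pt x (u x)))
      ((graphL g).comp ((ContinuousLinearMap.id ℝ _).prod (fderiv ℝ u a))) a :=
  (graphL g).hasFDerivAt.comp a ((hasFDerivAt_id a).prodMk hu.hasFDerivAt)

theorem contDiffAt_image (hu : ContDiffAt ℝ ∞ u a) :
    ContDiffAt ℝ ∞ (fun x => g.mulVec (pt x (u x))) a :=
  (graphL g).contDiff.contDiffAt.comp a (contDiffAt_id.prodMk hu)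

theorem contDiffAt_imageBase (hu : ContDiffAt ℝ ∞ u a) : ContDiffAt ℝ ∞ (imageBase g u) a :=
  contDiffAt_pi.2 fun i => contDiffAt_pi.1 (contDiffAt_image hu) (emb i)

theorem fderiv_image_apply (hu : DifferentiableAt ℝ u a) (b : Idx m) (y : Base m → ℝ) :
    fderiv ℝ (fun x => g.mulVec (pt x (u x)) b) a y =
      g.mulVec (pt y (fderiv ℝ u a y)) b := by
  rw [(hasFDerivAt_pi'.1 (hasFDerivAt_image (g := g) hu) b).fderiv]
  rfl

theorem fderiv_imageBase_apply (hu : DifferentiableAt ℝ u a) (y : Base m → ℝ) (i : Base m) :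
    fderiv ℝ (imageBase g u) a y i = g.mulVec (pt y (fderiv ℝ u a y)) (emb i) := by
  have h1 : HasFDerivAt (imageBase g u) (ContinuousLinearMap.pi fun i =>
      (ContinuousLinearMap.proj (emb i)).comp
        ((graphL g).comp ((ContinuousLinearMap.id ℝ _).prod (fderiv ℝ u a)))) a :=
    hasFDerivAt_pi.2 fun i => hasFDerivAt_pi'.1 (hasFDerivAt_image (g := g) hu) (emb i)
  rw [h1.fderiv]
  rfl

theorem dq_pt_fderiv (hu : ContDiffAt ℝ ∞ u a) (y : Base m → ℝ) :
    dq (jetOf u a) (pt y (fderiv ℝ u a y)) = 0 := by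
  rw [dq, fderiv_eq_jetOf hu]
  simp only [pt_emb, pt_dep, sub_self]

/-- A kernel vector gives a tangent vector of the graph that `g` maps to a multiple of `∂/∂yₙ`. It
is a multiple of `h ∂/∂yₙ`, which is not tangent when `denPoly h` is nonzero. -/
theorem fderiv_imageBase_injective (hgh : g * h = 1) (hu : ContDiffAt ℝ ∞ u a)
    (hD : MvPolynomial.eval (jetOf u a) (denPoly h) ≠ 0) :
    Function.Injective (fderiv ℝ (imageBase g u) a) := by
  refine (injective_iff_map_eq_zero _).2 fun y hy => ?_
  have hu1 : DifferentiableAt ℝ u a := hu.differentiableAt (by simp)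
  set z := pt y (fderiv ℝ u a y)
  have h1 : g.mulVec z = g.mulVec z dep • Pi.single dep 1 := by
    refine idx_ext (fun k => ?_) (by simp)
    rw [← fderiv_imageBase_apply hu1, hy]
    simp [emb_ne_dep]
  have h2 : z = g.mulVec z dep • h.mulVec (Pi.single dep 1) := by
    rw [← Matrix.mulVec_smul, ← h1, Matrix.mulVec_mulVec, mul_eq_one_comm.1 hgh,
      Matrix.one_mulVec]
  have h3 := dq_pt_fderiv hu y
  change dq (jetOf u a) z = 0 at h3
  rw [h2, ← dqL_apply, map_smul, dqL_apply, ← eval_denPoly, smul_eq_mul, mul_eq_zero,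
    or_iff_left hD] at h3
  rw [h3, zero_smul] at h2
  funext i
  have := congrFun h2 (emb i)
  simpa [z] using this

/-- Conversely, if the image lies in a graph, `∂/∂yₙ` cannot be tangent to it: the derivative of
`u'` would have to map zero to one. -/
theorem eval_denPoly_ne_zero (hgh : g * h = 1) (hu : ContDiffAt ℝ ∞ u a)
    (hu' : DifferentiableAt ℝ u' (imageBase g u a))
    (hg : (fun x => g.mulVec (pt x (u x)) dep) =ᶠ[𝓝 a] fun x => u' (imageBase g u x)) :
    MvPolynomial.eval (jetOf u a) (denPoly h) ≠ 0 := by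
  intro h0
  have hu1 : DifferentiableAt ℝ u a := hu.differentiableAt (by simp)
  set y : Base m → ℝ := fun i => h.mulVec (Pi.single dep 1) (emb i)
  have h1 : pt y (fderiv ℝ u a y) = h.mulVec (Pi.single dep 1) := by
    refine idx_ext (fun k => by simp [y]) ?_
    rw [pt_dep, fderiv_eq_jetOf hu]
    rw [eval_denPoly, dq, sub_eq_zero] at h0
    exact h0
  have h2 : ∀ b, g.mulVec (pt y (fderiv ℝ u a y)) b = (Pi.single dep 1 : Idx m → ℝ) b := by
    intro b; rw [h1, Matrix.mulVec_mulVec, hgh, Matrix.one_mulVec]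
  have h3 : fderiv ℝ (imageBase g u) a y = 0 := by
    funext i
    rw [fderiv_imageBase_apply hu1, h2]
    simp [emb_ne_dep]
  have h4 := congrArg (fun L : (Base m → ℝ) →L[ℝ] ℝ => L y) hg.fderiv_eq
  rw [fderiv_image_apply hu1, h2] at h4
  have h5 := fderiv_comp a hu' ((contDiffAt_imageBase (g := g) hu).differentiableAt (by simp))
  have h6 : fderiv ℝ (fun x => u' (imageBase g u x)) a y = 0 := by
    change fderiv ℝ (u' ∘ imageBase g u) a y = 0
    rw [h5, ContinuousLinearMap.comp_apply, h3, map_zero]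
  rw [h6] at h4
  simp at h4

theorem RatAlong.act_position (hu : ContDiffAt ℝ ∞ u a) (b : Idx m) :
    RatAlong u a (act g (position SympHyp.gen) b) fun x => g.mulVec (pt x (u x)) b := by
  refine RatAlong.sum hu _ fun c _ => (RatAlong.const _).mul ?_
  induction c using idx_cases with
  | h i => simpa [position, jetOf] using RatAlong.gen (u := u) (a := a) (.x i)
  | h' => simpa [position, jetOf_zero] using RatAlong.gen (u := u) (a := a) (.u 0)

theorem exists_ratAlong_newTangent (hu : ContDiffAt ℝ ∞ u a)
    (hD : MvPolynomial.eval (jetOf u a) (denPoly h) ≠ 0) (i : Base m) :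
    ∃ W : (Base m → ℝ) → Base m → ℝ, ∀ k,
      RatAlong u a (newTangent h i (emb k)) fun x => W x k := by
  have h1 : ∀ b, ∃ H, RatAlong u a (pt (Pi.single i 1) (newSlope h i) b) H := by
    refine idx_cases (fun k => ⟨fun _ => if k = i then 1 else 0, ?_⟩) ?_
    · rw [pt_emb, Pi.single_apply]
      split_ifs
      · simpa using RatAlong.const (u := u) (a := a) 1
      · simpa using RatAlong.const (u := u) (a := a) 0
    · rw [pt_dep, newSlope, div_eq_mul_inv, ← toRat_conormalPoly, ← toRat_conormalPoly,
        SympHyp.toRat, ← map_neg]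
      exact ⟨_, (RatAlong.toRat _).mul ((RatAlong.toRat _).inv hD)⟩
  choose H hH using h1
  exact ⟨fun x k => ∑ b, h (emb k) b * H b x, fun k =>
    RatAlong.sum hu Finset.univ fun b _ => (RatAlong.const (h (emb k) b)).mul (hH b)⟩

theorem ratAlong_newCoord (hgh : g * h = 1) (hu : ContDiffAt ℝ ∞ u a)
    (hu' : ContDiffAt ℝ ∞ u' (imageBase g u a))
    (hg : (fun x => g.mulVec (pt x (u x)) dep) =ᶠ[𝓝 a] fun x => u' (imageBase g u x)) (t : JetVar m) :
    RatAlong u a (newCoord g h t) fun x => jetOf u' (imageBase g u x) t := by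
  cases t with
  | x i => exact RatAlong.act_position hu (emb i)
  | u σ =>
    have hD := eval_denPoly_ne_zero hgh hu (hu'.differentiableAt (by simp)) hg
    have hX := contDiffAt_imageBase (g := g) hu
    choose W hW using exists_ratAlong_newTangent hu hD
    have hder : ∀ i {f : JetRat m} {H : (Base m → ℝ) → ℝ}, RatAlong u a f H →
        RatAlong u a (newDer h i f) fun x => fderiv ℝ H x (W i x) := by
      intro i f H hf
      rw [newDer, horizontal_apply]
      simp only [fderiv_eq_sum_single (W i _)]
      exact RatAlong.sum hu _ fun k _ => (hW i k).mul (hf.totalDer hu k)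
    -- The fields `W i` are mapped by the linearized change of variables to the coordinate fields;
    -- this is the algebraic identity for `newDer` of the transformed position, read along `u`.
    have hXW : ∀ i, ∀ᶠ x in 𝓝 a, fderiv ℝ (imageBase g u) x (W i x) = Pi.single i 1 := by
      intro i
      have h1 : ∀ l, ∀ᶠ x in 𝓝 a, fderiv ℝ (fun y => g.mulVec (pt y (u y)) (emb l)) x (W i x) =
          (Pi.single i 1 : Base m → ℝ) l := by
        intro l
        refine (hder i (RatAlong.act_position hu (emb l))).unique hu ?_
        rw [newDer_position hgh, pt_emb, Pi.single_apply, Pi.single_apply]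
        split_ifs
        · simpa using RatAlong.const (u := u) (a := a) 1
        · simpa using RatAlong.const (u := u) (a := a) 0
      filter_upwards [eventually_all.2 h1, ((hu.of_le (m := ((1 : ℕ) : ℕ∞ω)) (by exact_mod_cast le_top)).eventually
          (natCast_ne_infty 1))]
        with x h1 h2
      funext l
      have h3 := h2.differentiableAt (by simp)
      rw [fderiv_imageBase_apply h3, ← fderiv_image_apply h3, h1]
    -- Induction on the order: differentiating along `W i` the identity of lower order, near the
    -- point, adds one derivative by the chain rule.
    have key : ∀ n, ∀ σ : Base m →₀ ℕ, σ.degree = n →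
        RatAlong u a (newCoord g h (.u σ)) fun x => jetOf u' (imageBase g u x) (.u σ) := by
      intro n
      induction n with
      | zero =>
        intro σ hσ
        obtain rfl := Finsupp.degree_eq_zero_iff σ |>.1 hσ
        rw [newCoord_zero]
        refine (RatAlong.act_position hu dep).congr ?_
        filter_upwards [hg] with x hx
        rw [jetOf_zero, hx]
      | succ n ih =>
        intro σ hσ
        obtain ⟨i, hi⟩ : ∃ i, σ i ≠ 0 := by
          by_contra! h0
          have : σ = 0 := Finsupp.ext h0
          rw [this, map_zero] at hσ
          omega
        obtain ⟨τ, rfl⟩ : ∃ τ, σ = τ + Finsupp.single i 1 :=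
          ⟨σ - Finsupp.single i 1, (tsub_add_cancel_of_le (by
            rw [Finsupp.single_le_iff]; omega)).symm⟩
        have h1 := ih τ (by rw [map_add, Finsupp.degree_single] at hσ; omega)
        rw [newCoord_add hgh]
        refine (hder i h1).congr ?_
        filter_upwards [hXW i, hX.continuousAt.eventually (differentiableAt_jetOf hu' τ),
          ((hX.of_le (m := ((1 : ℕ) : ℕ∞ω)) (by exact_mod_cast le_top)).eventually
            (natCast_ne_infty 1))] with x h2 h3 h4
        have h5 := fderiv_comp x h3.1 (h4.differentiableAt (by simp))
        change _ = fderiv ℝ ((fun y => jetOf u' y (.u τ)) ∘ imageBase g u) x (W i x)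
        rw [h5, ContinuousLinearMap.comp_apply, h2, h3.2]
    exact key _ σ rfl

theorem MapsJet.hasValue (hgh : g * h = 1) {j j' : JetVar m → ℝ} (hj : MapsJet g j j')
    (t : JetVar m) : HasValue (newCoord g h t) j (j' t) := by
  obtain ⟨u, u', a, a', hu, hu', hj, hj', h1, h2⟩ := hj
  obtain rfl := (eq_imageBase h1).1
  rw [hj.eq_jetOf hu, hj'.eq_jetOf hu']
  refine (ratAlong_newCoord hgh hu hu' ?_ t).hasValue
  filter_upwards [h2] with x ⟨x', hx⟩
  obtain ⟨h3, h4⟩ := eq_imageBase hx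
  rw [← h4, h3]

/-- Transversality makes the change of independent variables a local diffeomorphism; composing with
its local inverse presents the image as a graph, and `h` maps it back. -/
theorem exists_mapsJet (hgh : g * h = 1) (hu : ContDiffAt ℝ ∞ u a)
    (hD : MvPolynomial.eval (jetOf u a) (denPoly h) ≠ 0) :
    ∃ j', MapsJet g (jetOf u a) j' ∧ MapsJet h j' (jetOf u a) := by
  have hX := contDiffAt_imageBase (g := g) hu
  let e : (Base m → ℝ) ≃L[ℝ] (Base m → ℝ) := (LinearEquiv.ofInjectiveEndo
    (fderiv ℝ (imageBase g u) a : (Base m → ℝ) →ₗ[ℝ] (Base m → ℝ))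
    (fderiv_imageBase_injective hgh hu hD)).toContinuousLinearEquiv
  have he : HasFDerivAt (imageBase g u) (e : (Base m → ℝ) →L[ℝ] (Base m → ℝ)) a := by
    have : (e : (Base m → ℝ) →L[ℝ] (Base m → ℝ)) = fderiv ℝ (imageBase g u) a := by
      ext1 y; rfl
    rw [this]
    exact (hX.differentiableAt (by simp)).hasFDerivAt
  have hn : (∞ : ℕ∞ω) ≠ 0 := by simp
  set φ := hX.localInverse he hn
  have hφ : ContDiffAt ℝ ∞ φ (imageBase g u a) := hX.to_localInverse he hn
  have hs : HasStrictFDerivAt (imageBase g u) (e : (Base m → ℝ) →L[ℝ] (Base m → ℝ)) a :=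
    hX.hasStrictFDerivAt' he hn
  have h1 : ∀ᶠ x in 𝓝 a, φ (imageBase g u x) = x := hs.eventually_left_inverse
  have h2 : ∀ᶠ x in 𝓝 (imageBase g u a), imageBase g u (φ x) = x := hs.eventually_right_inverse
  set u' : (Base m → ℝ) → ℝ := fun x => g.mulVec (pt (φ x) (u (φ x))) dep
  have hu' : ContDiffAt ℝ ∞ u' (imageBase g u a) := by
    have h3 : ContDiffAt ℝ ∞ (fun x => g.mulVec (pt x (u x)) dep) (φ (imageBase g u a)) := by
      rw [h1.self_of_nhds]
      exact contDiffAt_pi.1 (contDiffAt_image hu) dep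
    exact h3.comp _ hφ
  have h3 : ∀ᶠ x in 𝓝 a, g.mulVec (pt x (u x)) = pt (imageBase g u x) (u' (imageBase g u x)) := by
    filter_upwards [h1] with x hx
    simp only [u', hx, pt_imageBase]
  have h4 : ∀ᶠ x in 𝓝 (imageBase g u a), h.mulVec (pt x (u' x)) = pt (φ x) (u (φ x)) := by
    filter_upwards [h2] with x hx
    have : pt x (u' x) = g.mulVec (pt (φ x) (u (φ x))) := by
      conv_lhs => rw [← hx]
      simp only [u', hx]
      conv_rhs => rw [← pt_imageBase, hx]
    rw [this, Matrix.mulVec_mulVec, mul_eq_one_comm.1 hgh, Matrix.one_mulVec]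
  refine ⟨jetOf u' (imageBase g u a), ?_, ?_⟩
  · exact ⟨u, u', a, _, hu, hu', isJet_jetOf hu, isJet_jetOf hu', h3.self_of_nhds,
      h3.mono fun x hx => ⟨_, hx⟩⟩
  · refine ⟨u', u, _, a, hu', hu, isJet_jetOf hu', isJet_jetOf hu, ?_,
      h4.mono fun x hx => ⟨_, hx⟩⟩
    rw [h4.self_of_nhds, h1.self_of_nhds]

end images

/-! ### Polynomial functions with prescribed jets -/

section polynomialJets

variable {m : ℕ}

theorem fderiv_eval_sub (p : MvPolynomial (Base m) ℝ) (a x : Base m → ℝ) :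
    DifferentiableAt ℝ (fun y => MvPolynomial.eval (y - a) p) x ∧
      ∀ k, fderiv ℝ (fun y => MvPolynomial.eval (y - a) p) x (Pi.single k 1) =
        MvPolynomial.eval (x - a) (MvPolynomial.pderiv k p) := by
  classical
  induction p using MvPolynomial.induction_on with
  | C c => simp
  | add p q hp hq =>
    simp only [map_add]
    refine ⟨hp.1.add hq.1, fun k => ?_⟩
    rw [fderiv_fun_add hp.1 hq.1, add_apply, hp.2, hq.2]
  | mul_X p i hp =>
    have ht : HasFDerivAt (fun y : Base m → ℝ => (y - a) i)
        (ContinuousLinearMap.proj (R := ℝ) (φ := fun _ : Base m => ℝ) i) x :=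
      (hasFDerivAt_apply i x).sub_const (a i)
    simp only [map_mul, MvPolynomial.eval_X]
    refine ⟨hp.1.mul ht.differentiableAt, fun k => ?_⟩
    rw [fderiv_fun_mul hp.1 ht.differentiableAt, ht.fderiv, Derivation.leibniz,
      MvPolynomial.pderiv_X]
    simp only [add_apply, smul_apply, smul_eq_mul, hp.2, map_add, map_mul, MvPolynomial.eval_X,
      ContinuousLinearMap.proj_apply, Pi.single_apply, eq_comm (a := i),
      apply_ite (MvPolynomial.eval (x - a)), map_one, map_zero]

theorem iterPartial_eval_sub (l : List (Base m)) (p : MvPolynomial (Base m) ℝ) (a : Base m → ℝ) :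
    iterPartial l (fun y => MvPolynomial.eval (y - a) p) = fun x =>
      MvPolynomial.eval (x - a) (l.foldr (fun i q => MvPolynomial.pderiv i q) p) := by
  induction l with
  | nil => rfl
  | cons i l ih =>
    rw [iterPartial_cons, ih]
    funext x
    exact (fderiv_eval_sub _ a x).2 i

/-- Differentiation shifts coefficients up to nonzero factors. The Taylor coefficients at a point
can thus be prescribed without computing factorials. -/
theorem coeff_iterated_pderiv (l : List (Base m)) :
    ∃ c : (Base m →₀ ℕ) → ℝ, (∀ τ, c τ ≠ 0) ∧ ∀ (p : MvPolynomial (Base m) ℝ) τ,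
      MvPolynomial.coeff τ (l.foldr (fun i q => MvPolynomial.pderiv i q) p) =
        c τ * MvPolynomial.coeff (τ + Multiset.toFinsupp (l : Multiset (Base m))) p := by
  induction l with
  | nil => exact ⟨fun _ => 1, fun _ => one_ne_zero, fun p τ => by simp⟩
  | cons i l ih =>
    obtain ⟨c, hc, h⟩ := ih
    refine ⟨fun τ => (τ i + 1) * c (τ + Finsupp.single i 1),
      fun τ => mul_ne_zero (by positivity) (hc _), fun p τ => ?_⟩
    rw [List.foldr_cons, MvPolynomial.coeff_pderiv, h, ← Multiset.cons_coe,
      ← Multiset.singleton_add, map_add, Multiset.toFinsupp_singleton, add_assoc]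
    ring

/-- A polynomial on the jet space involves finitely many coordinates, and a polynomial function `u`
can realize their values at any point where `P` is nonzero. -/
theorem exists_smooth_jet {P : JetPoly m} (hP : P ≠ 0) :
    ∃ (u : (Base m → ℝ) → ℝ) (a : Base m → ℝ), ContDiffAt ℝ ∞ u a ∧
      MvPolynomial.eval (jetOf u a) P ≠ 0 := by
  classical
  obtain ⟨j, hj⟩ := exists_eval_ne_zero hP
  choose c hc hcoeff using fun l : List (Base m) => coeff_iterated_pderiv l
  let S : Finset (Base m →₀ ℕ) :=
    P.vars.biUnion fun t => match t with
      | .x _ => ∅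
      | .u σ => {σ}
  let list : (Base m →₀ ℕ) → List (Base m) := fun σ => (Finsupp.toMultiset σ).toList
  let p : MvPolynomial (Base m) ℝ :=
    ∑ σ ∈ S, MvPolynomial.monomial σ ((c (list σ) 0)⁻¹ * j (.u σ))
  let a : Base m → ℝ := fun i => j (.x i)
  refine ⟨fun y => MvPolynomial.eval (y - a) p, a, ?_, ?_⟩
  · have : ∀ q : MvPolynomial (Base m) ℝ,
        ContDiff ℝ ∞ fun y : Base m → ℝ => MvPolynomial.eval (y - a) q := by
      intro q
      induction q using MvPolynomial.induction_on with
      | C c => simpa using contDiff_const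
      | add p q hp hq => simpa using hp.add hq
      | mul_X p i hp =>
        simp only [map_mul, MvPolynomial.eval_X]
        exact hp.mul ((contDiff_apply ℝ ℝ i).sub contDiff_const)
    exact (this p).contDiffAt
  · have : MvPolynomial.eval (jetOf (fun y => MvPolynomial.eval (y - a) p) a) P =
        MvPolynomial.eval j P := by
      refine MvPolynomial.hom_congr_vars (by ext; simp) (fun t ht _ => ?_) rfl
      rw [MvPolynomial.eval_X, MvPolynomial.eval_X]
      cases t with
      | x i => rfl
      | u σ =>
        have hσ : σ ∈ S := Finset.mem_biUnion.2 ⟨_, ht, Finset.mem_singleton_self σ⟩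
        rw [jetOf, iterPartial_eval_sub]
        simp only [sub_self]
        have h0 : ∀ q : MvPolynomial (Base m) ℝ,
            MvPolynomial.eval (0 : Base m → ℝ) q = MvPolynomial.coeff 0 q := fun q => by
          rw [MvPolynomial.eval_zero, MvPolynomial.constantCoeff_eq]
        rw [h0, hcoeff, zero_add, Multiset.coe_toList, Finsupp.toMultiset_toFinsupp]
        simp only [p, MvPolynomial.coeff_sum, MvPolynomial.coeff_monomial]
        rw [Finset.sum_ite_eq' S σ, if_pos hσ, mul_inv_cancel_left₀ (hc _ _)]
    rwa [this]

end polynomialJets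

/-! ### The pull-back of rational functions -/

section pullback

variable {m : ℕ} {g h : Matrix (Idx m) (Idx m) ℝ}

theorem MapsJet.hasValue_newPoly (hgh : g * h = 1) {j j' : JetVar m → ℝ} (hj : MapsJet g j j')
    (p : JetPoly m) : HasValue (newPoly g h p) j (MvPolynomial.eval j' p) :=
  HasValue.aeval p fun t _ => hj.hasValue hgh t

/-- If `q` were in the kernel, a smooth jet with `q` and `denPoly g` nonzero would be the image
under `g` of some jet `j`. The value of the pull-back at `j` would be both zero and the nonzero
value of `q`. -/
theorem newPoly_injective (hgh : g * h = 1) : Function.Injective (newPoly g h) := by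
  refine (injective_iff_map_eq_zero _).2 fun q hq => ?_
  by_contra h0
  have hhg := mul_eq_one_comm.1 hgh
  obtain ⟨u, a, hu, hP⟩ := exists_smooth_jet (mul_ne_zero h0 (denPoly_ne_zero hhg))
  rw [map_mul] at hP
  obtain ⟨j, -, hj⟩ := exists_mapsJet hhg hu (right_ne_zero_of_mul hP)
  have h1 := hj.hasValue_newPoly hgh q
  rw [hq] at h1
  exact left_ne_zero_of_mul hP (h1.unique (HasValue.zero j))

/-- The pull-back of rational functions by the prolonged action. -/
def pullback (hgh : g * h = 1) : JetRat m →ₐ[ℝ] JetRat m :=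
  IsFractionRing.liftAlgHom (newPoly_injective hgh)

theorem pullback_toRat (hgh : g * h = 1) (p : JetPoly m) :
    pullback hgh (toRat p) = newPoly g h p :=
  IsFractionRing.lift_algebraMap (g := (newPoly g h).toRingHom) (newPoly_injective hgh) p

theorem pullback_gen (hgh : g * h = 1) (t : JetVar m) :
    pullback hgh (gen t) = newCoord g h t := by
  rw [← toRat_X, pullback_toRat, newPoly, MvPolynomial.aeval_X]

theorem newDer_pullback (hgh : g * h = 1) (i : Base m) (f : JetRat m) :
    newDer h i (pullback hgh f) = pullback hgh (totalDer i f) := by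
  obtain ⟨p, q, hq, hf⟩ := exists_num_denom f
  have hq0 : pullback hgh (toRat q) ≠ 0 := (map_ne_zero _).2 (toRat_ne_zero.2 hq)
  have h1 := congrArg (pullback hgh) hf
  have h2 := congrArg (pullback hgh) (congrArg (totalDer i) hf)
  rw [map_mul] at h1
  have h3 := congrArg (newDer h i) h1
  simp only [Derivation.leibniz, smul_eq_mul, map_add, map_mul, pullback_toRat, newDer_newPoly hgh,
    ← toRat_totalDerPoly] at h2 h3
  rw [pullback_toRat] at hq0
  rw [← h2] at h3
  exact mul_left_cancel₀ hq0 (add_left_cancel h3)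

theorem MapsJet.hasValue_pullback (hgh : g * h = 1) {j j' : JetVar m → ℝ} (hj : MapsJet g j j')
    {p q : JetPoly m} {f : JetRat m} (hf : f * toRat q = toRat p)
    (hq : MvPolynomial.eval j' q ≠ 0) :
    HasValue (pullback hgh f) j (MvPolynomial.eval j' p / MvPolynomial.eval j' q) := by
  have h1 := congrArg (pullback hgh) hf
  rw [map_mul, pullback_toRat, pullback_toRat] at h1
  have h2 : newPoly g h q ≠ 0 := by
    intro h0
    have h3 := hj.hasValue_newPoly hgh q
    rw [h0] at h3
    exact hq (h3.unique (HasValue.zero j))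
  rw [(eq_div_iff h2).2 h1]
  exact (hj.hasValue_newPoly hgh p).div (hj.hasValue_newPoly hgh q) hq

theorem exists_generic_poly {ι : Type*} (s : Finset ι) (f : ι → JetRat m) :
    ∃ r : JetPoly m, r ≠ 0 ∧ ∀ j, MvPolynomial.eval j r ≠ 0 →
      ∀ i ∈ s, ∃ c, HasValue (f i) j c ∧ (f i ≠ 0 → c ≠ 0) := by
  classical
  choose p q hq hf using fun i => exists_num_denom (f i)
  have hp : ∀ i, f i ≠ 0 → p i ≠ 0 := by
    intro i h0 h1
    exact mul_ne_zero h0 (toRat_ne_zero.2 (hq i)) ((hf i).trans (by rw [h1]; exact map_zero _))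
  refine ⟨∏ i ∈ s, q i * if f i = 0 then 1 else p i, Finset.prod_ne_zero_iff.2 fun i _ =>
    mul_ne_zero (hq i) ?_, fun j hj i hi => ?_⟩
  · split_ifs with h0
    · exact one_ne_zero
    · exact hp i h0
  · rw [map_prod] at hj
    have h1 := Finset.prod_ne_zero_iff.1 hj i hi
    rw [map_mul] at h1
    refine ⟨_, ⟨p i, q i, left_ne_zero_of_mul h1, hf i, rfl⟩, fun h0 => ?_⟩
    have h2 := right_ne_zero_of_mul h1
    rw [if_neg h0] at h2
    exact div_ne_zero h2 (left_ne_zero_of_mul h1)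

/-- The pointwise condition constrains a rational function only on jets that `g` maps somewhere and
where both functions have values. Such jets are sufficiently generic: a nonzero difference could be
evaluated at one of them. -/
theorem isPullback_iff (hgh : g * h = 1) (f f' : JetRat m) :
    IsPullback g f f' ↔ f' = pullback hgh f := by
  constructor
  · intro H
    by_contra h0
    obtain ⟨p, q, hq, hf⟩ := exists_num_denom f
    -- Including the pull-back of the denominator `q` ensures that `f` has a value at the image jet.
    obtain ⟨r, hr, hr'⟩ := exists_generic_poly Finset.univ
      ![f', f' - pullback hgh f, newPoly g h q]
    obtain ⟨u, a, hu, hP⟩ := exists_smooth_jet (mul_ne_zero hr (denPoly_ne_zero hgh))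
    rw [map_mul] at hP
    obtain ⟨j', hj, -⟩ := exists_mapsJet hgh hu (right_ne_zero_of_mul hP)
    have h1 := hr' _ (left_ne_zero_of_mul hP)
    obtain ⟨c, hc, -⟩ := h1 0 (Finset.mem_univ _)
    obtain ⟨d, hd, hd0⟩ := h1 1 (Finset.mem_univ _)
    obtain ⟨e, he, he0⟩ := h1 2 (Finset.mem_univ _)
    have hq' : MvPolynomial.eval j' q ≠ 0 := by
      rw [(hj.hasValue_newPoly hgh q).unique he]
      exact he0 ((map_ne_zero_iff _ (newPoly_injective hgh)).2 hq)
    have h2 := hj.hasValue_pullback hgh hf hq'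
    have h3 := H _ _ hj c _ hc ⟨p, q, hq', hf, rfl⟩
    have h4 : d = 0 := hd.unique (by simpa [h3] using hc.sub h2)
    exact hd0 (sub_ne_zero.2 h0) h4
  · rintro rfl j j' hj c c' hc ⟨p, q, hq, hf, rfl⟩
    exact hc.unique (hj.hasValue_pullback hgh hf hq)

end pullback

/-! ### Invariance of the canonical frame -/

section transport

variable {m : ℕ} {F F' : Type*} [Field F] [Field F']

theorem IsCanonicalFrame.transport {j : JetVar m → F} {v : Fin (2 * m + 1 + 1) → Idx m → F}
    (hv : IsCanonicalFrame j v) (f : F →+* F') {j' : JetVar m → F'}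
    {w : Fin (2 * m + 1 + 1) → Idx m → F'} (h0 : w 0 = position j')
    (hT : ∀ i, i ≠ 0 → dq j' (w i) = 0)
    (hω : ∀ i k, omega (w i) (w k) = f (omega (v i) (v k)))
    (hQ : ∀ i k, i ≠ 0 → k ≠ 0 → secondForm j' (w i) (w k) = f (secondForm j (v i) (v k))) :
    IsCanonicalFrame j' w := by
  have hne : ∀ i : Fin (2 * m + 1 + 1), 0 < i.val → i ≠ 0 := by
    rintro i hi rfl; exact lt_irrefl _ hi
  refine IsCanonicalFrame.of_relations h0 hT (fun i k hi hk => ?_) (fun i k hi hk => ?_)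
    (fun i k hi hk => ?_) (fun i k hi hk => ?_) (fun i k h0 hi hk => ?_) (fun i k hi hk => ?_)
  · rw [hω, hv.omega_odd i k hi hk, map_zero]
  · rw [hω, hv.omega_even i k hi hk, map_zero]
  · rw [hω, hv.omega_one i k hi hk, map_one]
  · rw [hQ i k (hne i hi.pos) (hne k (by omega)), hv.Q_odd i k hi hk, map_zero]
  · rw [hQ i k h0 (hne k (lt_of_le_of_lt (Nat.zero_le _) hk)), hv.Q_even i k h0 hi hk, map_zero]
  · rw [hQ i k (hne i hi.pos) (hne k (by omega)), hv.Q_one i k hi hk, map_one]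

theorem map_dq (f : F →+* F') (j : JetVar m → F) (y : Idx m → F) :
    dq (fun t => f (j t)) (fun a => f (y a)) = f (dq j y) := by
  simp [dq, -Fintype.sum_sum_type]

theorem map_omega (f : F →+* F') (y z : Idx m → F) :
    omega (fun a => f (y a)) (fun a => f (z a)) = f (omega y z) := by
  simp [omega]

theorem map_position (f : F →+* F') (j : JetVar m → F) :
    position (fun t => f (j t)) = fun a => f (position j a) := by
  funext a; rw [position, position, map_pt f]

theorem map_secondForm (f : F →+* F') (j : JetVar m → F) (y z : Idx m → F) :
    secondForm (fun t => f (j t)) (fun a => f (y a)) (fun a => f (z a)) =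
      f (secondForm j y z) := by
  rw [secondForm, secondForm, map_div₀, map_position, map_dq]
  simp [d2q, -Fintype.sum_sum_type]

theorem omega_eq_dotProduct (y z : Idx m → F) :
    omega y z = -(y ⬝ᵥ (Matrix.J (Fin (m + 1)) F).mulVec z) := by
  simp [omega, Matrix.J, dotProduct, Matrix.mulVec, Matrix.one_apply, Finset.sum_add_distrib,
    sub_eq_add_neg, add_comm]

theorem omega_mulVec {g : Matrix (Idx m) (Idx m) F}
    (hg : g ∈ Matrix.symplecticGroup (Fin (m + 1)) F) (y z : Idx m → F) :
    omega (g.mulVec y) (g.mulVec z) = omega y z := by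
  rw [omega_eq_dotProduct, omega_eq_dotProduct, Matrix.mulVec_mulVec, ← Matrix.vecMul_transpose,
    ← Matrix.dotProduct_mulVec, Matrix.mulVec_mulVec, ← Matrix.mul_assoc,
    SymplecticGroup.mem_iff'.1 hg]

theorem omega_act [Algebra ℝ F] {g : Matrix (Idx m) (Idx m) ℝ}
    (hg : g ∈ Matrix.symplecticGroup (Fin (m + 1)) ℝ) (y z : Idx m → F) :
    omega (act g y) (act g z) = omega y z := by
  have h : g.map (algebraMap ℝ F) ∈ Matrix.symplecticGroup (Fin (m + 1)) F :=
    SymplecticGroup.map_mem hg (algebraMap ℝ F)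
  exact omega_mulVec h y z

theorem exists_inverse {g : Matrix (Idx m) (Idx m) ℝ}
    (hg : g ∈ Matrix.symplecticGroup (Fin (m + 1)) ℝ) : ∃ h, g * h = 1 :=
  ⟨_, Matrix.mul_nonsing_inv g (SymplecticGroup.symplectic_det hg)⟩

end transport

/-! ### Equivariance of frame, invariants and derivations -/

section invariance

variable {m : ℕ} {g h : Matrix (Idx m) (Idx m) ℝ}

theorem horizontal_pullback (hgh : g * h = 1) {y : Idx m → JetRat m} (hy : dq gen y = 0)
    (f : JetRat m) :
    horizontal y (pullback hgh f) = ∑ i, act g y (emb i) * pullback hgh (totalDer i f) := by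
  rw [horizontal_eq_newDer hgh hy, derivation_sum_apply]
  simp only [Derivation.smul_apply, smul_eq_mul, newDer_pullback]

theorem pullback_position (hgh : g * h = 1) :
    position (fun t => pullback hgh (gen t)) = act g (position gen) := by
  refine idx_ext (fun i => ?_) ?_
  · simp [position, pullback_gen, newCoord]
  · rw [position, pt_dep, pullback_gen, newCoord_zero]

theorem pullback_slope (hgh : g * h = 1) (i : Base m) :
    pullback hgh (gen (.u (Finsupp.single i 1))) = newSlope h i := by
  rw [pullback_gen, ← zero_add (Finsupp.single i 1), newCoord_add hgh, newCoord_zero,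
    newDer_position hgh, pt_dep]

theorem pullback_dq (hgh : g * h = 1) {y : Idx m → JetRat m} (hy : dq gen y = 0) :
    dq (fun t => pullback hgh (gen t)) (act g y) = 0 := by
  rw [dq, act_tangent hgh hy, sub_eq_zero]
  simp only [pullback_slope]
  exact Finset.sum_congr rfl fun i _ => mul_comm _ _

/-- Differentiating `dq(z) = 0` along `y` expresses the second fundamental form through the
derivative of a tangent field. No coordinates of the hypersurface enter the right-hand side except
through `dq`. -/
theorem d2q_gen (y : Idx m → JetRat m) {z : Idx m → JetRat m} (hz : dq gen z = 0) :
    d2q gen y z = -dq gen (fun a => horizontal y (z a)) := by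
  have h1 := congrArg (horizontal y) hz
  rw [dq, map_sub, map_sum, map_zero] at h1
  simp only [Derivation.leibniz, smul_eq_mul, horizontal_apply y (gen _), totalDer_u,
    Finset.sum_add_distrib] at h1
  rw [eq_neg_iff_add_eq_zero, ← h1, dq, d2q, Finset.sum_comm, ← add_sub_assoc, add_comm]
  congr 2
  refine Finset.sum_congr rfl fun k _ => ?_
  rw [Finset.mul_sum]
  refine Finset.sum_congr rfl fun i _ => ?_
  rw [add_comm (Finsupp.single i 1)]; ring

theorem pullback_d2q (hgh : g * h = 1) {y z : Idx m → JetRat m} (hy : dq gen y = 0)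
    (hz : dq gen z = 0) :
    d2q (fun t => pullback hgh (gen t)) (act g y) (act g z) =
      -dq (fun t => pullback hgh (gen t)) (act g fun a => horizontal y (z a)) := by
  have h1 := congrArg (horizontal y) (pullback_dq hgh hz)
  rw [dq, map_sub, map_sum, map_zero] at h1
  simp only [Derivation.leibniz, smul_eq_mul, horizontal_pullback hgh hy, totalDer_u,
    Finset.sum_add_distrib, derivation_act] at h1
  rw [eq_neg_iff_add_eq_zero, ← h1, dq, d2q, Finset.sum_comm, ← add_sub_assoc, add_comm]
  congr 2
  refine Finset.sum_congr rfl fun k _ => ?_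
  rw [Finset.mul_sum]
  refine Finset.sum_congr rfl fun i _ => ?_
  rw [add_comm (Finsupp.single i 1)]; ring

/-- The transformed covector and the original one have the same kernel, hence are proportional; the
factor is found by evaluation at the position vector. -/
theorem pullback_dq_mul (hgh : g * h = 1) (y : Idx m → JetRat m) :
    dq (fun t => pullback hgh (gen t)) (act g y) * dq gen (position gen) =
      dq gen y * dq (fun t => pullback hgh (gen t)) (act g (position gen)) := by
  have h1 : dq gen (dq gen (position (gen (m := m))) • y - dq gen y • position (gen (m := m))) = 0 := by
    rw [← dqL_apply, map_sub, map_smul, map_smul]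
    simp only [dqL_apply, smul_eq_mul]; ring
  have h2 := pullback_dq hgh h1
  rw [sub_eq_add_neg, ← neg_smul, act_add, act_smul, act_smul, ← dqL_apply, map_add, map_smul,
    map_smul] at h2
  simp only [dqL_apply, smul_eq_mul] at h2
  linear_combination h2

/-- The proportionality factor of the covectors cancels because `Q` is normalized by `dq(v₀) = 1`.
-/
theorem pullback_secondForm (hgh : g * h = 1) (hlam : dq gen (position (gen (m := m))) ≠ 0)
    {y z : Idx m → JetRat m} (hy : dq gen y = 0) (hz : dq gen z = 0) :
    secondForm (fun t => pullback hgh (gen t)) (act g y) (act g z) = secondForm gen y z := by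
  have h1 := pullback_dq_mul hgh fun a => horizontal y (z a)
  have h2 : dq (fun t => pullback hgh (gen t)) (act g (position gen)) ≠ 0 := by
    rw [← pullback_position hgh]
    have := map_dq (pullback hgh).toRingHom gen (position (gen (m := m)))
    rw [← map_position] at this
    exact fun h0 => hlam ((map_eq_zero _).1 (this.symm.trans h0))
  rw [secondForm, secondForm, pullback_d2q hgh hy hz, d2q_gen y hz, pullback_position,
    div_eq_div_iff h2 hlam]
  linear_combination -h1

variable {v : Fin (2 * m + 1 + 1) → Idx m → JetRat m}

/-- For the pulled back jet there are two canonical frames: the relations can be pulled back, or the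
frame can be moved by the symplectic map `g`. Uniqueness identifies them. -/
theorem IsCanonicalFrame.pullback_eq (hv : IsCanonicalFrame gen v)
    (hg : g ∈ Matrix.symplecticGroup (Fin (m + 1)) ℝ) (hgh : g * h = 1)
    (i : Fin (2 * m + 1 + 1)) (a : Idx m) : pullback hgh (v i a) = act g (v i) a := by
  set j' : JetVar m → JetRat m := fun t => pullback hgh (gen t)
  have h1 : IsCanonicalFrame j' (fun i a => pullback hgh (v i a)) :=
    hv.transport (pullback hgh).toRingHom
      (by rw [hv.zero]; exact (map_position (pullback hgh).toRingHom gen).symm)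
      (fun i hi => (map_dq (pullback hgh).toRingHom gen (v i)).trans
        (by rw [hv.dq_eq_zero hi, map_zero]))
      (fun i k => map_omega (pullback hgh).toRingHom (v i) (v k))
      (fun i k _ _ => map_secondForm (pullback hgh).toRingHom gen (v i) (v k))
  have h2 : IsCanonicalFrame j' (fun i => act g (v i)) :=
    hv.transport (RingHom.id _) (by rw [hv.zero, pullback_position])
      (fun i hi => pullback_dq hgh (hv.dq_eq_zero hi))
      (fun i k => omega_act hg _ _)
      (fun i k hi hk => pullback_secondForm hgh hv.lam_ne_zero (hv.dq_eq_zero hi)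
        (hv.dq_eq_zero hk))
  have h3 : (hess j').det ≠ 0 := by
    have : hess j' = (pullback hgh).toRingHom.mapMatrix (hess gen) := rfl
    rw [this, ← RingHom.map_det]
    exact (map_ne_zero _).2 det_hess_gen_ne_zero
  exact congrFun (congrFun (h2.unique h1 h3) i) a

theorem isInvariant_iff {f : JetRat m} : IsInvariant f ↔
    ∀ g ∈ Matrix.symplecticGroup (Fin (m + 1)) ℝ, ∀ h, ∀ hgh : g * h = 1, pullback hgh f = f := by
  constructor
  · intro H g hg h hgh
    exact ((isPullback_iff hgh f f).1 (H g hg)).symm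
  · intro H g hg
    obtain ⟨h, hgh⟩ := exists_inverse hg
    exact (isPullback_iff hgh f f).2 (H g hg h hgh).symm

theorem IsCanonicalFrame.isInvariant_gramDiag (hv : IsCanonicalFrame gen v)
    (i : Fin (2 * m + 1)) : IsInvariant (gramDiag gen v i) := by
  refine isInvariant_iff.2 fun g hg h hgh => ?_
  have h1 := map_secondForm (pullback hgh).toRingHom gen (v i.succ) (v i.succ)
  have h2 : (fun a => (pullback hgh).toRingHom (v i.succ a)) = act g (v i.succ) :=
    funext fun a => hv.pullback_eq hg hgh _ a
  have hT := hv.dq_eq_zero (Fin.succ_ne_zero i)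
  rw [h2] at h1
  exact h1.symm.trans (pullback_secondForm hgh hv.lam_ne_zero hT hT)

theorem IsCanonicalFrame.pullback_nabla (hv : IsCanonicalFrame gen v)
    (hg : g ∈ Matrix.symplecticGroup (Fin (m + 1)) ℝ) (hgh : g * h = 1) {k : Fin (2 * m + 1 + 1)}
    (hk : k ≠ 0) (f : JetRat m) :
    pullback hgh (horizontal (v k) f) = horizontal (v k) (pullback hgh f) := by
  rw [horizontal_pullback hgh (hv.dq_eq_zero hk), horizontal_apply, map_sum]
  simp only [map_mul, hv.pullback_eq hg hgh]

theorem IsCanonicalFrame.isInvariantDer (hv : IsCanonicalFrame gen v) {k : Fin (2 * m + 1 + 1)}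
    (hk : k ≠ 0) : IsInvariantDer (horizontal (v k)) := by
  intro g hg f f' hf
  obtain ⟨h, hgh⟩ := exists_inverse hg
  rw [isPullback_iff hgh] at hf ⊢
  rw [hf, hv.pullback_nabla hg hgh hk]

theorem IsCanonicalFrame.linearIndependent_nabla (hv : IsCanonicalFrame gen v) :
    LinearIndependent (JetRat m) fun k : Fin (2 * m + 1) => horizontal (v k.succ) := by
  rw [Fintype.linearIndependent_iff]
  intro c hc
  rw [← horizontal_sum] at hc
  set y := ∑ k : Fin (2 * m + 1), c k • v k.succ
  have hy : dq gen y = 0 := by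
    rw [← dqL_apply, map_sum]
    simp [dqL_apply, hv.dq_eq_zero]
  have h1 : y = 0 := by
    funext a
    rw [← horizontal_position hy, hc]; rfl
  exact Fintype.linearIndependent_iff.1
    (hv.isDarboux.linearIndependent.comp Fin.succ (Fin.succ_injective _)) c h1

end invariance

/-! ### Structure equations of the canonical frame -/

section structureEquations

variable {m : ℕ} {g h : Matrix (Idx m) (Idx m) ℝ}

theorem derivation_omega (d : Derivation ℝ (JetRat m) (JetRat m)) (y z : Idx m → JetRat m) :
    d (omega y z) = omega (fun a => d (y a)) z + omega y (fun a => d (z a)) := by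
  simp only [omega, map_sum, map_sub, Derivation.leibniz, smul_eq_mul, ← Finset.sum_add_distrib]
  exact Finset.sum_congr rfl fun i _ => by ring

variable (v : Fin (2 * m + 1 + 1) → Idx m → JetRat m)

/-- The derivative of the frame vector `v_b` along `v_{i+1}`. -/
def frameDeriv (i : Fin (2 * m + 1)) (b : Fin (2 * m + 1 + 1)) : Idx m → JetRat m :=
  fun a => horizontal (v i.succ) (v b a)

/-- The connection forms of the frame, with one index lowered by `ω`. -/
def connForm (i : Fin (2 * m + 1)) (b a : Fin (2 * m + 1 + 1)) : JetRat m :=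
  omega (frameDeriv v i b) (v a)

/-- The tangential connection coefficients of the frame. -/
def christoffel (i b k : Fin (2 * m + 1)) : JetRat m := coord v k.succ (frameDeriv v i b.succ)

/-- The structure coefficients of the frame. -/
def structureCoeff (p : Fin (2 * m + 1) × Fin (2 * m + 1) × Fin (2 * m + 1)) : JetRat m :=
  christoffel v p.1 p.2.1 p.2.2 - christoffel v p.2.1 p.1 p.2.2

/-- The Gram matrix of the second fundamental form. -/
def gram (a k : Fin (2 * m + 1)) : JetRat m := secondForm gen (v a.succ) (v k.succ)

/-- The connection coefficients with the upper index lowered by `Q`. -/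
def lowered (i b a : Fin (2 * m + 1)) : JetRat m := ∑ k, gram v a k * christoffel v i b k

variable {v}

theorem partner_zero : (partner 0 : Fin (2 * m + 1 + 1)) = 1 := Fin.ext (by simp [partner])

theorem partner_one : (partner 1 : Fin (2 * m + 1 + 1)) = 0 := by
  rw [← partner_zero, partner_partner]

theorem lowered_comm (i b a : Fin (2 * m + 1)) :
    lowered v i b a - lowered v b i a = ∑ k, gram v a k * structureCoeff v (i, b, k) := by
  rw [lowered, lowered, ← Finset.sum_sub_distrib]
  exact Finset.sum_congr rfl fun k _ => by rw [structureCoeff]; ring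

namespace IsCanonicalFrame

variable (hv : IsCanonicalFrame gen v)
include hv

theorem gram_eq (a k : Fin (2 * m + 1)) : gram v a k = blockGram (gramDiag gen v) a k :=
  congrFun (congrFun hv.hasNormalForm.2 a) k

/-- The pairings `ω(v_b, v_a)` are constants, so their derivatives vanish. -/
theorem connForm_comm (i : Fin (2 * m + 1)) (b a : Fin (2 * m + 1 + 1)) :
    connForm v i b a = connForm v i a b := by
  have h1 : horizontal (v i.succ) (omega (v b) (v a)) = 0 := by
    rw [hv.isDarboux b a, sgn]; split_ifs <;> simp
  rw [derivation_omega, add_eq_zero_iff_eq_neg, ← omega_skew] at h1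
  exact h1

theorem frameDeriv_zero (i : Fin (2 * m + 1)) : frameDeriv v i 0 = v i.succ := by
  funext a
  rw [frameDeriv, hv.zero, horizontal_position (hv.dq_eq_zero (Fin.succ_ne_zero i))]

theorem connForm_zero (i : Fin (2 * m + 1)) (b : Fin (2 * m + 1 + 1)) :
    connForm v i b 0 = omega (v i.succ) (v b) := by
  rw [hv.connForm_comm, connForm, hv.frameDeriv_zero]

/-- Both sides are the component of the derivative transversal to the hypersurface, since `ω(·, v₁)`
is the normalized `dq`. -/
theorem connForm_one (i b : Fin (2 * m + 1)) : connForm v i b.succ 1 = -gram v i b := by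
  have h1 := d2q_gen (v i.succ) (hv.dq_eq_zero (Fin.succ_ne_zero b))
  have h2 := hv.dq_eq (frameDeriv v i b.succ)
  rw [gram, secondForm, h1, connForm, neg_div, neg_neg, eq_div_iff hv.lam_ne_zero, ← h2]
  rfl

theorem dq_frameDeriv_sub (i k : Fin (2 * m + 1)) :
    dq gen (frameDeriv v i k.succ - frameDeriv v k i.succ) = 0 := by
  have h1 := d2q_gen (v i.succ) (hv.dq_eq_zero (Fin.succ_ne_zero k))
  have h2 := d2q_gen (v k.succ) (hv.dq_eq_zero (Fin.succ_ne_zero i))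
  rw [d2q_symm, h1, neg_inj] at h2
  rw [← dqL_apply, map_sub, sub_eq_zero]
  exact h2

theorem expand_tangent {y : Idx m → JetRat m} (hy : dq gen y = 0) :
    y = ∑ l : Fin (2 * m + 1), coord v l.succ y • v l.succ := by
  have h1 := dq_eq_coord hv.isDarboux hv.zero (fun _ => hv.dq_eq_zero) y
  rw [hy, zero_eq_mul, or_iff_left hv.lam_ne_zero] at h1
  conv_lhs => rw [← hv.isDarboux.expand y, Fin.sum_univ_succ, h1, zero_smul, zero_add]

theorem frameDeriv_sub (i k : Fin (2 * m + 1)) :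
    frameDeriv v i k.succ - frameDeriv v k i.succ =
      ∑ l, structureCoeff v (i, k, l) • v l.succ := by
  conv_lhs => rw [hv.expand_tangent (hv.dq_frameDeriv_sub i k)]
  simp only [coord_sub]
  rfl

theorem bracket_nabla (i k : Fin (2 * m + 1)) :
    ⁅horizontal (v i.succ), horizontal (v k.succ)⁆ =
      ∑ l, structureCoeff v (i, k, l) • horizontal (v l.succ) := by
  rw [bracket_horizontal, ← horizontal_sum, ← hv.frameDeriv_sub]
  rfl

theorem connForm_sub (i b : Fin (2 * m + 1)) (a : Fin (2 * m + 1 + 1)) :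
    connForm v i b.succ a - connForm v b i.succ a =
      ∑ l, structureCoeff v (i, b, l) * omega (v l.succ) (v a) := by
  rw [connForm, connForm, ← omegaB_apply, ← omegaB_apply, ← LinearMap.sub_apply, ← map_sub,
    hv.frameDeriv_sub, map_sum, LinearMap.sum_apply]
  simp only [map_smul, LinearMap.smul_apply, smul_eq_mul, omegaB_apply]

/-- In the expansion of `∇_b v_a`, the transversal term drops out because `ω(v_i, v₁) = 0` for
tangent `v_i`; the others are lowered by `Q` because `ω(v_k, ∇_i v₁) = Q(v_i, v_k)`. -/
theorem omega_frameDeriv (b a i : Fin (2 * m + 1)) :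
    omega (frameDeriv v b a.succ) (frameDeriv v i 1) = lowered v b a i := by
  have h0 : connForm v i 1 0 = 0 := by
    rw [hv.connForm_zero, hv.isDarboux, if_neg]
    intro h1
    have h2 := congrArg partner h1
    rw [partner_one, partner_partner] at h2
    exact Fin.succ_ne_zero i h2.symm
  rw [omega_skew]
  conv_lhs => rw [← hv.isDarboux.expand (frameDeriv v b a.succ)]
  rw [← omegaB_apply, map_sum, Fin.sum_univ_succ, lowered, neg_add]
  simp only [map_smul, omegaB_apply, smul_eq_mul]
  have h1 : ∀ k, omega (frameDeriv v i 1) (v k) = connForm v i 1 k := fun _ => rfl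
  rw [h1, h0, mul_zero, neg_zero, zero_add, ← Finset.sum_neg_distrib]
  refine Finset.sum_congr rfl fun k _ => ?_
  rw [h1, hv.connForm_comm, hv.connForm_one, christoffel]; ring

/-- The Codazzi equation: `Q(v_b, v_a) = -ω(∇_b v_a, v₁)` is differentiated along `v_i` and
skew-symmetrized in `i` and `b`; the second derivatives of `v_a` combine to the bracket. -/
theorem lowered_sub (a b i : Fin (2 * m + 1)) :
    lowered v b a i - lowered v i a b =
      -horizontal (v i.succ) (gram v b a) + horizontal (v b.succ) (gram v i a) +
        ∑ l, structureCoeff v (i, b, l) * gram v l a := by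
  have key : ∀ i b : Fin (2 * m + 1), horizontal (v i.succ) (gram v b a) =
      -omega (fun x => horizontal (v i.succ) (horizontal (v b.succ) (v a.succ x))) (v 1) -
        lowered v b a i := by
    intro i b
    rw [← neg_neg (gram v b a), ← hv.connForm_one, map_neg, connForm, derivation_omega, neg_add]
    rw [← hv.omega_frameDeriv]
    rfl
  have h1 : (fun x => horizontal (v i.succ) (horizontal (v b.succ) (v a.succ x))) -
      (fun x => horizontal (v b.succ) (horizontal (v i.succ) (v a.succ x))) =
        ∑ l, structureCoeff v (i, b, l) • frameDeriv v l a.succ := by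
    funext x
    have h2 := congrArg (fun d => d (v a.succ x)) (hv.bracket_nabla i b)
    simp only [Derivation.commutator_apply, derivation_sum_apply] at h2
    rw [Pi.sub_apply, h2, Finset.sum_apply]
    rfl
  have h2 := congrArg (fun y => omega y (v 1)) h1
  simp only [← omegaB_apply] at h2
  rw [map_sub, map_sum, LinearMap.sub_apply, LinearMap.sum_apply] at h2
  simp only [map_smul, LinearMap.smul_apply, smul_eq_mul, omegaB_apply] at h2
  have h3 : ∀ l, omega (frameDeriv v l a.succ) (v 1) = -gram v l a := fun l => hv.connForm_one l a
  simp only [h3, mul_neg, Finset.sum_neg_distrib] at h2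
  rw [key i b, key b i]
  linear_combination -h2

theorem pullback_structureCoeff (hg : g ∈ Matrix.symplecticGroup (Fin (m + 1)) ℝ)
    (hgh : g * h = 1) (p : Fin (2 * m + 1) × Fin (2 * m + 1) × Fin (2 * m + 1)) :
    pullback hgh (structureCoeff v p) = structureCoeff v p := by
  have key : ∀ i b k, pullback hgh (christoffel v i b k) = christoffel v i b k := by
    intro i b k
    have h1 : pullback hgh (sgn (JetRat m) k.succ) = sgn (JetRat m) k.succ := by
      rw [sgn]; split_ifs <;> simp
    have h2 := map_omega (pullback hgh).toRingHom (frameDeriv v i b.succ) (v (partner k.succ))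
    rw [christoffel, coord, map_mul, h1]
    congr 1
    refine h2.symm.trans ?_
    rw [← omega_act hg (frameDeriv v i b.succ) (v (partner k.succ))]
    congr 1
    · funext a
      refine (hv.pullback_nabla hg hgh (Fin.succ_ne_zero i) _).trans ?_
      rw [hv.pullback_eq hg hgh, derivation_act]
      rfl
    · exact funext fun a => hv.pullback_eq hg hgh _ a
  rw [structureCoeff, map_sub, key, key]

theorem isInvariant_structureCoeff
    (p : Fin (2 * m + 1) × Fin (2 * m + 1) × Fin (2 * m + 1)) :
    IsInvariant (structureCoeff v p) :=
  isInvariant_iff.2 fun _ hg _ hgh => hv.pullback_structureCoeff hg hgh p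

theorem det_gram_ne_zero : (Matrix.of (gram v)).det ≠ 0 := by
  intro h0
  obtain ⟨θ, hθ, h1⟩ := Matrix.exists_mulVec_eq_zero_iff.2 h0
  apply hθ
  set y := ∑ k : Fin (2 * m + 1), θ k • v k.succ
  have hy : dq gen y = 0 := by
    rw [← dqL_apply, map_sum]
    simp [dqL_apply, hv.dq_eq_zero]
  have h2 : y = 0 := by
    refine hv.eq_zero_of_secondForm det_hess_gen_ne_zero hy fun b hb => ?_
    obtain ⟨b, rfl⟩ := Fin.exists_succ_eq.2 hb
    rw [← secB_apply, map_sum, ← Pi.zero_apply (M := fun _ => JetRat m) b, ← h1]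
    refine Finset.sum_congr rfl fun k _ => ?_
    rw [map_smul, smul_eq_mul, mul_comm]
    rfl
  exact funext (Fintype.linearIndependent_iff.1
    (hv.isDarboux.linearIndependent.comp Fin.succ (Fin.succ_injective _)) θ h2)

end IsCanonicalFrame

end structureEquations

/-! ### Reconstruction of the connection from the invariants -/

section linearAlgebra

variable {K : Type*} [Field K] [Algebra ℝ K]

/-- The inverse matrix has entries in the field `E`, so a linear system over `E` with right-hand
side in `S` is solvable in `S`. -/
theorem mem_of_mulVec_mem {ι : Type*} [Fintype ι] [DecidableEq ι] {E : IntermediateField ℝ K}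
    {S : Subalgebra ℝ K} (hES : ∀ x ∈ E, x ∈ S) {M : Matrix ι ι K} (hM : ∀ i k, M i k ∈ E)
    (hdet : M.det ≠ 0) {θ : ι → K} (hθ : ∀ i, M.mulVec θ i ∈ S) (i : ι) : θ i ∈ S := by
  let M' : Matrix ι ι E := Matrix.of fun i k => ⟨M i k, hM i k⟩
  have hM' : (algebraMap E K).mapMatrix M' = M := rfl
  have hdet' : IsUnit M'.det := by
    refine isUnit_iff_ne_zero.2 fun h0 => hdet ?_
    rw [← hM', ← RingHom.map_det, h0, map_zero]
  have h1 : (algebraMap E K).mapMatrix M'⁻¹ * M = 1 := by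
    rw [← hM', ← map_mul, Matrix.nonsing_inv_mul _ hdet', map_one]
  have h2 : θ = ((algebraMap E K).mapMatrix M'⁻¹).mulVec (M.mulVec θ) := by
    rw [Matrix.mulVec_mulVec, h1, Matrix.one_mulVec]
  rw [h2]
  exact sum_mem fun k _ => mul_mem (hES _ (M'⁻¹ i k).2) (hθ k)

end linearAlgebra

/-! ### Connection coefficients as polynomials in derivatives of the generators -/

section reconstruction

variable {m : ℕ} {v : Fin (2 * m + 1 + 1) → Idx m → JetRat m} {S : Subalgebra ℝ (JetRat m)}

namespace IsCanonicalFrame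

variable (hv : IsCanonicalFrame gen v)
  (hI : ∀ f ∈ IntermediateField.adjoin ℝ (Set.range (gramDiag gen v)), f ∈ S)
  (hc : ∀ p, structureCoeff v p ∈ S)
  (hD : ∀ k : Fin (2 * m + 1), ∀ f ∈ S, horizontal (v k.succ) f ∈ S)

include hv in
theorem gram_mem_adjoin (a k : Fin (2 * m + 1)) :
    gram v a k ∈ IntermediateField.adjoin ℝ (Set.range (gramDiag gen v)) := by
  rw [hv.gram_eq, blockGram]
  split_ifs
  · exact IntermediateField.subset_adjoin _ _ ⟨_, rfl⟩
  · exact one_mem _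
  · exact zero_mem _

include hv in
theorem omega_mem (S : Subalgebra ℝ (JetRat m)) (i k : Fin (2 * m + 1 + 1)) :
    omega (v i) (v k) ∈ S := by
  rw [hv.isDarboux, sgn]
  split_ifs
  · exact one_mem _
  · exact neg_mem (one_mem _)
  · exact zero_mem _

theorem sgn_mem (S : Subalgebra ℝ (JetRat m)) (k : Fin (2 * m + 1 + 1)) :
    sgn (JetRat m) k ∈ S := by
  rw [sgn]
  split_ifs
  · exact one_mem _
  · exact neg_mem (one_mem _)

theorem christoffel_mem_of_connForm {i b k : Fin (2 * m + 1)}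
    (h : connForm v i b.succ (partner k.succ) ∈ S) : christoffel v i b k ∈ S :=
  mul_mem (sgn_mem S _) h

theorem connForm_mem_of_christoffel {i b k : Fin (2 * m + 1)}
    (h : christoffel v i b k ∈ S) : connForm v i b.succ (partner k.succ) ∈ S := by
  have h1 : connForm v i b.succ (partner k.succ) = sgn (JetRat m) k.succ * christoffel v i b k := by
    rw [christoffel, coord, ← mul_assoc, sgn_mul_self, one_mul, connForm]
  rw [h1]
  exact mul_mem (sgn_mem S _) h

include hv hI in
theorem connForm_one_mem (i b : Fin (2 * m + 1)) : connForm v i b.succ 1 ∈ S := by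
  rw [hv.connForm_one]
  exact neg_mem (hI _ (hv.gram_mem_adjoin i b))

include hv hc in
-- Modulo `S` the connection form is totally symmetric: exactly in the last two indices, and up to
-- torsion terms in the first two.
theorem connForm_rotate (i b a : Fin (2 * m + 1)) :
    connForm v a i.succ b.succ ∈ S ↔ connForm v i b.succ a.succ ∈ S := by
  rw [hv.connForm_comm i]
  have h1 : connForm v a i.succ b.succ - connForm v i a.succ b.succ ∈ S := by
    rw [hv.connForm_sub]
    exact sum_mem fun l _ => mul_mem (hc _) (hv.omega_mem S _ _)
  constructor
  · intro h2; simpa using sub_mem h2 h1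
  · intro h2; simpa using add_mem h1 h2

include hv hI hc hD in
-- The Codazzi equation and the torsion identity each permute indices up to elements of `S`;
-- together they yield the rotation.
theorem lowered_rotate (i b a : Fin (2 * m + 1)) :
    lowered v a i b ∈ S ↔ lowered v i b a ∈ S := by
  have hG : ∀ a k, gram v a k ∈ S := fun a k => hI _ (hv.gram_mem_adjoin a k)
  have h1 : lowered v a i b - lowered v b i a ∈ S := by
    rw [hv.lowered_sub]
    exact add_mem (add_mem (neg_mem (hD _ _ (hG _ _))) (hD _ _ (hG _ _)))
      (sum_mem fun l _ => mul_mem (hc _) (hG _ _))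
  have h2 : lowered v b i a - lowered v i b a ∈ S := by
    rw [lowered_comm]
    exact sum_mem fun k _ => mul_mem (hG _ _) (hc _)
  have h3 := add_mem h1 h2
  rw [sub_add_sub_cancel] at h3
  constructor
  · intro h4; simpa using sub_mem h4 h3
  · intro h4; simpa using add_mem h3 h4

include hv hI in
theorem lowered_mem_of_christoffel {i b : Fin (2 * m + 1)} (h : ∀ k, christoffel v i b k ∈ S)
    (a : Fin (2 * m + 1)) : lowered v i b a ∈ S :=
  sum_mem fun k _ => mul_mem (hI _ (hv.gram_mem_adjoin a k)) (h k)

include hv hI in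
theorem christoffel_mem_of_lowered {i b : Fin (2 * m + 1)} (h : ∀ a, lowered v i b a ∈ S)
    (k : Fin (2 * m + 1)) : christoffel v i b k ∈ S :=
  mem_of_mulVec_mem (M := Matrix.of (gram v)) hI hv.gram_mem_adjoin hv.det_gram_ne_zero h k

include hv hI in
theorem connForm_mem_of_forall {i b : Fin (2 * m + 1)} (h : ∀ k, christoffel v i b k ∈ S)
    (a : Fin (2 * m + 1 + 1)) : connForm v i b.succ a ∈ S := by
  by_cases ha : partner a = 0
  · have : a = 1 := by rw [← partner_partner a, ha, partner_zero]
    rw [this]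
    exact hv.connForm_one_mem hI i b
  · obtain ⟨k, hk⟩ := Fin.exists_succ_eq.2 ha
    have := connForm_mem_of_christoffel (h k)
    rwa [hk, partner_partner] at this

include hv in
theorem christoffel_mem_of_forall {i b : Fin (2 * m + 1)}
    (h0 : ∀ a : Fin (2 * m + 1), connForm v i b.succ a.succ ∈ S) (k : Fin (2 * m + 1)) :
    christoffel v i b k ∈ S := by
  refine christoffel_mem_of_connForm ?_
  by_cases ha : partner k.succ = 0
  · rw [ha, hv.connForm_zero]
    exact hv.omega_mem S _ _
  · obtain ⟨a, ha⟩ := Fin.exists_succ_eq.2 ha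
    rw [← ha]
    exact h0 a

include hv hI hc hD in
theorem christoffel_mem (i b k : Fin (2 * m + 1)) : christoffel v i b k ∈ S := by
  -- Induction on the upper index. Index `k` in the code stands for `v_{k+1}`; coefficients with a
  -- smaller upper index are known for all lower indices.
  have key : ∀ n : ℕ, ∀ k : Fin (2 * m + 1), k.val = n → ∀ i b, christoffel v i b k ∈ S := by
    intro n
    induction n using Nat.strong_induction_on with
    | _ n ih =>
      intro k hk
      have ih' : ∀ l < k, ∀ i b, christoffel v i b l ∈ S := fun l hl => ih l (by omega) l rfl
      clear ih
      have hG : ∀ a k, gram v a k ∈ S := fun a k => hI _ (hv.gram_mem_adjoin a k)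
      rcases Nat.even_or_odd k.val with hk2 | hk2
      -- For even `k` the coefficient is, up to sign, `ω(∇_i v_b, v_k)`. With `a = k - 1`, row `a`
      -- of the Gram matrix meets only the columns `a - 1` and `a`, so lowering to `a` uses known
      -- coefficients. Rotation by `Q` then gives everything differentiated in direction `a`, and
      -- rotation by `ω` the desired pairing.
      · have h1 : (partner k.succ).val + 1 = k.val + 1 :=
          partner_of_odd (by rw [Fin.val_succ]; exact hk2.add_one)
        intro i b
        refine christoffel_mem_of_connForm ?_
        by_cases h0 : partner k.succ = 0
        · rw [h0, hv.connForm_zero]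
          exact hv.omega_mem S _ _
        · obtain ⟨a, ha⟩ := Fin.exists_succ_eq.2 h0
          rw [← ha] at h1 ⊢
          rw [Fin.val_succ] at h1
          have h2 : ∀ i b, lowered v i b a ∈ S := by
            intro i b
            refine sum_mem fun l _ => ?_
            by_cases hl : l < k
            · exact mul_mem (hG _ _) (ih' l hl i b)
            · rw [hv.gram_eq, blockGram, if_neg (by rintro rfl; exact hl (by omega)), if_neg,
                zero_mul]
              · exact zero_mem _
              · rintro (⟨h3, h4⟩ | ⟨h3, h4⟩)
                · rw [show k.val = a.val + 1 by omega] at hk2; exact (Nat.not_even_iff_odd.2 h3.add_one) hk2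
                · omega
          rw [← hv.connForm_rotate hc]
          exact hv.connForm_mem_of_forall hI (hv.christoffel_mem_of_lowered hI fun c =>
            (hv.lowered_rotate hI hc hD i c a).2 (h2 i c)) b.succ
      -- For odd `k` the roles are exchanged. With `a = k - 1`, the `ω`-pairing with `v_{a+1}` is
      -- either given by `Q` or a coefficient with upper index `k - 2`; rotating by `ω` and then by
      -- `Q` puts the lowered coefficient with index `a` in `S`. Row `a` has entry one in column `k`
      -- and otherwise only known terms.
      · obtain ⟨a, ha⟩ : ∃ a : Fin (2 * m + 1), a.val + 1 = k.val :=
          ⟨⟨k.val - 1, by omega⟩, by have := hk2.pos; simp only; omega⟩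
        have hae : Even a.val := by
          rw [← ha] at hk2; exact Nat.not_odd_iff_even.1 fun h => (Nat.not_even_iff_odd.2 hk2) h.add_one
        have h1 : (partner a.succ).val + 1 = a.val + 1 :=
          partner_of_odd (by rw [Fin.val_succ]; exact hae.add_one)
        have h2 : ∀ i b : Fin (2 * m + 1), connForm v i b.succ a.succ ∈ S := by
          intro i b
          by_cases h0 : partner a.succ = 0
          · have : a.succ = 1 := by rw [← partner_partner a.succ, h0, partner_zero]
            rw [this]
            exact hv.connForm_one_mem hI i b
          · obtain ⟨l, hl⟩ := Fin.exists_succ_eq.2 h0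
            have h3 : l.val < k.val := by rw [← hl, Fin.val_succ] at h1; omega
            have := connForm_mem_of_christoffel (ih' l h3 i b)
            rwa [hl, partner_partner] at this
        intro i b
        have h3 : lowered v i b a ∈ S := by
          refine (hv.lowered_rotate hI hc hD i b a).1 ?_
          exact hv.lowered_mem_of_christoffel hI (hv.christoffel_mem_of_forall fun c =>
            (hv.connForm_rotate hc i c a).2 (h2 i c)) b
        rw [lowered, ← Finset.add_sum_erase _ _ (Finset.mem_univ k), hv.gram_eq, blockGram,
          if_neg (by rintro rfl; omega), if_pos (Or.inl ⟨hae, ha.symm⟩), one_mul] at h3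
        refine (add_mem_cancel_right (sum_mem fun l hl => ?_)).1 h3
        by_cases hl' : l < k
        · exact mul_mem (hG _ _) (ih' l hl' i b)
        · rw [hv.gram_eq, blockGram, if_neg (by rintro rfl; exact hl' (by omega)), if_neg,
            zero_mul]
          · exact zero_mem _
          · rintro (⟨h4, h5⟩ | ⟨h4, h5⟩)
            · exact Finset.ne_of_mem_erase hl (Fin.ext (by omega))
            · omega
  exact key _ k rfl i b

include hv hI hc hD in
theorem coord_frameDeriv_mem (i : Fin (2 * m + 1)) (b k : Fin (2 * m + 1 + 1)) :
    coord v k (frameDeriv v i b) ∈ S := by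
  refine mul_mem (sgn_mem S k) ?_
  induction b using Fin.cases with
  | zero =>
    rw [hv.frameDeriv_zero]
    exact hv.omega_mem S _ _
  | succ b => exact hv.connForm_mem_of_forall hI (hv.christoffel_mem hI hc hD i b) _

end IsCanonicalFrame

end reconstruction

/-! ### Independence of the differentials of the invariants -/

section characteristicPolynomial

open Polynomial

variable {K : Type*} [Field K] [Algebra ℝ K]

theorem derivation_prod_eq_zero {ι A : Type*} [CommRing A] [Algebra ℝ A] (D : Derivation ℝ A A) (s : Finset ι)
    {f : ι → A} (hf : ∀ i, D (f i) = 0) : D (∏ i ∈ s, f i) = 0 := by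
  induction s using Finset.cons_induction with
  | empty => simp
  | cons i s hi ih => rw [Finset.prod_cons, Derivation.leibniz, ih, hf]; simp

/-- The extension of a derivation to polynomials that maps the variable to `1`. -/
def polyDer (δ : Derivation ℝ K K) : Derivation ℝ K[X] K[X] :=
  (PolynomialModule.equivPolynomialSelf (R := K)).toLinearMap.compDer δ.mapCoeffs +
    derivative'.restrictScalars ℝ

theorem coeff_polyDer (δ : Derivation ℝ K K) (p : K[X]) (n : ℕ) :
    (polyDer δ p).coeff n = δ (p.coeff n) + p.coeff (n + 1) * (n + 1) := by
  have : (polyDer δ p).coeff n = (δ.mapCoeffs p).coeff n + (derivative p).coeff n := rfl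
  rw [this, coeff_derivative, Derivation.mapCoeffs_apply]

/-- A matrix is invertible if some derivation maps it to the identity matrix. -/
theorem det_ne_zero_of_derivation {ι : Type*} [CharZero K] [Fintype ι] [DecidableEq ι]
    (δ : Derivation ℝ K K) {W : Matrix ι ι K}
    (hW : ∀ i k, δ (W i k) = if i = k then 1 else 0) : W.det ≠ 0 := by
  intro h0
  -- The derivation maps both the variable and the diagonal entries of `W` to one, so it annihilates
  -- the characteristic matrix, hence the characteristic polynomial.
  have h1 : ∀ i k, polyDer δ (W.charmatrix i k) = 0 := by
    intro i k
    have h2 := hW i k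
    ext n
    rw [coeff_polyDer]
    by_cases hik : i = k
    · subst hik
      rw [Matrix.charmatrix_apply_eq]
      rcases n with _ | _ | n <;> simp_all [coeff_X, coeff_C]
    · rw [Matrix.charmatrix_apply_ne _ _ _ hik]
      rcases n with _ | n <;> simp_all [coeff_C]
  have h2 : polyDer δ W.charpoly = 0 := by
    rw [Matrix.charpoly, Matrix.det_apply, map_sum]
    refine Finset.sum_eq_zero fun σ _ => ?_
    rw [Units.smul_def, map_zsmul, derivation_prod_eq_zero (polyDer δ) _
      (f := fun i => W.charmatrix (σ i) i) fun i => h1 _ _, smul_zero]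
  -- A singular `W` has zero constant coefficient. Vanishing of the derivative expresses each next
  -- coefficient through the derivative of the previous one, so all vanish, contradicting monicity.
  have h3 : ∀ n, W.charpoly.coeff n = 0 := by
    intro n
    induction n with
    | zero =>
      rw [Matrix.det_eq_sign_charpoly_coeff, mul_eq_zero] at h0
      exact h0.resolve_left (pow_ne_zero _ (by norm_num))
    | succ n ih =>
      have h4 := coeff_polyDer δ W.charpoly n
      rw [h2, ih, map_zero, zero_add, coeff_zero, zero_eq_mul] at h4
      exact h4.resolve_right (by exact_mod_cast n.succ_ne_zero)
  exact W.charpoly_monic.ne_zero (Polynomial.ext h3)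

end characteristicPolynomial

/-! ### Derivatives of the second-order invariants are independent -/

section independence

variable {m : ℕ} {v : Fin (2 * m + 1 + 1) → Idx m → JetRat m}

theorem derivation_dq (δ : Derivation ℝ (JetRat m) (JetRat m))
    (hδ : ∀ i : Base m, δ (gen (.u (Finsupp.single i 1))) = 0) (y : Idx m → JetRat m) :
    δ (dq gen y) = dq gen fun a => δ (y a) := by
  simp only [dq, map_sub, map_sum, Derivation.leibniz, smul_eq_mul, hδ, mul_zero, add_zero]

theorem derivation_eq_zero_of_mem_ratOrd {δ : Derivation ℝ (JetRat m) (JetRat m)} {k : ℕ}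
    (hδ : ∀ t : JetVar m, t.ord ≤ k → δ (gen t) = 0) {f : JetRat m} (hf : f ∈ ratOrd m k) :
    δ f = 0 := by
  induction hf using IntermediateField.adjoin_induction with
  | mem x hx => obtain ⟨t, ht, rfl⟩ := hx; exact hδ t ht
  | algebraMap c => simp
  | add x y _ _ hx hy => rw [map_add, hx, hy, add_zero]
  | inv x _ hx => rw [Derivation.leibniz_inv, hx, smul_zero]
  | mul x y _ _ hx hy => rw [Derivation.leibniz, hx, hy, smul_zero, smul_zero, add_zero]

theorem dq_mem_ratOrd {y : Idx m → JetRat m} (hy : ∀ a, y a ∈ ratOrd m 2) :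
    dq gen y ∈ ratOrd m 2 :=
  sub_mem (sum_mem fun i _ => mul_mem (gen_mem_ratOrd (by rw [ord_single]; norm_num)) (hy _))
    (hy _)

theorem position_mem_ratOrd (a : Idx m) : position gen a ∈ ratOrd m 2 := by
  induction a using idx_cases with
  | h i => simpa [position] using gen_mem_ratOrd (t := .x i) (Nat.zero_le _)
  | h' => simpa [position] using gen_mem_ratOrd (t := .u 0) (by rw [ord_zero]; norm_num)

theorem secondForm_mem_ratOrd {y z : Idx m → JetRat m} (hy : ∀ a, y a ∈ ratOrd m 2)
    (hz : ∀ a, z a ∈ ratOrd m 2) : secondForm gen y z ∈ ratOrd m 2 :=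
  div_mem (sum_mem fun i _ => sum_mem fun k _ =>
    mul_mem (mul_mem (gen_mem_ratOrd (by rw [ord_single_add])) (hy _)) (hz _))
    (dq_mem_ratOrd position_mem_ratOrd)

theorem secondForm_zero (y : Idx m → JetRat m) : secondForm gen 0 y = 0 := by
  simp [secondForm, d2q]

/-- The components of the coframe dual to the tangential part of the frame. -/
def coframe (v : Fin (2 * m + 1 + 1) → Idx m → JetRat m) (c : Fin (2 * m + 1)) (p : Base m) :
    JetRat m :=
  coord v c.succ (tangentVec gen (Pi.single p 1))

theorem sum_coframe (c : Fin (2 * m + 1)) {y : Idx m → JetRat m} (hy : dq gen y = 0) :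
    ∑ p, coframe v c p * y (emb p) = coord v c.succ y := by
  have h1 : y = ∑ p, y (emb p) • tangentVec gen (Pi.single p 1) := by
    refine idx_ext (fun k => ?_) ?_
    · simp [Finset.sum_apply, tangentVec, Pi.single_apply, -Fintype.sum_sum_type]
    · rw [dq, sub_eq_zero] at hy
      rw [← hy]
      simp [Finset.sum_apply, tangentVec, Pi.single_apply, -Fintype.sum_sum_type, mul_comm]
  conv_rhs => rw [h1, coord_sum]
  exact Finset.sum_congr rfl fun p _ => by rw [coord_smul, mul_comm]; rfl

theorem prod_pow_single_add_add {F : Type*} [CommMonoid F] (e : Base m → F) (a b p : Base m) :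
    ∏ l, e l ^ (Finsupp.single a 1 + Finsupp.single b 1 + Finsupp.single p 1 : Base m →₀ ℕ) l =
      e a * e b * e p := by
  simp only [Finsupp.add_apply, pow_add, Finset.prod_mul_distrib]
  simp [Finsupp.single_apply, pow_ite, -Fintype.prod_sum_type]

namespace IsCanonicalFrame

variable (hv : IsCanonicalFrame gen v) (hv2 : ∀ i a, v i a ∈ ratOrd m 2)

/-- A vertical derivation on jets of order three. -/
def thirdDer (v : Fin (2 * m + 1 + 1) → Idx m → JetRat m) :
    Derivation ℝ (JetRat m) (JetRat m) :=
  genDer fun t => match t with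
    | .x _ => 0
    -- The third derivatives vary by the sum of the cubes of the dual coframe, scaled by `dq(v₀)` to
    -- cancel the denominator of `Q`.
    | .u σ => if σ.degree = 3 then
        dq gen (position gen) * ∑ c, ∏ l, coframe v c l ^ σ l else 0

theorem thirdDer_gen {t : JetVar m} (ht : t.ord ≤ 2) : thirdDer v (gen t) = 0 := by
  rw [thirdDer, genDer_gen]
  cases t with
  | x i => rfl
  | u σ => exact if_neg (by simp only [JetVar.ord] at ht; omega)

include hv hv2 in
-- The derivation kills functions of order two, in particular the components of `v_i`. Contracting
-- the sum of cubes with `v_i` leaves the square of the `i`-th coframe member.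
theorem bracket_thirdDer_gen (i : Fin (2 * m + 1)) (a b : Base m) :
    ⁅thirdDer v, horizontal (v i.succ)⁆ (gen (.u (Finsupp.single a 1 + Finsupp.single b 1))) =
      dq gen (position gen) * (coframe v i a * coframe v i b) := by
  have h1 : ∀ p, thirdDer v (v i.succ p) = 0 := fun p =>
    derivation_eq_zero_of_mem_ratOrd (fun t => thirdDer_gen) (hv2 _ _)
  rw [Derivation.commutator_apply, thirdDer_gen (by rw [ord_single_add]), map_zero, sub_zero,
    horizontal_apply, map_sum]
  simp only [Derivation.leibniz, h1, smul_eq_mul, mul_zero, add_zero, totalDer_u]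
  have h2 : ∀ p, thirdDer v (gen (.u (Finsupp.single a 1 + Finsupp.single b 1 +
      Finsupp.single p 1))) =
        dq gen (position gen) * ∑ c, coframe v c a * coframe v c b * coframe v c p := by
    intro p
    rw [thirdDer, genDer_gen]
    simp only [prod_pow_single_add_add]
    rw [if_pos (by simp)]
  simp only [h2]
  have h3 : ∀ c, ∑ p, coframe v c p * v i.succ (emb p) = if c = i then 1 else 0 := by
    intro c
    rw [sum_coframe c (hv.dq_eq_zero (Fin.succ_ne_zero i)), hv.isDarboux.coord_self]
    simp only [Fin.succ_inj]
  calc ∑ p, v i.succ (emb p) * (dq gen (position gen) *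
        ∑ c, coframe v c a * coframe v c b * coframe v c p) =
      dq gen (position gen) * ∑ c, coframe v c a * coframe v c b *
        ∑ p, coframe v c p * v i.succ (emb p) := by
        simp only [Finset.mul_sum]
        rw [Finset.sum_comm]
        exact Finset.sum_congr rfl fun c _ => Finset.sum_congr rfl fun p _ => by ring
    _ = _ := by simp [h3]

include hv2 in
theorem bracket_thirdDer_low (i : Fin (2 * m + 1)) {t : JetVar m} (ht : t.ord ≤ 1) :
    ⁅thirdDer v, horizontal (v i.succ)⁆ (gen t) = 0 := by
  have h1 : ∀ p, thirdDer v (v i.succ p) = 0 := fun p =>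
    derivation_eq_zero_of_mem_ratOrd (fun t => thirdDer_gen) (hv2 _ _)
  rw [Derivation.commutator_apply, thirdDer_gen (by omega), map_zero, sub_zero,
    horizontal_apply, map_sum]
  refine Finset.sum_eq_zero fun p _ => ?_
  rw [Derivation.leibniz, h1, smul_zero, add_zero, smul_eq_mul]
  cases t with
  | x k => rw [totalDer_x]; split_ifs <;> simp
  | u σ =>
    rw [totalDer_u, thirdDer_gen, mul_zero]
    simp only [JetVar.ord, map_add, Finsupp.degree_single] at ht ⊢
    omega

theorem derivation_secondForm (η : Derivation ℝ (JetRat m) (JetRat m))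
    (hlow : ∀ t : JetVar m, t.ord ≤ 1 → η (gen t) = 0) (e : Base m → JetRat m)
    (h2 : ∀ a b, η (gen (.u (Finsupp.single a 1 + Finsupp.single b 1))) =
      dq gen (position gen) * (e a * e b)) (hlam : dq gen (position (gen (m := m))) ≠ 0)
    (y z : Idx m → JetRat m) :
    η (secondForm gen y z) = secondForm gen (fun a => η (y a)) z +
      secondForm gen y (fun a => η (z a)) +
        (∑ p, e p * y (emb p)) * ∑ p, e p * z (emb p) := by
  have h3 : η (dq gen (position gen)) = 0 := by
    rw [derivation_dq η fun i => hlow _ (by rw [ord_single])]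
    have : (fun a => η (position gen a)) = 0 :=
      idx_ext (fun i => by simp [position, hlow (.x i) (Nat.zero_le _)])
        (by simp [position, hlow (.u 0) (by rw [ord_zero]; exact zero_le_one)])
    rw [this, ← dqL_apply, map_zero]
  rw [secondForm, secondForm, secondForm, Derivation.leibniz_div, h3]
  have h4 : η (d2q gen y z) = d2q gen (fun a => η (y a)) z + d2q gen y (fun a => η (z a)) +
      dq gen (position gen) * ((∑ p, e p * y (emb p)) * ∑ p, e p * z (emb p)) := by
    rw [Finset.sum_mul_sum]
    simp only [d2q, map_sum, Finset.mul_sum, ← Finset.sum_add_distrib]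
    refine Finset.sum_congr rfl fun a _ => Finset.sum_congr rfl fun b _ => ?_
    simp only [Derivation.leibniz, smul_eq_mul, h2]
    ring
  rw [h4]
  simp only [smul_eq_mul, mul_zero, sub_zero]
  field_simp

include hv hv2 in
-- Since `I_{2,l}` is of order two, the left-hand side is the bracket `η` applied to it.
-- Infinitesimally `η` adds to `Q` the square of the `i`-th coframe member. This affects only the
-- diagonal entry `i`, which is not normalized, so the frame does not move and only `I_{2,i}`
-- changes, at rate one.
theorem thirdDer_nabla_gramDiag (i l : Fin (2 * m + 1)) :
    thirdDer v (horizontal (v i.succ) (gramDiag gen v l)) = if i = l then 1 else 0 := by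
  set η := ⁅thirdDer v, horizontal (v i.succ)⁆ with hη
  have hlow : ∀ t : JetVar m, t.ord ≤ 1 → η (gen t) = 0 := fun t =>
    bracket_thirdDer_low hv2 i
  have hQ := derivation_secondForm η hlow (coframe v i)
    (hv.bracket_thirdDer_gen hv2 i) hv.lam_ne_zero
  have he : ∀ b : Fin (2 * m + 1 + 1), b ≠ 0 →
      ∑ p, coframe v i p * v b (emb p) = if i.succ = b then 1 else 0 := by
    intro b hb
    rw [sum_coframe i (hv.dq_eq_zero hb), hv.isDarboux.coord_self]
  have hconst : ∀ c : JetRat m, (∃ r : ℝ, c = algebraMap ℝ _ r) → η c = 0 := by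
    rintro _ ⟨r, rfl⟩; simp
  -- The infinitesimal case of rigidity, with both frames equal to `v`.
  have hs : (fun b a => η (v b a)) = (0 : Fin (2 * m + 1 + 1) → Idx m → JetRat m) := by
    refine hv.rigid hv det_hess_gen_ne_zero _ ?_ ?_ ?_ ?_
    · rw [hv.zero]
      exact idx_ext (fun i => by simp [position, hlow (.x i) (Nat.zero_le _)])
        (by simp [position, hlow (.u 0) (by rw [ord_zero]; exact zero_le_one)])
    · intro a
      rw [← derivation_dq η fun i => hlow _ (by rw [ord_single])]
      by_cases ha : a = 0
      · subst ha
        rw [hv.zero, derivation_dq η fun i => hlow _ (by rw [ord_single])]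
        have : (fun a => η (position gen a)) = 0 :=
          idx_ext (fun i => by simp [position, hlow (.x i) (Nat.zero_le _)])
            (by simp [position, hlow (.u 0) (by rw [ord_zero]; exact zero_le_one)])
        rw [this, ← dqL_apply, map_zero]
      · rw [hv.dq_eq_zero ha, map_zero]
    · intro a b
      rw [← derivation_omega, hv.isDarboux]
      refine hconst _ ?_
      rw [sgn]
      split_ifs
      · exact ⟨1, by simp⟩
      · exact ⟨-1, by simp⟩
      · exact ⟨0, by simp⟩
    · intro a b ha hb hab
      have h1 := hQ (v a) (v b)
      rw [he a ha, he b hb, hv.secondForm_eq ha hb, if_neg hab] at h1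
      have h2 : ((if i.succ = a then 1 else 0) * if i.succ = b then 1 else 0 : JetRat m) = 0 := by
        split_ifs with h3 h4
        · exact absurd (h3.symm.trans h4) hab
        all_goals simp
      rw [h2, add_zero] at h1
      rw [← h1]
      refine hconst _ ?_
      split_ifs
      · exact ⟨1, by simp⟩
      · exact ⟨0, by simp⟩
  have h1 := hQ (v l.succ) (v l.succ)
  have h2 : (fun a => η (v l.succ a)) = 0 := congrFun hs l.succ
  rw [h2, he _ (Fin.succ_ne_zero l), secondForm_symm _ _ 0, secondForm_zero, zero_add, zero_add,
    hη, Derivation.commutator_apply] at h1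
  have h3 : thirdDer v (secondForm gen (v l.succ) (v l.succ)) = 0 :=
    derivation_eq_zero_of_mem_ratOrd (fun t => thirdDer_gen)
      (secondForm_mem_ratOrd (hv2 _) (hv2 _))
  rw [h3, map_zero, sub_zero] at h1
  rw [gramDiag, h1]
  simp only [Fin.succ_inj]
  split_ifs <;> simp

include hv hv2 in
theorem det_nabla_gramDiag_ne_zero :
    (Matrix.of fun i l : Fin (2 * m + 1) =>
      horizontal (v i.succ) (gramDiag gen v l)).det ≠ 0 :=
  det_ne_zero_of_derivation (thirdDer v)
    (hv.thirdDer_nabla_gramDiag hv2)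

end IsCanonicalFrame

end independence

/-! ### Specialization of the frame -/

section specialization

variable {m : ℕ}

theorem mem_symplecticGroup_of_omega {g : Matrix (Idx m) (Idx m) ℝ}
    (h : ∀ y z, omega (g.mulVec y) (g.mulVec z) = omega y z) :
    g ∈ Matrix.symplecticGroup (Fin (m + 1)) ℝ := by
  rw [SymplecticGroup.mem_iff']
  ext a b
  have h1 := h (Pi.single a 1) (Pi.single b 1)
  rw [omega_eq_dotProduct, omega_eq_dotProduct, neg_inj, Matrix.mulVec_mulVec,
    ← Matrix.vecMul_transpose, ← Matrix.dotProduct_mulVec, Matrix.mulVec_mulVec,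
    ← Matrix.mul_assoc] at h1
  simpa [Matrix.mulVec_single_one] using h1

/-- The map that preserves coordinates between two symplectic bases preserves `ω`. -/
theorem exists_symplectic {a b : Fin (2 * m + 1 + 1) → Idx m → ℝ} (ha : IsDarboux a)
    (hb : IsDarboux b) :
    ∃ g ∈ Matrix.symplecticGroup (Fin (m + 1)) ℝ, ∀ i, g.mulVec (a i) = b i := by
  let L : (Idx m → ℝ) →ₗ[ℝ] (Idx m → ℝ) :=
    { toFun := fun y => ∑ k, coord a k y • b k
      map_add' := fun y z => by simp only [coord_add, add_smul, Finset.sum_add_distrib]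
      map_smul' := fun c y => by
        simp only [coord_smul, mul_smul, Finset.smul_sum, RingHom.id_apply] }
  have hL : ∀ y, (LinearMap.toMatrix' L).mulVec y = ∑ k, coord a k y • b k := fun y =>
    LinearMap.toMatrix'_mulVec L y
  refine ⟨LinearMap.toMatrix' L, mem_symplecticGroup_of_omega fun y z => ?_, fun i => ?_⟩
  · have key : ∀ {w : Fin (2 * m + 1 + 1) → Idx m → ℝ}, IsDarboux w → ∀ c d : Fin _ → ℝ,
        omega (∑ k, c k • w k) (∑ k, d k • w k) =
          ∑ k, ∑ l, c k * (d l * if l = partner k then sgn ℝ k else 0) := by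
      intro w hw c d
      rw [← omegaB_apply]
      simp only [map_sum, LinearMap.sum_apply, map_smul, LinearMap.smul_apply, smul_eq_mul,
        omegaB_apply, hw _ _]
      simp only [Finset.mul_sum]
      rw [Finset.sum_comm]
      exact Finset.sum_congr rfl fun k _ => Finset.sum_congr rfl fun l _ => by ring
    rw [hL, hL, key hb, ← key ha, ha.expand, ha.expand]
  · rw [hL]
    simp [ha.coord_self]

theorem IsDarboux.of_hasValue {v : Fin (2 * m + 1 + 1) → Idx m → JetRat m} (hv : IsDarboux v)
    {j : JetVar m → ℝ} {w : Fin (2 * m + 1 + 1) → Idx m → ℝ}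
    (hw : ∀ i a, HasValue (v i a) j (w i a)) : IsDarboux w := by
  intro i k
  refine (HasValue.omega (hw i) (hw k)).unique ?_
  rw [hv i k, sgn, sgn]
  split_ifs
  · exact HasValue.one j
  · exact (HasValue.one j).neg
  · exact HasValue.zero j

theorem HasValue.aeval_sumElim {τ ν : Type*} {b : τ → JetRat m} {j : JetVar m → ℝ}
    {c : JetRat m → ℝ} (r : MvPolynomial (τ ⊕ ν) ℝ) {V : ν → JetRat m} {V' : ν → ℝ}
    (hV : ∀ s, HasValue (V s) j (V' s))
    (hb : ∀ i, Sum.inl i ∈ r.vars → HasValue (b i) j (c (b i))) :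
    HasValue (MvPolynomial.aeval (Sum.elim b V) r) j
      (MvPolynomial.aeval (Sum.elim (fun i => c (b i)) V') r) := by
  refine HasValue.aeval r fun t ht => ?_
  rcases t with i | s
  · exact hb i ht
  · exact hV s

theorem IsCanonicalFrame.pullback_aeval {v : Fin (2 * m + 1 + 1) → Idx m → JetRat m}
    (hv : IsCanonicalFrame gen v) {g h : Matrix (Idx m) (Idx m) ℝ}
    (hg : g ∈ Matrix.symplecticGroup (Fin (m + 1)) ℝ) (hgh : g * h = 1) {τ : Type*}
    {b : τ → JetRat m} (hb : ∀ i, pullback hgh (b i) = b i)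
    (r : MvPolynomial (τ ⊕ Fin (2 * m + 1 + 1) × Idx m) ℝ) :
    pullback hgh (MvPolynomial.aeval (Sum.elim b fun s => v s.1 s.2) r) =
      MvPolynomial.aeval (Sum.elim b fun s => act g (v s.1) s.2) r := by
  have h1 := MvPolynomial.comp_aeval_apply (Sum.elim b fun s => v s.1 s.2) (pullback hgh) r
  refine h1.trans ?_
  congr 2
  funext t
  rcases t with i | s
  · exact hb i
  · exact hv.pullback_eq hg hgh _ _

/-- Relations between invariants and the components of a canonical frame persist when the frame is
replaced by suitable constants. -/
theorem IsCanonicalFrame.exists_specialization {v : Fin (2 * m + 1 + 1) → Idx m → JetRat m}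
    (hv : IsCanonicalFrame gen v) {ι κ : Type*} {a : ι → JetRat m} {e : κ → JetRat m}
    (ha : ∀ i, IsInvariant (a i)) (he : ∀ i, IsInvariant (e i)) {f : JetRat m}
    (hf : IsInvariant f) {p : MvPolynomial (ι ⊕ Fin (2 * m + 1 + 1) × Idx m) ℝ}
    {q : MvPolynomial (κ ⊕ Fin (2 * m + 1 + 1) × Idx m) ℝ}
    (hpq : f * MvPolynomial.aeval (Sum.elim e fun s => v s.1 s.2) q =
      MvPolynomial.aeval (Sum.elim a fun s => v s.1 s.2) p)
    (hq : MvPolynomial.aeval (Sum.elim e fun s => v s.1 s.2) q ≠ 0) :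
    ∃ B : Fin (2 * m + 1 + 1) × Idx m → ℝ,
      MvPolynomial.aeval (Sum.elim e fun s => algebraMap ℝ (JetRat m) (B s)) q ≠ 0 ∧
      f * MvPolynomial.aeval (Sum.elim e fun s => algebraMap ℝ (JetRat m) (B s)) q =
        MvPolynomial.aeval (Sum.elim a fun s => algebraMap ℝ (JetRat m) (B s)) p := by
  classical
  rw [isInvariant_iff] at hf
  simp only [isInvariant_iff] at ha he
  let V : Fin (2 * m + 1 + 1) × Idx m → JetRat m := fun s => v s.1 s.2
  -- The constants `B` are the values of the frame at a jet `j₁` where the denominator has a nonzero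
  -- value; the specialized denominator has the same value there and so is nonzero.
  let S₁ : Finset (JetRat m) := q.vars.image (Sum.elim e V) ∪ Finset.univ.image V ∪
    {MvPolynomial.aeval (Sum.elim e V) q}
  obtain ⟨r₁, hr₁, h₁⟩ := exists_generic_poly S₁ id
  obtain ⟨j₁, hj₁⟩ := exists_eval_ne_zero hr₁
  choose! c₁ hc₁ hc₁' using h₁ j₁ hj₁
  have hV₁ : ∀ s, HasValue (V s) j₁ (c₁ (V s)) := fun s => hc₁ _
    (Finset.mem_union_left _ (Finset.mem_union_right _ (Finset.mem_image_of_mem V (Finset.mem_univ s))))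
  have he₁ : ∀ i, Sum.inl i ∈ q.vars → HasValue (e i) j₁ (c₁ (e i)) := by
    intro i ht
    exact hc₁ _ (Finset.mem_union_left _ (Finset.mem_union_left _
      (Finset.mem_image.2 ⟨_, ht, rfl⟩)))
  refine ⟨fun s => c₁ (V s), ?_, ?_⟩
  · intro h0
    have h2 := HasValue.aeval_sumElim q (fun s => HasValue.const j₁ (c₁ (V s))) he₁
    rw [h0] at h2
    have h3 := HasValue.aeval_sumElim q hV₁ he₁
    rw [h2.unique (HasValue.zero _)] at h3
    have h4 : MvPolynomial.aeval (Sum.elim e V) q ∈ S₁ := by simp [S₁]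
    exact hc₁' _ h4 hq ((hc₁ _ h4).unique h3)
  · by_contra hne
    set D := f * MvPolynomial.aeval (Sum.elim e fun s => algebraMap ℝ (JetRat m) (c₁ (V s))) q -
      MvPolynomial.aeval (Sum.elim a fun s => algebraMap ℝ (JetRat m) (c₁ (V s))) p
    have hD : D ≠ 0 := sub_ne_zero.2 hne
    -- If the specialized relation failed, its defect `D` would have a nonzero value at some `j₂`.
    let S₂ : Finset (JetRat m) := q.vars.image (Sum.elim e V) ∪ p.vars.image (Sum.elim a V) ∪
      Finset.univ.image V ∪ {f, D}
    obtain ⟨r₂, hr₂, h₂⟩ := exists_generic_poly S₂ id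
    obtain ⟨j₂, hj₂⟩ := exists_eval_ne_zero hr₂
    choose! c₂ hc₂ hc₂' using h₂ j₂ hj₂
    have hV₂ : ∀ s, HasValue (V s) j₂ (c₂ (V s)) := fun s => hc₂ _
      (Finset.mem_union_left _ (Finset.mem_union_right _
        (Finset.mem_image_of_mem V (Finset.mem_univ s))))
    have he₂ : ∀ i, Sum.inl i ∈ q.vars → HasValue (e i) j₂ (c₂ (e i)) := by
      intro i ht
      exact hc₂ _ (Finset.mem_union_left _ (Finset.mem_union_left _ (Finset.mem_union_left _
        (Finset.mem_image.2 ⟨_, ht, rfl⟩))))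
    have ha₂ : ∀ i, Sum.inl i ∈ p.vars → HasValue (a i) j₂ (c₂ (a i)) := by
      intro i ht
      exact hc₂ _ (Finset.mem_union_left _ (Finset.mem_union_left _ (Finset.mem_union_right _
        (Finset.mem_image.2 ⟨_, ht, rfl⟩))))
    -- A symplectic `g` maps the frame at `j₂` to `B`. Pulling the relation back by `g` fixes the
    -- invariants and replaces the frame by its image under `g`, whose value at `j₂` is `B`; so the
    -- defect vanishes there.
    obtain ⟨g, hg, hgB⟩ := exists_symplectic
      (hv.isDarboux.of_hasValue (w := fun i x => c₂ (v i x)) fun i x => hV₂ (i, x))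
      (hv.isDarboux.of_hasValue (w := fun i x => c₁ (v i x)) fun i x => hV₁ (i, x))
    obtain ⟨h, hgh⟩ := exists_inverse hg
    have hW : ∀ s : Fin (2 * m + 1 + 1) × Idx m,
        HasValue (act g (v s.1) s.2) j₂ (c₁ (V s)) := by
      intro s
      have h3 := HasValue.act g (fun x => hV₂ (s.1, x)) s.2
      rw [act_real] at h3
      have h4 := congrFun (hgB s.1) s.2
      simp only [V] at h3 ⊢
      rwa [h4] at h3
    have h3 := congrArg (pullback hgh) hpq
    rw [map_mul, hf g hg h hgh, hv.pullback_aeval hg hgh fun i => he i g hg h hgh,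
      hv.pullback_aeval hg hgh fun i => ha i g hg h hgh] at h3
    have hf₂ : HasValue f j₂ (c₂ f) := hc₂ _ (by simp [S₂])
    have h4 := hf₂.mul (HasValue.aeval_sumElim q hW he₂)
    rw [h3] at h4
    have h5 := h4.unique (HasValue.aeval_sumElim p hW ha₂)
    have h6 := (hf₂.mul (HasValue.aeval_sumElim q (fun s => HasValue.const j₂ (c₁ (V s))) he₂)).sub
      (HasValue.aeval_sumElim p (fun s => HasValue.const j₂ (c₁ (V s))) ha₂)
    rw [h5, sub_self] at h6
    have h7 : D ∈ S₂ := by simp [S₂]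
    exact hc₂' _ h7 hD ((hc₂ _ h7).unique h6)

theorem aeval_sumElim_mem {τ ν : Type*} {S : Subalgebra ℝ (JetRat m)} {b : τ → JetRat m}
    (hb : ∀ i, b i ∈ S) (B : ν → ℝ) (r : MvPolynomial (τ ⊕ ν) ℝ) :
    MvPolynomial.aeval (Sum.elim b fun s => algebraMap ℝ (JetRat m) (B s)) r ∈ S := by
  have h1 : Algebra.adjoin ℝ (Set.range (Sum.elim b fun s => algebraMap ℝ (JetRat m) (B s))) ≤ S := by
    rw [Algebra.adjoin_le_iff]
    rintro _ ⟨i | s, rfl⟩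
    · exact hb i
    · exact S.algebraMap_mem _
  rw [Algebra.adjoin_range_eq_range_aeval] at h1
  exact h1 ⟨r, rfl⟩

theorem exists_aeval_of_mem_adjoin {ν : Type*} {S : Set (JetRat m)} {V : ν → JetRat m}
    {x : JetRat m} (hx : x ∈ Algebra.adjoin ℝ (S ∪ Set.range V)) :
    ∃ r : MvPolynomial (S ⊕ ν) ℝ, MvPolynomial.aeval (Sum.elim Subtype.val V) r = x := by
  have h1 : S ∪ Set.range V = Set.range (Sum.elim (Subtype.val : S → JetRat m) V) := by
    rw [Set.Sum.elim_range, Subtype.range_coe]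
  rw [h1, Algebra.adjoin_range_eq_range_aeval] at hx
  exact hx

/-- After specialization the numerator lies in `A` and the denominator in `E`. The denominator must
have coefficients in a field contained in `A`, since elements of `A` need not be invertible in `A`.
-/
theorem IsCanonicalFrame.mem_of_mul_mem {v : Fin (2 * m + 1 + 1) → Idx m → JetRat m}
    (hv : IsCanonicalFrame gen v) {A : Subalgebra ℝ (JetRat m)}
    {E : IntermediateField ℝ (JetRat m)} (hEA : ∀ x ∈ E, x ∈ A) (hA : ∀ x ∈ A, IsInvariant x)
    {f q : JetRat m} (hf : IsInvariant f) (hq0 : q ≠ 0)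
    (hq : q ∈ Algebra.adjoin ℝ
      ((E : Set (JetRat m)) ∪ Set.range fun s : Fin (2 * m + 1 + 1) × Idx m => v s.1 s.2))
    (hfq : f * q ∈ Algebra.adjoin ℝ
      ((A : Set (JetRat m)) ∪ Set.range fun s : Fin (2 * m + 1 + 1) × Idx m => v s.1 s.2)) :
    f ∈ A := by
  obtain ⟨r, rfl⟩ := exists_aeval_of_mem_adjoin hq
  obtain ⟨p, hp⟩ := exists_aeval_of_mem_adjoin hfq
  obtain ⟨B, hB, hB'⟩ := hv.exists_specialization (a := (Subtype.val : ↥(A : Set (JetRat m)) → JetRat m))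
    (e := (Subtype.val : ↥(E : Set (JetRat m)) → JetRat m)) (fun x => hA _ x.2)
    (fun x => hA _ (hEA _ x.2)) hf hp.symm hq0
  rw [(eq_div_iff hB).2 hB', div_eq_mul_inv]
  refine mul_mem (aeval_sumElim_mem (b := (Subtype.val : ↥(A : Set (JetRat m)) → JetRat m)) Subtype.prop B p) (hEA _ (inv_mem ?_))
  exact aeval_sumElim_mem (S := E.toSubalgebra) (b := (Subtype.val : ↥(E : Set (JetRat m)) → JetRat m))
    Subtype.prop B r

end specialization

/-! ### Generation of the invariants -/

section ratPoly

variable {m : ℕ}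

theorem isRatPoly_of_mem_ratOrd {f : JetRat m} (hf : f ∈ ratOrd m 2) : IsRatPoly f :=
  Subalgebra.algebraMap_mem _ (⟨f, hf⟩ : ratOrd m 2)

theorem isRatPoly_gen (t : JetVar m) : IsRatPoly (gen t) := by
  by_cases ht : 2 < t.ord
  · exact Algebra.subset_adjoin ⟨t, ht, rfl⟩
  · exact isRatPoly_of_mem_ratOrd (gen_mem_ratOrd (not_lt.1 ht))

theorem isRatPoly_totalDer_gen (i : Base m) (t : JetVar m) : IsRatPoly (totalDer i (gen t)) := by
  cases t with
  | x k =>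
    rw [totalDer_x]
    split_ifs
    · exact one_mem _
    · exact zero_mem _
  | u σ => rw [totalDer_u]; exact isRatPoly_gen _

theorem isRatPoly_totalDer_of_mem (i : Base m) {f : JetRat m} (hf : f ∈ ratOrd m 2) :
    IsRatPoly (totalDer i f) := by
  induction hf using IntermediateField.adjoin_induction with
  | mem x hx => obtain ⟨t, -, rfl⟩ := hx; exact isRatPoly_totalDer_gen i t
  | algebraMap c => rw [Derivation.map_algebraMap]; exact zero_mem _
  | add x y _ _ hx hy => rw [map_add]; exact add_mem hx hy
  | inv x hx0 hx =>
    rw [Derivation.leibniz_inv, smul_eq_mul]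
    refine mul_mem (neg_mem (isRatPoly_of_mem_ratOrd ?_)) hx
    exact pow_mem (inv_mem hx0) 2
  | mul x y hx0 hy0 hx hy =>
    rw [Derivation.leibniz, smul_eq_mul, smul_eq_mul]
    exact add_mem (mul_mem (isRatPoly_of_mem_ratOrd hx0) hy)
      (mul_mem (isRatPoly_of_mem_ratOrd hy0) hx)

theorem IsRatPoly.totalDer (i : Base m) {f : JetRat m} (hf : IsRatPoly f) :
    IsRatPoly (totalDer i f) := by
  induction hf using Algebra.adjoin_induction with
  | mem x hx => obtain ⟨t, -, rfl⟩ := hx; exact isRatPoly_totalDer_gen i t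
  | algebraMap r => exact isRatPoly_totalDer_of_mem i r.2
  | add x y _ _ hx hy => rw [map_add]; exact add_mem hx hy
  | mul x y hx0 hy0 hx hy =>
    rw [Derivation.leibniz, smul_eq_mul, smul_eq_mul]
    exact add_mem (mul_mem hx0 hy) (mul_mem hy0 hx)

theorem IsRatPoly.horizontal {y : Idx m → JetRat m} (hy : ∀ a, IsRatPoly (y a)) {f : JetRat m}
    (hf : IsRatPoly f) : IsRatPoly (horizontal y f) := by
  rw [horizontal_apply]
  exact sum_mem fun i _ => mul_mem (hy _) (hf.totalDer i)

variable (m) in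
/-- The field of rational differential invariants. -/
def invariants : IntermediateField ℝ (JetRat m) where
  carrier := {f | IsInvariant f}
  mul_mem' {a b} ha hb := by
    simp only [Set.mem_ofPred_eq, isInvariant_iff] at *
    intro g hg h hgh
    rw [map_mul, ha g hg h hgh, hb g hg h hgh]
  add_mem' {a b} ha hb := by
    simp only [Set.mem_ofPred_eq, isInvariant_iff] at *
    intro g hg h hgh
    rw [map_add, ha g hg h hgh, hb g hg h hgh]
  algebraMap_mem' r := isInvariant_iff.2 fun g _ h hgh => (pullback hgh).commutes r
  inv_mem' a ha := by
    simp only [Set.mem_ofPred_eq, isInvariant_iff] at *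
    intro g hg h hgh
    rw [map_inv₀, ha g hg h hgh]

variable (m) in
/-- The algebra of invariants that are polynomial in the jet variables of order `> 2`. -/
def polyInvariants : Subalgebra ℝ (JetRat m) :=
  (invariants m).toSubalgebra ⊓
    (Algebra.adjoin (ratOrd m 2) (gen '' {t | 2 < t.ord})).restrictScalars ℝ

end ratPoly

/-! ### Jet coordinates from the frame and the generators -/

section generation

variable {m : ℕ} {v : Fin (2 * m + 1 + 1) → Idx m → JetRat m}

namespace IsCanonicalFrame

variable (hv : IsCanonicalFrame gen v) (hv2 : ∀ i a, v i a ∈ ratOrd m 2)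

include hv in
theorem invariant_nabla (k : Fin (2 * m + 1)) {f : JetRat m} (hf : IsInvariant f) :
    IsInvariant (horizontal (v k.succ) f) :=
  fun g hg => hv.isInvariantDer (Fin.succ_ne_zero k) g hg f f (hf g hg)

include hv2 in
theorem isRatPoly_structureCoeff
    (p : Fin (2 * m + 1) × Fin (2 * m + 1) × Fin (2 * m + 1)) :
    IsRatPoly (structureCoeff v p) := by
  have h1 : ∀ i a, IsRatPoly (v i a) := fun i a => isRatPoly_of_mem_ratOrd (hv2 i a)
  have h2 : ∀ i b a, IsRatPoly (frameDeriv v i b a) := fun i b a =>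
    (h1 b a).horizontal (h1 i.succ)
  have h3 : ∀ i b k, IsRatPoly (christoffel v i b k) := by
    intro i b k
    refine mul_mem ?_ (sum_mem fun l _ => sub_mem (mul_mem (h2 _ _ _) (h1 _ _))
      (mul_mem (h2 _ _ _) (h1 _ _)))
    rw [sgn]
    split_ifs
    · exact one_mem _
    · exact neg_mem (one_mem _)
  exact sub_mem (h3 _ _ _) (h3 _ _ _)

include hv2 in
theorem gramDiag_mem_ratOrd (i : Fin (2 * m + 1)) : gramDiag gen v i ∈ ratOrd m 2 :=
  secondForm_mem_ratOrd (hv2 _) (hv2 _)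

include hv hv2 in
theorem diffAlgebra_le : diffAlgebra (gramDiag gen v) (structureCoeff v)
    (fun k : Fin (2 * m + 1) => horizontal (v k.succ)) ≤ polyInvariants m := by
  refine sInf_le ⟨fun f hf => ?_, fun p => ?_, fun k f hf => ?_⟩
  · constructor
    · have : IntermediateField.adjoin ℝ (Set.range (gramDiag gen v)) ≤ invariants m := by
        rw [IntermediateField.adjoin_le_iff]
        rintro _ ⟨i, rfl⟩
        exact hv.isInvariant_gramDiag i
      exact this hf
    · have : IntermediateField.adjoin ℝ (Set.range (gramDiag gen v)) ≤ ratOrd m 2 := by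
        rw [IntermediateField.adjoin_le_iff]
        rintro _ ⟨i, rfl⟩
        exact gramDiag_mem_ratOrd hv2 i
      exact isRatPoly_of_mem_ratOrd (this hf)
  · exact ⟨hv.isInvariant_structureCoeff p, isRatPoly_structureCoeff hv2 p⟩
  · exact ⟨hv.invariant_nabla k hf.1,
      IsRatPoly.horizontal (fun a => isRatPoly_of_mem_ratOrd (hv2 _ a)) hf.2⟩

include hv in
theorem diffField_le : diffField (gramDiag gen v) (fun k : Fin (2 * m + 1) => horizontal (v k.succ)) ≤
    invariants m :=
  sInf_le ⟨hv.isInvariant_gramDiag, fun k _ hf => hv.invariant_nabla k hf⟩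

/-- The field generated by the components of the frame and the invariants of second order. -/
abbrev frameField (v : Fin (2 * m + 1 + 1) → Idx m → JetRat m) :
    IntermediateField ℝ (JetRat m) :=
  IntermediateField.adjoin ℝ (Set.range (gramDiag gen v) ∪
    Set.range fun s : Fin (2 * m + 1 + 1) × Idx m => v s.1 s.2)

theorem frame_mem (i : Fin (2 * m + 1 + 1)) (a : Idx m) : v i a ∈ frameField v :=
  IntermediateField.subset_adjoin _ _ (Or.inr ⟨(i, a), rfl⟩)

include hv2 in
theorem frameField_le : frameField v ≤ ratOrd m 2 := by
  rw [IntermediateField.adjoin_le_iff]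
  rintro _ (⟨i, rfl⟩ | ⟨s, rfl⟩)
  · exact gramDiag_mem_ratOrd hv2 i
  · exact hv2 _ _

theorem omega_mem_field {L : IntermediateField ℝ (JetRat m)} {y z : Idx m → JetRat m}
    (hy : ∀ a, y a ∈ L) (hz : ∀ a, z a ∈ L) : omega y z ∈ L :=
  sum_mem fun _ _ => sub_mem (mul_mem (hy _) (hz _)) (mul_mem (hy _) (hz _))

theorem coord_mem_field {L : IntermediateField ℝ (JetRat m)} (hL : frameField v ≤ L)
    {y : Idx m → JetRat m} (hy : ∀ a, y a ∈ L) (k : Fin (2 * m + 1 + 1)) : coord v k y ∈ L :=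
  mul_mem (sgn_mem L.toSubalgebra k) (omega_mem_field hy fun a => hL (frame_mem _ a))

include hv in
-- The vector `v₀` contains the base point and the value of `u`. The form `ω(·, v₁)` is `dq` up to a
-- factor fixed by `dq(∂/∂yₙ) = -1`, which gives the slopes; the Gram matrix of `Q` in the frame
-- then gives the second derivatives.
theorem ratOrd_le : ratOrd m 2 ≤ frameField v := by
  classical
  set L := frameField v
  have hx : ∀ i, gen (.x i) ∈ L := fun i => by
    have := frame_mem (v := v) 0 (emb i)
    rw [hv.zero] at this
    simpa [position] using this
  have hu : gen (.u 0) ∈ L := by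
    have := frame_mem (v := v) 0 dep
    rw [hv.zero] at this
    simpa [position] using this
  have hsingle : ∀ a b : Idx m, (Pi.single a 1 : Idx m → JetRat m) b ∈ L := fun a b => by
    rw [Pi.single_apply]
    split_ifs
    · exact one_mem _
    · exact zero_mem _
  have hω : ∀ a, omega (Pi.single a 1) (v 1) ∈ L := fun a =>
    omega_mem_field (hsingle a) fun b => frame_mem _ b
  have hlam : dq gen (position gen) ∈ L := by
    have h1 := hv.dq_eq (Pi.single dep 1)
    have h2 : dq gen (Pi.single dep (1 : JetRat m)) = -1 := by
      simp [dq, emb_ne_dep, -Fintype.sum_sum_type]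
    rw [h2] at h1
    have h3 : omega (Pi.single dep 1) (v 1) ≠ 0 := by
      intro h0; rw [h0, zero_mul] at h1; simp at h1
    rw [(eq_div_iff h3).2 ((mul_comm _ _).trans h1.symm)]
    exact div_mem (neg_mem (one_mem _)) (hω _)
  have hu1 : ∀ p, gen (.u (Finsupp.single p 1)) ∈ L := by
    intro p
    have h1 := hv.dq_eq (Pi.single (emb p) 1)
    have h2 : dq gen (Pi.single (emb p) (1 : JetRat m)) = gen (.u (Finsupp.single p 1)) := by
      simp [dq, Pi.single_apply, (emb_ne_dep p).symm, emb_injective.eq_iff,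
        -Fintype.sum_sum_type]
    rw [← h2, h1]
    exact mul_mem (hω _) hlam
  have htan : ∀ p a, tangentVec gen (Pi.single p 1) a ∈ L := by
    intro p a
    induction a using idx_cases with
    | h i =>
      rw [tangentVec, pt_emb, Pi.single_apply]
      split_ifs
      · exact one_mem _
      · exact zero_mem _
    | h' =>
      rw [tangentVec, pt_dep]
      simpa [Pi.single_apply, -Fintype.sum_sum_type] using hu1 p
  have hu2 : ∀ p q, gen (.u (Finsupp.single p 1 + Finsupp.single q 1)) ∈ L := by
    intro p q
    have h1 : gen (.u (Finsupp.single p 1 + Finsupp.single q 1)) =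
        secondForm gen (tangentVec gen (Pi.single p 1)) (tangentVec gen (Pi.single q 1)) *
          dq gen (position gen) := by
      rw [secondForm, div_mul_cancel₀ _ hv.lam_ne_zero]
      simp [d2q, tangentVec, Pi.single_apply, -Fintype.sum_sum_type]
    rw [h1]
    refine mul_mem ?_ hlam
    rw [hv.expand_tangent (dq_tangentVec gen (Pi.single p 1)),
      hv.expand_tangent (dq_tangentVec gen (Pi.single q 1)), ← secB_apply, map_sum,
      ]
    refine sum_mem fun l _ => ?_
    rw [map_smul, map_sum, LinearMap.sum_apply, smul_eq_mul]
    refine mul_mem (coord_mem_field le_rfl (htan q) _) (sum_mem fun k _ => ?_)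
    rw [map_smul, LinearMap.smul_apply, smul_eq_mul]
    refine mul_mem (coord_mem_field le_rfl (htan p) _) ?_
    exact IntermediateField.adjoin.mono _ _ _ Set.subset_union_left (hv.gram_mem_adjoin k l)
  rw [ratOrd, IntermediateField.adjoin_le_iff]
  rintro _ ⟨t, ht, rfl⟩
  cases t with
  | x i => exact hx i
  | u σ =>
    have h1 : σ.degree ≤ 2 := ht
    have hdec : ∀ σ : Base m →₀ ℕ, σ ≠ 0 → ∃ τ i, σ = τ + Finsupp.single i 1 := by
      intro σ hσ
      obtain ⟨i, hi⟩ := Finsupp.ne_iff.1 hσ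
      exact ⟨σ - Finsupp.single i 1, i, (tsub_add_cancel_of_le (by
        rw [Finsupp.single_le_iff]; exact Nat.one_le_iff_ne_zero.2 hi)).symm⟩
    by_cases h0 : σ = 0
    · rw [h0]; exact hu
    · obtain ⟨τ, i, rfl⟩ := hdec σ h0
      by_cases h2 : τ = 0
      · rw [h2, zero_add]; exact hu1 i
      · obtain ⟨ρ, k, rfl⟩ := hdec τ h2
        simp only [map_add, Finsupp.degree_single] at h1
        have h3 : ρ = 0 := (Finsupp.degree_eq_zero_iff ρ).1 (by omega)
        rw [h3, zero_add]
        exact hu2 k i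

variable {A : Subalgebra ℝ (JetRat m)}
  (hI : ∀ f ∈ IntermediateField.adjoin ℝ (Set.range (gramDiag gen v)), f ∈ A)
  (hc : ∀ p, structureCoeff v p ∈ A)
  (hD : ∀ k : Fin (2 * m + 1), ∀ f ∈ A, horizontal (v k.succ) f ∈ A)

/-- The algebra generated by the functions on 2-jets and by an algebra of invariants. -/
abbrev extend (A : Subalgebra ℝ (JetRat m)) : Subalgebra ℝ (JetRat m) :=
  Algebra.adjoin ℝ ((ratOrd m 2 : Set (JetRat m)) ∪ A)

theorem ratOrd_mem_extend {f : JetRat m} (hf : f ∈ ratOrd m 2) : f ∈ extend A :=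
  Algebra.subset_adjoin (Or.inl hf)

theorem mem_extend {f : JetRat m} (hf : f ∈ A) : f ∈ extend A :=
  Algebra.subset_adjoin (Or.inr hf)

include hv hv2 hI hc hD in
-- It suffices to differentiate the generators of the field of 2-jets. The `I_{2,i}` stay in `A`,
-- and the derivatives of the frame vectors are combinations of the frame with coefficients in `A`.
theorem nabla_mem_extend (k : Fin (2 * m + 1)) {f : JetRat m} (hf : f ∈ extend A) :
    horizontal (v k.succ) f ∈ extend A := by
  have h1 : ∀ f ∈ frameField v, horizontal (v k.succ) f ∈ extend A := by
    intro f hf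
    have hle := frameField_le hv2
    induction hf using IntermediateField.adjoin_induction with
    | mem x hx =>
      rcases hx with ⟨i, rfl⟩ | ⟨s, rfl⟩
      · exact mem_extend (hD k _ (hI _ (IntermediateField.subset_adjoin _ _ ⟨i, rfl⟩)))
      · have h2 : horizontal (v k.succ) (v s.1 s.2) = frameDeriv v k s.1 s.2 := rfl
        simp only [h2]
        rw [← hv.isDarboux.expand (frameDeriv v k s.1), Finset.sum_apply]
        exact sum_mem fun l _ => mul_mem (mem_extend (hv.coord_frameDeriv_mem hI hc hD k s.1 l))
          (ratOrd_mem_extend (hv2 _ _))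
    | algebraMap c => rw [Derivation.map_algebraMap]; exact zero_mem _
    | add x y _ _ hx hy => rw [map_add]; exact add_mem hx hy
    | inv x hx0 hx =>
      rw [Derivation.leibniz_inv, smul_eq_mul]
      exact mul_mem (neg_mem (ratOrd_mem_extend (pow_mem (inv_mem (hle hx0)) 2))) hx
    | mul x y hx0 hy0 hx hy =>
      rw [Derivation.leibniz, smul_eq_mul, smul_eq_mul]
      exact add_mem (mul_mem (ratOrd_mem_extend (hle hx0)) hy)
        (mul_mem (ratOrd_mem_extend (hle hy0)) hx)
  induction hf using Algebra.adjoin_induction with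
  | mem x hx =>
    rcases hx with hx | hx
    · exact h1 x (hv.ratOrd_le hx)
    · exact mem_extend (hD k x hx)
  | algebraMap r => rw [Derivation.map_algebraMap]; exact zero_mem _
  | add x y _ _ hx hy => rw [map_add]; exact add_mem hx hy
  | mul x y hx0 hy0 hx hy =>
    rw [Derivation.leibniz, smul_eq_mul, smul_eq_mul]
    exact add_mem (mul_mem hx0 hy) (mul_mem hy0 hx)

include hv in
-- The coordinate tangent vectors are expanded in the frame; closure under the `∇_k` thus implies
-- closure under total derivatives.
theorem totalDer_eq (i : Base m) (f : JetRat m) :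
    totalDer i f = ∑ k, coframe v k i * horizontal (v k.succ) f := by
  have h1 : totalDer i f = horizontal (tangentVec gen (Pi.single i 1)) f := by
    rw [horizontal_apply]
    simp [tangentVec, Pi.single_apply, -Fintype.sum_sum_type]
  rw [h1, hv.expand_tangent (dq_tangentVec gen (Pi.single i 1)), horizontal_sum,
    derivation_sum_apply]
  rfl

include hv hv2 hI hc hD in
theorem totalDer_mem_extend (i : Base m) {f : JetRat m} (hf : f ∈ extend A) :
    totalDer i f ∈ extend A := by
  rw [hv.totalDer_eq]
  refine sum_mem fun k _ => mul_mem (ratOrd_mem_extend ?_)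
    (hv.nabla_mem_extend hv2 hI hc hD k hf)
  refine coord_mem_field (frameField_le hv2) (fun a => ?_) _
  induction a using idx_cases with
  | h l =>
    rw [tangentVec, pt_emb, Pi.single_apply]
    split_ifs
    · exact one_mem _
    · exact zero_mem _
  | h' =>
    rw [tangentVec, pt_dep]
    simpa [Pi.single_apply, -Fintype.sum_sum_type] using
      gen_mem_ratOrd (t := .u (Finsupp.single i 1)) (by rw [ord_single]; norm_num)

include hv hv2 hI hc hD in
theorem gen_mem_extend (t : JetVar m) : gen t ∈ extend A := by
  cases t with
  | x i => exact ratOrd_mem_extend (gen_mem_ratOrd (Nat.zero_le _))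
  | u σ =>
    have key : ∀ n, ∀ σ : Base m →₀ ℕ, σ.degree = n → gen (.u σ) ∈ extend A := by
      intro n
      induction n with
      | zero =>
        intro σ hσ
        exact ratOrd_mem_extend (gen_mem_ratOrd (by simp only [JetVar.ord]; omega))
      | succ n ih =>
        intro σ hσ
        obtain ⟨i, hi⟩ : ∃ i, σ i ≠ 0 := by
          by_contra! h0
          have : σ = 0 := Finsupp.ext h0
          rw [this, map_zero] at hσ
          omega
        obtain ⟨τ, rfl⟩ : ∃ τ, σ = τ + Finsupp.single i 1 :=
          ⟨σ - Finsupp.single i 1, (tsub_add_cancel_of_le (by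
            rw [Finsupp.single_le_iff]; omega)).symm⟩
        rw [← totalDer_u]
        exact hv.totalDer_mem_extend hv2 hI hc hD i
          (ih τ (by rw [map_add, Finsupp.degree_single] at hσ; omega))
    exact key _ σ rfl

include hv hv2 hI hc hD in
theorem toRat_mem_extend (p : JetPoly m) : toRat p ∈ extend A := by
  induction p using MvPolynomial.induction_on with
  | C a => rw [toRat_C]; exact (extend A).algebraMap_mem a
  | add p q hp hq => rw [toRat, map_add]; exact add_mem hp hq
  | mul_X p t hp =>
    rw [toRat, map_mul]
    exact mul_mem hp (hv.gen_mem_extend hv2 hI hc hD t)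

include hv hv2 hI hc hD in
theorem isRatPoly_mem_extend {f : JetRat m} (hf : IsRatPoly f) : f ∈ extend A := by
  induction hf using Algebra.adjoin_induction with
  | mem x hx => obtain ⟨t, -, rfl⟩ := hx; exact hv.gen_mem_extend hv2 hI hc hD t
  | algebraMap r => exact ratOrd_mem_extend r.2
  | add x y _ _ hx hy => exact add_mem hx hy
  | mul x y _ _ hx hy => exact mul_mem hx hy

/-- Polynomials in the components of the frame. -/
abbrev polyOver (v : Fin (2 * m + 1 + 1) → Idx m → JetRat m) (S : Set (JetRat m)) :
    Subalgebra ℝ (JetRat m) :=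
  Algebra.adjoin ℝ (S ∪ Set.range fun s : Fin (2 * m + 1 + 1) × Idx m => v s.1 s.2)

include hv in
-- Only functions of the 2-jet introduce denominators. By `ratOrd_le` these are polynomials in the
-- frame components and the `I_{2,i}`, so they have coefficients in `E` rather than merely in `A`.
theorem exists_mul_mem_polyOver {E : IntermediateField ℝ (JetRat m)} (hEA : ∀ x ∈ E, x ∈ A)
    (hE : ∀ i, gramDiag gen v i ∈ E) {f : JetRat m} (hf : f ∈ extend A) :
    ∃ q ∈ polyOver v E, q ≠ 0 ∧ f * q ∈ polyOver v A := by
  have hle : polyOver v E ≤ polyOver v A :=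
    Algebra.adjoin_mono (Set.union_subset_union_left _ hEA)
  induction hf using Algebra.adjoin_induction with
  | mem x hx =>
    rcases hx with hx | hx
    · have h1 := hv.ratOrd_le hx
      obtain ⟨r, hr, s, hs, rfl⟩ := IntermediateField.mem_adjoin_iff_div.1 h1
      have h2 : Algebra.adjoin ℝ (Set.range (gramDiag gen v) ∪
          Set.range fun s : Fin (2 * m + 1 + 1) × Idx m => v s.1 s.2) ≤ polyOver v E :=
        Algebra.adjoin_mono (Set.union_subset_union_left _ (by rintro _ ⟨i, rfl⟩; exact hE i))
      -- A zero denominator makes the quotient zero by convention.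
      by_cases h0 : s = 0
      · exact ⟨1, one_mem _, one_ne_zero, by rw [h0, div_zero, zero_mul]; exact zero_mem _⟩
      · exact ⟨s, h2 hs, h0, by rw [div_mul_cancel₀ _ h0]; exact hle (h2 hr)⟩
    · exact ⟨1, one_mem _, one_ne_zero, by
        rw [mul_one]; exact Algebra.subset_adjoin (Or.inl hx)⟩
  | algebraMap r => exact ⟨1, one_mem _, one_ne_zero, by
      rw [mul_one]; exact Subalgebra.algebraMap_mem _ _⟩
  | add x y _ _ hx hy =>
    obtain ⟨q, hq, hq0, hxq⟩ := hx
    obtain ⟨q', hq', hq0', hyq⟩ := hy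
    refine ⟨q * q', mul_mem hq hq', mul_ne_zero hq0 hq0', ?_⟩
    have : (x + y) * (q * q') = x * q * q' + y * q' * q := by ring
    rw [this]
    exact add_mem (mul_mem hxq (hle hq')) (mul_mem hyq (hle hq))
  | mul x y _ _ hx hy =>
    obtain ⟨q, hq, hq0, hxq⟩ := hx
    obtain ⟨q', hq', hq0', hyq⟩ := hy
    refine ⟨q * q', mul_mem hq hq', mul_ne_zero hq0 hq0', ?_⟩
    rw [mul_mul_mul_comm]
    exact mul_mem hxq hyq

include hv hv2 hI hc hD in
theorem mem_of_isRatPoly (hA : ∀ x ∈ A, IsInvariant x) {f : JetRat m} (hf : IsInvariant f)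
    (hf' : IsRatPoly f) : f ∈ A := by
  obtain ⟨q, hq, hq0, hfq⟩ := hv.exists_mul_mem_polyOver hI
    (fun i => IntermediateField.subset_adjoin _ _ ⟨i, rfl⟩)
    (hv.isRatPoly_mem_extend hv2 hI hc hD hf')
  exact hv.mem_of_mul_mem hI hA hf hq0 hq hfq

include hv hv2 in
theorem mem_of_isInvariant {E : IntermediateField ℝ (JetRat m)}
    (hI : ∀ i, gramDiag gen v i ∈ E) (hc : ∀ p, structureCoeff v p ∈ E)
    (hD : ∀ k : Fin (2 * m + 1), ∀ f ∈ E, horizontal (v k.succ) f ∈ E)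
    (hE : ∀ x ∈ E, IsInvariant x) {f : JetRat m} (hf : IsInvariant f) : f ∈ E := by
  have hI' : IntermediateField.adjoin ℝ (Set.range (gramDiag gen v)) ≤ E := by
    rw [IntermediateField.adjoin_le_iff]
    rintro _ ⟨i, rfl⟩
    exact hI i
  have h1 := fun p => hv.exists_mul_mem_polyOver (A := E.toSubalgebra) (fun _ hx => hx) hI
    (hv.toRat_mem_extend hv2 (A := E.toSubalgebra) hI' hc hD p)
  obtain ⟨p, q, hq, hfq⟩ := exists_num_denom f
  obtain ⟨r, hr, hr0, hpr⟩ := h1 p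
  obtain ⟨s, hs, hs0, hqs⟩ := h1 q
  refine hv.mem_of_mul_mem (A := E.toSubalgebra) (fun _ hx => hx) hE hf
    (mul_ne_zero (mul_ne_zero (toRat_ne_zero.2 hq) hs0) hr0) (mul_mem hqs hr) ?_
  have : f * (toRat q * s * r) = toRat p * r * s := by rw [← hfq]; ring
  rw [this]
  exact mul_mem hpr hs

include hv hv2 in
-- Applying the bracket of two derivations to every `I_{2,a}` gives a linear system for the
-- structure coefficients whose matrix `∇_l I_{2,a}` is invertible and whose entries lie in `E`.
theorem structureCoeff_mem_field {E : IntermediateField ℝ (JetRat m)}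
    (hI : ∀ i, gramDiag gen v i ∈ E)
    (hD : ∀ k : Fin (2 * m + 1), ∀ f ∈ E, horizontal (v k.succ) f ∈ E)
    (p : Fin (2 * m + 1) × Fin (2 * m + 1) × Fin (2 * m + 1)) : structureCoeff v p ∈ E := by
  obtain ⟨i, k, l⟩ := p
  refine mem_of_mulVec_mem (E := E) (S := E.toSubalgebra) (fun _ hx => hx)
    (M := (Matrix.of fun i l : Fin (2 * m + 1) =>
      horizontal (v i.succ) (gramDiag gen v l)).transpose)
    (θ := fun l => structureCoeff v (i, k, l)) (fun a b => hD _ _ (hI _)) ?_ (fun a => ?_) l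
  · rw [Matrix.det_transpose]
    exact hv.det_nabla_gramDiag_ne_zero hv2
  · have h1 := congrArg (fun d => d (gramDiag gen v a)) (hv.bracket_nabla i k)
    simp only [Derivation.commutator_apply, derivation_sum_apply] at h1
    have h2 : horizontal (v i.succ) (horizontal (v k.succ) (gramDiag gen v a)) -
        horizontal (v k.succ) (horizontal (v i.succ) (gramDiag gen v a)) ∈ E :=
      sub_mem (hD _ _ (hD _ _ (hI a))) (hD _ _ (hD _ _ (hI a)))
    rw [h1] at h2
    refine (congrArg (· ∈ E) (Finset.sum_congr rfl fun l _ => ?_)).mp h2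
    exact mul_comm _ _

include hv hv2 in
theorem invariants_eq : {f : JetRat m | IsInvariant f} =
    (diffField (gramDiag gen v) (fun k : Fin (2 * m + 1) => horizontal (v k.succ)) : Set (JetRat m)) := by
  refine Set.Subset.antisymm (fun f hf => ?_) hv.diffField_le
  rw [diffField, SetLike.mem_coe, IntermediateField.mem_sInf]
  have hI : ∀ i, gramDiag gen v i ∈ diffField (gramDiag gen v) fun k : Fin (2 * m + 1) => horizontal (v k.succ) :=
    fun i => IntermediateField.mem_sInf.2 fun E hE => hE.1 i
  have hD : ∀ k : Fin (2 * m + 1), ∀ f ∈ diffField (gramDiag gen v) fun k : Fin (2 * m + 1) => horizontal (v k.succ),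
      horizontal (v k.succ) f ∈ diffField (gramDiag gen v) fun k : Fin (2 * m + 1) => horizontal (v k.succ) :=
    fun k f hf => IntermediateField.mem_sInf.2 fun E hE =>
      hE.2 k f (IntermediateField.mem_sInf.1 hf E hE)
  exact IntermediateField.mem_sInf.1 (hv.mem_of_isInvariant hv2 hI
    (hv.structureCoeff_mem_field hv2 hI hD) hD (fun x hx => hv.diffField_le hx) hf)

include hv hv2 in
theorem polyInvariants_eq : {f : JetRat m | IsInvariant f ∧ IsRatPoly f} =
    (diffAlgebra (gramDiag gen v) (structureCoeff v) (fun k : Fin (2 * m + 1) => horizontal (v k.succ)) :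
      Set (JetRat m)) := by
  refine Set.Subset.antisymm (fun f hf => ?_) (hv.diffAlgebra_le hv2)
  refine hv.mem_of_isRatPoly hv2 (fun f hf => ?_) (fun p => ?_) (fun k f hf => ?_)
    (fun x hx => (hv.diffAlgebra_le hv2 hx).1) hf.1 hf.2
  · exact Algebra.mem_sInf.2 fun S hS => hS.1 f hf
  · exact Algebra.mem_sInf.2 fun S hS => hS.2.1 p
  · exact Algebra.mem_sInf.2 fun S hS => hS.2.2 k f (Algebra.mem_sInf.1 hf S hS)

end IsCanonicalFrame

end generation

end SympHyp

end

/-! ### The theorem -/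

theorem mainTheorem3 (m : ℕ) :
    -- the canonical frame, with coefficients rational functions on the space of 2-jets
    ∃ v : Fin (2 * m + 1 + 1) → SympHyp.Idx m → SympHyp.JetRat m,
      SympHyp.IsCanonicalFrame SympHyp.gen v ∧
      (∀ w, SympHyp.IsCanonicalFrame SympHyp.gen w → w = v) ∧
      (∀ i a, v i a ∈ SympHyp.ratOrd m 2) ∧
      SympHyp.HasNormalForm SympHyp.gen v ∧
      -- on a nonempty Zariski open set of 2-jets it is the unique canonical frame
      (∃ P : SympHyp.JetPoly m, P ≠ 0 ∧ (∀ t ∈ P.vars, t.ord ≤ 2) ∧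
        ∀ j : SympHyp.JetVar m → ℝ, MvPolynomial.eval j P ≠ 0 →
          ∃ w : Fin (2 * m + 1 + 1) → SympHyp.Idx m → ℝ,
            SympHyp.IsCanonicalFrame j w ∧
            (∀ w', SympHyp.IsCanonicalFrame j w' → w' = w) ∧
            SympHyp.HasNormalForm j w ∧
            ∀ i a, SympHyp.HasValue (v i a) j (w i a)) ∧
      -- the invariants `I_{2,i}` and the derivations `∇_k`
      ∃ (I : Fin (2 * m + 1) → SympHyp.JetRat m)
        (nabla : Fin (2 * m + 1) →
          Derivation ℝ (SympHyp.JetRat m) (SympHyp.JetRat m)),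
        I = SympHyp.gramDiag SympHyp.gen v ∧
        (∀ k, nabla k = SympHyp.horizontal (v k.succ)) ∧
        (∀ i, I i ∈ SympHyp.ratOrd m 2 ∧ SympHyp.IsInvariant (I i)) ∧
        (∀ k, SympHyp.IsInvariantDer (nabla k)) ∧
        LinearIndependent (SympHyp.JetRat m) nabla ∧
        -- generation of the rational differential invariants by the `I_{2,i}` and `∇_k`
        {f : SympHyp.JetRat m | SympHyp.IsInvariant f} =
          (SympHyp.diffField I nabla : Set (SympHyp.JetRat m)) ∧
        -- generation of the invariants polynomial in the jets of order `> 2`, with the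
        -- structure coefficients of the frame included
        ∃ c : Fin (2 * m + 1) × Fin (2 * m + 1) × Fin (2 * m + 1) → SympHyp.JetRat m,
          (∀ i k, ⁅nabla i, nabla k⁆ = ∑ l, c (i, k, l) • nabla l) ∧
          {f : SympHyp.JetRat m | SympHyp.IsInvariant f ∧ SympHyp.IsRatPoly f} =
            (SympHyp.diffAlgebra I c nabla : Set (SympHyp.JetRat m)) := by
  obtain ⟨v, hv, hv2⟩ := SympHyp.exists_generic_frame (m := m)
  exact ⟨v, hv, fun w hw => hv.unique hw SympHyp.det_hess_gen_ne_zero, hv2, hv.hasNormalForm,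
    SympHyp.exists_frame_domain hv hv2,
    SympHyp.gramDiag SympHyp.gen v, fun k => SympHyp.horizontal (v k.succ), rfl, fun _ => rfl,
    fun i => ⟨SympHyp.IsCanonicalFrame.gramDiag_mem_ratOrd hv2 i, hv.isInvariant_gramDiag i⟩,
    fun k => hv.isInvariantDer (Fin.succ_ne_zero k), hv.linearIndependent_nabla,
    hv.invariants_eq hv2, SympHyp.structureCoeff v, fun i k => hv.bracket_nabla i k,
    hv.polyInvariants_eq hv2⟩
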